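/- **Theorem 1.** A *cell* is a closed regular hexagon of side $\frac12$ with two vertical sides. The centres of the cells of a hexagonal grid are $t+ae_1+be_2$ with $a,b\in\mathbb Z$, where $e_1=(\frac{\sqrt3}{2},0)$, $e_2=(\frac{\sqrt3}{4},\frac34)$. A *septa-hexagon* with centre $c$ is the union of the cell centred at $c$ and its six neighbouring cells. For $t\in\mathbb R^2$ let $\mathcal T_t$ be the family of the septa-hexagons $C_{a,b}$ with centres $t+a(2e_1+e_2)+b(3e_2-e_1)$, $a,b\in\mathbb Z$, and let the colour of $C_{a,b}$ be the pair of parities of $a$ and $b$ (four colours; the six neighbours of a septa-hexagon have the other three colours, opposite neighbours the same one). For a finite set $S\subset\mathbb R^2$, a *dominating set* is a $D\subseteq S$ such that every point of $S$ is at distance at most $1$ from some point of $D$. For a septa-hexagon $C$ put $S_1=S\cap C$ and let $S_2$ be the set of points of $S$ at distance at most $1$ from some point of $S_1$. The *single septa-hexagon problem* asks for a minimum size $S'\subseteq S_2$ such that the unit disks centred at $S'$ cover $S_1$. A *4-coloured septa-hexagonal partition for $S$* is a family of translates of the septa-hexagon with pairwise disjoint interiors, each coloured with one of four colours, such that every point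 of $S$ is in the interior of one of them and any two points in the interiors of distinct septa-hexagons of the same colour are more than distance $2$ apart. 1. For every $t$, the septa-hexagons of $\mathcal T_t$ cover the plane and have pairwise disjoint interiors, and any two points in the interiors of distinct septa-hexagons of $\mathcal T_t$ of the same colour are more than distance $2$ apart. 2. For every finite $S$ there is a $t$ such that no point of $S$ is on the boundary of a septa-hexagon of $\mathcal T_t$, and for every such $t$ the coloured family $\mathcal T_t$ is a 4-coloured septa-hexagonal partition for $S$. 3. For every finite $S$ and every 4-coloured septa-hexagonal partition for $S$, each single septa-hexagon problem has an optimum solution, every optimum solution has at most $7$ points, and the union of any choice of optimum solutions, one for each septa-hexagon, is a dominating set of $S$ of size at most $4$ times that of a minimum dominating set. 4. There is an algorithm on the real RAM (unit cost for addition and truncated subtraction of natural numbers, exact real arithmetic $+,-,\times,\div,\sqrt{\ }$, comparisons, and indirect addressing; no rounding) which, given the coordinates of any $n\ge0$ distinct points forming a set $S$, outputs the union of optimum solutions, one for each septa-hexagon, for some 4-coloured septa-hexagonal partition for $S$ in which any two septa-hexagons that meet a common unit disk belong to a common family $\mathcal T_t$. The output is a dominating set of $S$ of size at most $4$ times that of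 a minimum dominating set, and the running time is $O(n^6\log n)$. -/

import Mathlib

/-! ### Dominating sets of planar point sets by unit disks -/

/-- The Euclidean plane. -/
abbrev Plane : Type := EuclideanSpace ℝ (Fin 2)

/-- The unit radius disks centred at the points of `D` cover all the points of `T`. -/
def Covers (D T : Finset Plane) : Prop :=
  ∀ s ∈ T, ∃ d ∈ D, s ∈ Metric.closedBall d 1

/-- `D` is a dominating set of the point set `S`. -/
def IsDominatingSet (S D : Finset Plane) : Prop :=
  D ⊆ S ∧ Covers D S

/-- `D` is a dominating set of `S` whose size is at most `k` times the size of any dominating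
set of `S`, in particular of a minimum one. -/
def IsApproxMDS (k : ℕ) (S D : Finset Plane) : Prop :=
  IsDominatingSet S D ∧ ∀ O : Finset Plane, IsDominatingSet S O → D.card ≤ k * O.card

open Classical in
/-- The points of `U₂` whose unit disk covers at least one point of `U₁`. -/
noncomputable def coverers (U₁ U₂ : Finset Plane) : Finset Plane :=
  U₂.filter fun q => ∃ p ∈ U₁, p ∈ Metric.closedBall q 1

/-! ### Cells, septa-hexagons, and their 4-coloured tiling -/

/-- The closed regular hexagon of side length `1/2` (apothem `√3/4`) with centre `c` and two
vertical sides, as the intersection of three strips. -/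
def cell (c : Plane) : Set Plane :=
  {x | |x 0 - c 0| ≤ √3 / 4 ∧
       |(x 0 - c 0) / 2 + √3 / 2 * (x 1 - c 1)| ≤ √3 / 4 ∧
       |(x 0 - c 0) / 2 - √3 / 2 * (x 1 - c 1)| ≤ √3 / 4}

/-- The centres of the cells of the hexagonal grid are the integer combinations of `e₁`, `e₂`. -/
noncomputable def e₁ : Plane := !₂[√3 / 2, 0]

/-- See `e₁`. -/
noncomputable def e₂ : Plane := !₂[√3 / 4, 3 / 4]

/-- The septa-hexagon with centre `c`: a cell together with its six neighbours. -/
def septaHexagon (c : Plane) : Set Plane :=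
  cell c ∪ cell (c + e₁) ∪ cell (c - e₁) ∪ cell (c + e₂) ∪ cell (c - e₂) ∪
    cell (c + (e₁ - e₂)) ∪ cell (c - (e₁ - e₂))

/-- The centre of the septa-hexagon with index `z` in the tiling of the plane by septa-hexagons
that has a septa-hexagon centred at `t`. -/
noncomputable def tileCentre (t : Plane) (z : ℤ × ℤ) : Plane :=
  t + (z.1 : ℝ) • ((2 : ℝ) • e₁ + e₂) + (z.2 : ℝ) • ((3 : ℝ) • e₂ - e₁)

/-- The 4-colouring: the six neighbours of a septa-hexagon get the three other colours, opposite
neighbours the same one. -/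
def tileColour (z : ℤ × ℤ) : Fin 4 :=
  if Even z.1 then (if Even z.2 then 0 else 1) else (if Even z.2 then 2 else 3)

/-- Any two points in the interiors of distinct septa-hexagons of the same colour are more than
distance `2` apart. -/
def SameColourFar {ι : Type} (centre : ι → Plane) (colour : ι → Fin 4) : Prop :=
  ∀ i j, i ≠ j → colour i = colour j →
    ∀ x ∈ interior (septaHexagon (centre i)), ∀ y ∈ interior (septaHexagon (centre j)),
      2 < dist x y

/-- Distinct septa-hexagons of the family have no common interior point. -/
def NonOverlapping {ι : Type} (centre : ι → Plane) : Prop :=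
  ∀ i j, i ≠ j →
    Disjoint (interior (septaHexagon (centre i))) (interior (septaHexagon (centre j)))

/-- The family is a partition of a region around `S` into 4-coloured septa-hexagons: they do not overlap, every
point of `S` is inside one of them, not on the boundary, and those of the same colour are
more than distance `2` apart. -/
def IsColouredSeptaPartition (S : Finset Plane) {ι : Type} (centre : ι → Plane)
    (colour : ι → Fin 4) : Prop :=
  NonOverlapping centre ∧
  (∀ s ∈ S, ∃ i, s ∈ interior (septaHexagon (centre i))) ∧
  SameColourFar centre colour

/-- Around every unit disk the family looks like the tiling: septa-hexagons that meet a common unit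
disk belong to a common copy of the tiling. -/
def FollowsTiling {ι : Type} (centre : ι → Plane) : Prop :=
  ∀ i j, (∃ d : Plane, (septaHexagon (centre i) ∩ Metric.closedBall d 1).Nonempty ∧
      (septaHexagon (centre j) ∩ Metric.closedBall d 1).Nonempty) →
    ∃ z, centre j = tileCentre (centre i) z

open Classical in
/-- The points of `S` in the septa-hexagon with centre `c`. -/
noncomputable def pointsIn (S : Finset Plane) (c : Plane) : Finset Plane :=
  S.filter fun s => s ∈ septaHexagon c

/-- `D` covers the points `S₁` of `S` in the septa-hexagon with centre `c` by disks centred at points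
of `S` that cover at least one point of `S₁`. -/
def IsSeptaCover (S : Finset Plane) (c : Plane) (D : Finset Plane) : Prop :=
  D ⊆ coverers (pointsIn S c) S ∧ Covers D (pointsIn S c)

/-- `D` is an optimum solution of the single septa-hexagon problem. -/
def IsSeptaOptimum (S : Finset Plane) (c : Plane) (D : Finset Plane) : Prop :=
  IsSeptaCover S c D ∧ ∀ D', IsSeptaCover S c D' → D.card ≤ D'.card

open Classical in
/-- The union of the subsets `L i` of `S`. -/
noncomputable def combine (S : Finset Plane) {ι : Type} (L : ι → Finset Plane) : Finset Plane :=
  S.filter fun s => ∃ i, s ∈ L i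

/-! ### The real RAM

Programs over countably many arrays of natural numbers and of real numbers (a program mentions only
finitely many of them), with unit cost for every operation. Real arithmetic is exact and includes
square roots; there is no rounding, and a real number cannot be turned into an index. -/

/-- The memory: `nat A i` and `real A i` are the entries with index `i` of the arrays called `A`. -/
structure Memory where
  nat : ℕ → ℕ → ℕ
  real : ℕ → ℕ → ℝ

/-- Natural number expressions (subtraction is truncated). -/
inductive NatExp where
  | const (k : ℕ)
  | get (A : ℕ) (i : NatExp)
  | add (a b : NatExp)
  | sub (a b : NatExp)

namespace NatExp

/-- The value of an expression. -/
def eval (m : Memory) : NatExp → ℕ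
  | const k => k
  | get A i => m.nat A (i.eval m)
  | add a b => a.eval m + b.eval m
  | sub a b => a.eval m - b.eval m

/-- The number of operations in an expression. -/
def cost : NatExp → ℕ
  | const _ => 1
  | get _ i => i.cost + 1
  | add a b => a.cost + b.cost + 1
  | sub a b => a.cost + b.cost + 1

end NatExp

/-- Real number expressions. -/
inductive RealExp where
  | const (k : ℕ)
  | get (A : ℕ) (i : NatExp)
  | add (a b : RealExp)
  | sub (a b : RealExp)
  | mul (a b : RealExp)
  | div (a b : RealExp)
  | sqrt (a : RealExp)

namespace RealExp

/-- The value of an expression. -/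
noncomputable def eval (m : Memory) : RealExp → ℝ
  | const k => k
  | get A i => m.real A (i.eval m)
  | add a b => a.eval m + b.eval m
  | sub a b => a.eval m - b.eval m
  | mul a b => a.eval m * b.eval m
  | div a b => a.eval m / b.eval m
  | sqrt a => √(a.eval m)

/-- The number of operations in an expression. -/
def cost : RealExp → ℕ
  | const _ => 1
  | get _ i => i.cost + 1
  | add a b => a.cost + b.cost + 1
  | sub a b => a.cost + b.cost + 1
  | mul a b => a.cost + b.cost + 1
  | div a b => a.cost + b.cost + 1
  | sqrt a => a.cost + 1

end RealExp

/-- Tests. -/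
inductive Test where
  | natLe (a b : NatExp)
  | realLe (a b : RealExp)
  | not (a : Test)
  | and (a b : Test)

namespace Test

/-- The truth value of a test. -/
def Holds (m : Memory) : Test → Prop
  | natLe a b => a.eval m ≤ b.eval m
  | realLe a b => a.eval m ≤ b.eval m
  | not a => ¬ a.Holds m
  | and a b => a.Holds m ∧ b.Holds m

/-- The number of operations in a test. -/
def cost : Test → ℕ
  | natLe a b => a.cost + b.cost + 1
  | realLe a b => a.cost + b.cost + 1
  | not a => a.cost + 1
  | and a b => a.cost + b.cost + 1

end Test

/-- Programs. -/
inductive Program where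
  | skip
  | setNat (A : ℕ) (i e : NatExp)
  | setReal (A : ℕ) (i : NatExp) (e : RealExp)
  | seq (p q : Program)
  | cond (b : Test) (p q : Program)
  | loop (b : Test) (p : Program)

namespace Memory

/-- Write `v` to entry `i` of the natural number array `A`. -/
def writeNat (m : Memory) (A i v : ℕ) : Memory :=
  { m with nat := Function.update m.nat A (Function.update (m.nat A) i v) }

/-- Write `v` to entry `i` of the real number array `A`. -/
noncomputable def writeReal (m : Memory) (A i : ℕ) (v : ℝ) : Memory :=
  { m with real := Function.update m.real A (Function.update (m.real A) i v) }

end Memory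

/-- `Runs p m T m'`: started in memory `m`, the program `p` halts after `T` steps in memory `m'`.
`loop b p` repeats `p` as long as `b` holds. -/
inductive Runs : Program → Memory → ℕ → Memory → Prop where
  | skip (m : Memory) : Runs .skip m 1 m
  | setNat (m : Memory) (A : ℕ) (i e : NatExp) :
      Runs (.setNat A i e) m (i.cost + e.cost + 1) (m.writeNat A (i.eval m) (e.eval m))
  | setReal (m : Memory) (A : ℕ) (i : NatExp) (e : RealExp) :
      Runs (.setReal A i e) m (i.cost + e.cost + 1) (m.writeReal A (i.eval m) (e.eval m))
  | seq {p q : Program} {m m₁ m₂ : Memory} {T₁ T₂ : ℕ} :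
      Runs p m T₁ m₁ → Runs q m₁ T₂ m₂ → Runs (.seq p q) m (T₁ + T₂) m₂
  | cond_true {b : Test} {p q : Program} {m m' : Memory} {T : ℕ} :
      b.Holds m → Runs p m T m' → Runs (.cond b p q) m (b.cost + 1 + T) m'
  | cond_false {b : Test} {p q : Program} {m m' : Memory} {T : ℕ} :
      ¬ b.Holds m → Runs q m T m' → Runs (.cond b p q) m (b.cost + 1 + T) m'
  | loop_false {b : Test} {p : Program} {m : Memory} :
      ¬ b.Holds m → Runs (.loop b p) m (b.cost + 1) m
  | loop_true {b : Test} {p : Program} {m m₁ m₂ : Memory} {T₁ T₂ : ℕ} :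
      b.Holds m → Runs p m T₁ m₁ → Runs (.loop b p) m₁ T₂ m₂ →
      Runs (.loop b p) m (b.cost + 1 + T₁ + T₂) m₂

/-- The initial memory on input `P`: entry `0` of the natural number array `0` is `n`, the real number
arrays `0` and `1` hold the coordinates of the points, and all other entries are `0`. -/
noncomputable def inputMemory {n : ℕ} (P : Fin n ↪ Plane) : Memory where
  nat A i := if A = 0 ∧ i = 0 then n else 0
  real A i := if h : i < n then (if A = 0 then P ⟨i, h⟩ 0 else if A = 1 then P ⟨i, h⟩ 1 else 0) else 0

/-- The final memory `m` describes the subset `D` of the points of `P`: entry `0` of the natural number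
array `1` is a number `k`, and the first `k` entries of the natural number array `2` are the indices
of the points of `D`. -/
def IsOutput {n : ℕ} (P : Fin n ↪ Plane) (m : Memory) (D : Finset Plane) : Prop :=
  (∀ j < m.nat 1 0, m.nat 2 j < n) ∧
  ∀ x : Plane, x ∈ D ↔ ∃ j < m.nat 1 0, ∃ i : Fin n, m.nat 2 j = i ∧ P i = x

set_option linter.unusedSimpArgs false

/-! ### Reasoning about programs -/

/-! Geometry. In the coordinates `xi`, `eta` everything about cells becomes integral. The centres of
the septa-hexagons form a sublattice of index 7 in the lattice of cell centres, and the seven cells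
of a septa-hexagon represent its cosets; hence covering (`exists_halfTile`) and non-overlap
(`tile_eq_of_open`). A septa-hexagon lies in three strips (`Tile.bound`), and for two of equal
colour the strips in one of the three directions are at least 2 apart (`sameColourFar_tileCentre`).
A boundary point has an integral coordinate relative to the centre, so only countably many shifts
along `e₁` are bad for a finite set (`exists_generic`).

Approximation. A cell has diameter 1, so one point from each occupied cell solves a single problem
with at most 7 disks (`exists_cover_seven`). If O is any dominating set, the points of O that reach
the points of S in a septa-hexagon solve its problem, so the optimum there is no larger. Two points
reached by one unit disk are within distance 2, so an element of O reaches at most one septa-hexagon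
of each colour and is counted at most four times (`isApproxMDS_combine`).

Algorithm for one septa-hexagon, with candidate list Q. Covers of size 1 to 6 are tried in turn: all
disks but the last are enumerated, and the last is found in almost linear time (`reaches_search`).
That last step asks which candidates lie in every unit disk around the uncovered points, that is,
below all upper half-circles and above all lower ones. The heights of the arcs over the candidates
form a matrix with the Monge property, because the half-circle is concave (`monge_arcMatrix`). So
the columns of the row minima are monotone, and all minima are found in O((R + C) log n) steps by
halving strides (`reaches_rowMinima`). If six disks fail, a greedy choice needs at most seven, since
eight pairwise distant points do not fit in seven cells (`reaches_solveTile`).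

Placing the points. The machine cannot round, so the indices of a septa-hexagon are found by trial,
and the range to try must be O(n). Each coordinate is therefore measured from a root: the nearest
value not above it with a gap of more than 8 below. A point is at most `8 * n` from its root in each
coordinate, and points with different roots are too far apart to interact, so each pair of roots may
carry its own copy of the tiling (`IsCentring.roots_eq`). Ties on boundaries are broken by half-open
cells, which amounts to a small shift of the tiling (`IsPrepared.exists_centring`).

Running time. One septa-hexagon costs O(|Q| n^5 log n), and each point is a candidate for at most 49
septa-hexagons (`IsPrepared.sum_tileWork_le`), which gives O(n^6 log n). -/

/-- Started in `m`, the program `p` halts within `T` steps in a memory satisfying `Q`. -/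
def Reaches (p : Program) (m : Memory) (T : ℕ) (Q : Memory → Prop) : Prop :=
  ∃ T' m', Runs p m T' m' ∧ T' ≤ T ∧ Q m'

theorem Reaches.mono {p : Program} {m : Memory} {T T' : ℕ} {Q Q' : Memory → Prop}
    (h : Reaches p m T Q) (hT : T ≤ T') (hQ : ∀ m', Q m' → Q' m') : Reaches p m T' Q' := by
  obtain ⟨t, m', hr, ht, hq⟩ := h
  exact ⟨t, m', hr, ht.trans hT, hQ _ hq⟩

theorem Reaches.seq {p q : Program} {m : Memory} {T₁ T₂ : ℕ} {Q₁ Q : Memory → Prop}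
    (h₁ : Reaches p m T₁ Q₁) (h₂ : ∀ m', Q₁ m' → Reaches q m' T₂ Q) :
    Reaches (.seq p q) m (T₁ + T₂) Q := by
  obtain ⟨t, m', hr, ht, hq⟩ := h₁
  obtain ⟨t', m'', hr', ht', hq'⟩ := h₂ m' hq
  exact ⟨t + t', m'', .seq hr hr', by omega, hq'⟩

theorem Reaches.cond {b : Test} {p q : Program} {m : Memory} {T : ℕ} {Q : Memory → Prop}
    (hp : b.Holds m → Reaches p m T Q) (hq : ¬ b.Holds m → Reaches q m T Q) :
    Reaches (.cond b p q) m (b.cost + 1 + T) Q := by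
  by_cases hb : b.Holds m
  · obtain ⟨t, m', hr, ht, h⟩ := hp hb
    exact ⟨_, m', .cond_true hb hr, by omega, h⟩
  · obtain ⟨t, m', hr, ht, h⟩ := hq hb
    exact ⟨_, m', .cond_false hb hr, by omega, h⟩

/-- `Runs` unfolds a loop from the front, so the induction is on the number of iterations still to
come. The cost `t` may vary with the iteration; the amortised bounds rely on this. -/
theorem Reaches.loop {b : Test} {p : Program} (I : ℕ → Memory → Prop) (t : ℕ → ℕ) (N : ℕ)
    (hstep : ∀ i < N, ∀ m', I i m' → b.Holds m' ∧ Reaches p m' (t i) (I (i + 1)))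
    (hend : ∀ m', I N m' → ¬ b.Holds m') {m : Memory} (h0 : I 0 m) :
    Reaches (.loop b p) m (∑ i ∈ Finset.range N, (t i + (b.cost + 1)) + (b.cost + 1)) (I N) := by
  suffices H : ∀ d i, i + d = N → ∀ m', I i m' → Reaches (.loop b p) m'
      (∑ j ∈ Finset.range d, (t (i + j) + (b.cost + 1)) + (b.cost + 1)) (I N) by
    simpa using H N 0 (by simp) m h0
  intro d
  induction d with
  | zero =>
    intro i hi m' hm'
    obtain rfl : i = N := by omega
    exact ⟨_, m', .loop_false (hend m' hm'), by simp, hm'⟩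
  | succ d ih =>
    intro i hi m' hm'
    obtain ⟨hb, T₁, m₁, hr, hT, hI⟩ := hstep i (by omega) m' hm'
    obtain ⟨T₂, m₂, hr₂, hT₂, hI₂⟩ := ih (i + 1) (by omega) m₁ hI
    refine ⟨_, m₂, .loop_true hb hr hr₂, ?_, hI₂⟩
    rw [Finset.sum_range_succ']
    have : ∀ j, i + 1 + j = i + (j + 1) := fun j => by omega
    simp only [this] at hT₂
    simp only [add_zero]
    omega

open Classical in
/-- The memory `m₁` or `m₂`, as `b` holds or not. -/
noncomputable def branch (b : Prop) (m₁ m₂ : Memory) : Memory := if b then m₁ else m₂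

theorem branch_pos {b : Prop} (h : b) (m₁ m₂ : Memory) : branch b m₁ m₂ = m₁ := if_pos h

theorem branch_neg {b : Prop} (h : ¬ b) (m₁ m₂ : Memory) : branch b m₁ m₂ = m₂ := if_neg h

namespace Program

/-- The program contains no loop. -/
def LoopFree : Program → Prop
  | seq p q => p.LoopFree ∧ q.LoopFree
  | cond _ p q => p.LoopFree ∧ q.LoopFree
  | loop _ _ => False
  | _ => True

/-- The final memory of a loop-free program. -/
noncomputable def exec : Program → Memory → Memory
  | skip, m => m
  | setNat A i e, m => m.writeNat A (i.eval m) (e.eval m)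
  | setReal A i e, m => m.writeReal A (i.eval m) (e.eval m)
  | seq p q, m => q.exec (p.exec m)
  | cond b p q, m => branch (b.Holds m) (p.exec m) (q.exec m)
  | loop _ _, m => m

/-- A bound for the running time of a loop-free program. -/
def maxCost : Program → ℕ
  | skip => 1
  | setNat _ i e => i.cost + e.cost + 1
  | setReal _ i e => i.cost + e.cost + 1
  | seq p q => p.maxCost + q.maxCost
  | cond b p q => b.cost + 1 + (p.maxCost + q.maxCost)
  | loop _ _ => 0

end Program

/-- Straight-line code is verified by computing `exec` symbolically. Charging both branches of a
conditional loses only a constant that depends on the program alone. -/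
theorem reaches_of_loopFree {p : Program} (hp : p.LoopFree) {m : Memory} {Q : Memory → Prop}
    (hQ : Q (p.exec m)) : Reaches p m p.maxCost Q := by
  suffices H : ∀ m, Reaches p m p.maxCost (fun m' => m' = p.exec m) from
    (H m).mono le_rfl (by rintro _ rfl; exact hQ)
  clear hQ m
  induction p with
  | skip => exact fun m => ⟨_, _, .skip m, le_rfl, rfl⟩
  | setNat A i e => exact fun m => ⟨_, _, .setNat m A i e, le_rfl, rfl⟩
  | setReal A i e => exact fun m => ⟨_, _, .setReal m A i e, le_rfl, rfl⟩
  | seq p q ihp ihq =>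
    intro m
    exact (ihp hp.1 m).seq (by rintro _ rfl; exact ihq hp.2 _)
  | cond b p q ihp ihq =>
    intro m
    refine Reaches.cond (fun hb => ?_) (fun hb => ?_)
    · exact (ihp hp.1 m).mono (by omega) (by rintro _ rfl; simp [Program.exec, branch, hb])
    · exact (ihq hp.2 m).mono (by omega) (by rintro _ rfl; simp [Program.exec, branch, hb])
  | loop b p => exact hp.elim

namespace Memory

theorem nat_writeNat (m : Memory) (A i v B j : ℕ) :
    (m.writeNat A i v).nat B j = if B = A ∧ j = i then v else m.nat B j := by
  by_cases hB : B = A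
  · subst hB
    by_cases hj : j = i <;> simp [writeNat, Function.update, hj]
  · simp [writeNat, Function.update, hB]

theorem real_writeReal (m : Memory) (A i : ℕ) (v : ℝ) (B j : ℕ) :
    (m.writeReal A i v).real B j = if B = A ∧ j = i then v else m.real B j := by
  by_cases hB : B = A
  · subst hB
    by_cases hj : j = i <;> simp [writeReal, Function.update, hj]
  · simp [writeReal, Function.update, hB]

@[simp] theorem real_writeNat (m : Memory) (A i v : ℕ) : (m.writeNat A i v).real = m.real := rfl

@[simp] theorem nat_writeReal (m : Memory) (A i : ℕ) (v : ℝ) :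
    (m.writeReal A i v).nat = m.nat := rfl

end Memory

/-- Only arrays in `N` differ. -/
def Frame (N : Set ℕ) (m m' : Memory) : Prop :=
  ∀ A, A ∉ N → m'.nat A = m.nat A ∧ m'.real A = m.real A

namespace Frame

theorem refl (N : Set ℕ) (m : Memory) : Frame N m m := fun _ _ => ⟨rfl, rfl⟩

theorem mono {N N' : Set ℕ} {m m' : Memory} (h : Frame N m m') (hN : N ⊆ N') : Frame N' m m' :=
  fun A hA => h A fun h' => hA (hN h')

theorem trans {N : Set ℕ} {m m' m'' : Memory} (h : Frame N m m') (h' : Frame N m' m'') :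
    Frame N m m'' :=
  fun A hA => ⟨(h' A hA).1.trans (h A hA).1, (h' A hA).2.trans (h A hA).2⟩

theorem writeNat {N : Set ℕ} {m m' : Memory} (h : Frame N m m') {A : ℕ} (hA : A ∈ N) (i v : ℕ) :
    Frame N m (m'.writeNat A i v) := by
  intro B hB
  refine ⟨?_, (h B hB).2⟩
  funext j
  rw [Memory.nat_writeNat, if_neg (by rintro ⟨rfl, -⟩; exact hB hA), (h B hB).1]

theorem writeReal {N : Set ℕ} {m m' : Memory} (h : Frame N m m') {A : ℕ} (hA : A ∈ N) (i : ℕ)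
    (v : ℝ) : Frame N m (m'.writeReal A i v) := by
  intro B hB
  refine ⟨(h B hB).1, ?_⟩
  funext j
  rw [Memory.real_writeReal, if_neg (by rintro ⟨rfl, -⟩; exact hB hA), (h B hB).2]

end Frame

/-! ### Lists in memory, bounded loops and filters -/

/-- The list stored in the array `A` with its length in the variable `B`. -/
def readList (m : Memory) (A B : ℕ) : List ℕ := (List.range (m.nat B 0)).map (m.nat A)

theorem length_readList (m : Memory) (A B : ℕ) : (readList m A B).length = m.nat B 0 := by
  simp [readList]

theorem readList_congr {m m' : Memory} {A B : ℕ} (hA : m'.nat A = m.nat A)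
    (hB : m'.nat B = m.nat B) : readList m' A B = readList m A B := by
  simp [readList, hA, hB]

theorem Frame.readList {N : Set ℕ} {m m' : Memory} (h : Frame N m m') {A B : ℕ} (hA : A ∉ N)
    (hB : B ∉ N) : readList m' A B = readList m A B :=
  readList_congr (h A hA).1 (h B hB).1

theorem readList_push {m m' : Memory} {A B x : ℕ} (hB : m'.nat B 0 = m.nat B 0 + 1)
    (hA : ∀ i < m.nat B 0, m'.nat A i = m.nat A i) (hx : m'.nat A (m.nat B 0) = x) :
    readList m' A B = readList m A B ++ [x] := by
  simp only [readList, hB, List.range_succ, List.map_append, List.map_cons, List.map_nil, hx]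
  congr 1
  exact List.map_congr_left fun i hi => hA i (List.mem_range.1 hi)

theorem mem_readList {m : Memory} {A B x : ℕ} :
    x ∈ readList m A B ↔ ∃ i < m.nat B 0, m.nat A i = x := by
  simp [readList]

/-- The variable `A`. -/
abbrev var (A : ℕ) : NatExp := .get A (.const 0)

/-- Assignment to a variable. -/
abbrev assign (A : ℕ) (e : NatExp) : Program := .setNat A (.const 0) e

/-- Test for `a < b`. -/
abbrev Test.natLt (a b : NatExp) : Test := .not (.natLe b a)

/-- Repeat `p` for the values of the variable `c` below `N`. -/
def forLoop (c : ℕ) (N : NatExp) (p : Program) : Program :=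
  .seq (assign c (.const 0)) (.loop (.natLt (var c) N) (.seq p (assign c (.add (var c) (.const 1)))))

/-- The invariant must not notice changes of the counter (`hc`), and the body must return the
counter unchanged. The loop overhead is charged `n + 1` times because the last test fails. -/
theorem reaches_forLoop {c : ℕ} {N : NatExp} {p : Program} {m : Memory} (n : ℕ) (t : ℕ → ℕ)
    (I : ℕ → Memory → Prop) (h0 : I 0 m)
    (hc : ∀ i m' v, I i m' → I i (m'.writeNat c 0 v))
    (hN : ∀ i m', I i m' → N.eval m' = n)
    (hstep : ∀ i < n, ∀ m', I i m' → m'.nat c 0 = i →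
      Reaches p m' (t i) (fun m'' => I (i + 1) m'' ∧ m''.nat c 0 = i)) :
    Reaches (forLoop c N p) m (∑ i ∈ Finset.range n, t i + (n + 1) * (N.cost + 20))
      (fun m' => I n m' ∧ m'.nat c 0 = n) := by
  have h1 : Reaches (assign c (.const 0)) m 3 (fun m' => I 0 m' ∧ m'.nat c 0 = 0) := by
    refine (reaches_of_loopFree (by trivial) (Q := fun m' => I 0 m' ∧ m'.nat c 0 = 0) ?_).mono
      (by simp [Program.maxCost, NatExp.cost]) (fun _ h => h)
    exact ⟨hc 0 m _ h0, by simp [Program.exec, Memory.nat_writeNat, NatExp.eval]⟩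
  have h2 : ∀ m', (I 0 m' ∧ m'.nat c 0 = 0) → Reaches (.loop (.natLt (var c) N)
      (.seq p (assign c (.add (var c) (.const 1))))) m'
      (∑ i ∈ Finset.range n, ((t i + 7) + (N.cost + 5)) + (N.cost + 5))
      (fun m' => I n m' ∧ m'.nat c 0 = n) := by
    intro m' hm'
    refine (Reaches.loop (fun i m' => I i m' ∧ m'.nat c 0 = i) (fun i => t i + 7) n ?_ ?_ hm').mono
      ?_ (fun _ h => h)
    · rintro i hi m₁ ⟨h1, h2⟩
      refine ⟨by simp [Test.Holds, NatExp.eval, hN i m₁ h1, h2, hi], ?_⟩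
      refine ((hstep i hi m₁ h1 h2).seq (T₂ := 7) fun m₂ h => ?_).mono (by omega) (fun _ h => h)
      refine (reaches_of_loopFree (by trivial) ?_).mono
        (by simp [Program.maxCost, NatExp.cost]) (fun _ h => h)
      exact ⟨hc _ _ _ h.1, by simp [Program.exec, Memory.nat_writeNat, NatExp.eval, h.2]⟩
    · rintro m₁ ⟨h1, h2⟩
      simp [Test.Holds, NatExp.eval, hN n m₁ h1, h2]
    · simp only [Test.cost, NatExp.cost]
      have : N.cost + (0 + 1 + 1) + 1 + 1 = N.cost + 4 := by ring
      gcongr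
  refine (h1.seq h2).mono ?_ (fun _ h => h)
  rw [Finset.sum_add_distrib, Finset.sum_add_distrib]
  simp only [Finset.sum_const, Finset.card_range, smul_eq_mul]
  nlinarith

theorem reaches_forLoop_const {c : ℕ} {N : NatExp} {p : Program} {m : Memory} (n t : ℕ)
    (I : ℕ → Memory → Prop) (h0 : I 0 m)
    (hc : ∀ i m' v, I i m' → I i (m'.writeNat c 0 v))
    (hN : ∀ i m', I i m' → N.eval m' = n)
    (hstep : ∀ i < n, ∀ m', I i m' → m'.nat c 0 = i →
      Reaches p m' t (fun m'' => I (i + 1) m'' ∧ m''.nat c 0 = i)) :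
    Reaches (forLoop c N p) m ((n + 1) * (t + N.cost + 20)) (fun m' => I n m' ∧ m'.nat c 0 = n) := by
  refine (reaches_forLoop n (fun _ => t) I h0 hc hN hstep).mono ?_ (fun _ h => h)
  simp only [Finset.sum_const, Finset.card_range, smul_eq_mul]
  nlinarith

open Classical in
/-- The elements of a list with the property `p`. -/
noncomputable def select (p : ℕ → Prop) (l : List ℕ) : List ℕ := l.filter fun x => p x

theorem mem_select {p : ℕ → Prop} {l : List ℕ} {x : ℕ} : x ∈ select p l ↔ x ∈ l ∧ p x := by
  simp [select]

theorem select_append (p : ℕ → Prop) (l l' : List ℕ) :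
    select p (l ++ l') = select p l ++ select p l' := by
  simp [select]

theorem select_singleton_pos {p : ℕ → Prop} {x : ℕ} (h : p x) : select p [x] = [x] := by
  simp [select, h]

theorem select_singleton_neg {p : ℕ → Prop} {x : ℕ} (h : ¬ p x) : select p [x] = [] := by
  simp [select, h]

theorem select_congr {p q : ℕ → Prop} {l : List ℕ} (h : ∀ x ∈ l, (p x ↔ q x)) :
    select p l = select q l := by
  classical
  unfold select
  exact List.filter_congr fun x hx => by simp [h x hx]

theorem select_select (p q : ℕ → Prop) (l : List ℕ) :
    select p (select q l) = select (fun x => q x ∧ p x) l := by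
  simp only [select, List.filter_filter]
  exact List.filter_congr fun x _ => by by_cases h : q x <;> simp [h]

theorem length_select_le (p : ℕ → Prop) (l : List ℕ) : (select p l).length ≤ l.length :=
  List.length_filter_le _ _

/-- Collect in the list `(dst, dlen)` the elements of the list `(src, slen)` for which the program
`pre` sets variable `82` to a positive value; `pre` finds the element in variable `81`. -/
def filterLoop (src slen dst dlen : ℕ) (pre : Program) : Program :=
  .seq (assign dlen (.const 0))
    (forLoop 80 (var slen)
      (.seq (assign 81 (.get src (var 80)))
        (.seq pre
          (.cond (.natLe (.const 1) (var 82))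
            (.seq (.setNat dst (var dlen) (var 81)) (assign dlen (.add (var dlen) (.const 1))))
            .skip))))

/-- The arrays `80` to `89` are reserved for this loop: lists live below `80`, and `pre` may touch
only `82` to `89`, so that the counter and the current element survive. The invariant is that the
destination holds the selection from the prefix read so far. -/
theorem reaches_filterLoop {src slen dst dlen : ℕ} {pre : Program} {m : Memory} (p : ℕ → Prop)
    (t : ℕ) (hs : src < 80) (hsl : slen < 80) (hd : dst < 80) (hdl : dlen < 80)
    (h1 : dst ≠ src) (h2 : dst ≠ slen) (h3 : dlen ≠ src) (h4 : dlen ≠ slen) (h5 : dst ≠ dlen)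
    (hpre : ∀ m' x, Frame {A | A = dst ∨ A = dlen ∨ (80 ≤ A ∧ A < 90)} m m' → m'.nat 81 0 = x →
      x ∈ readList m src slen →
      Reaches pre m' t fun m'' => Frame {A | 82 ≤ A ∧ A < 90} m' m'' ∧ (1 ≤ m''.nat 82 0 ↔ p x)) :
    Reaches (filterLoop src slen dst dlen pre) m
      ((m.nat slen 0 + 1) * (t + 60))
      fun m' => Frame {A | A = dst ∨ A = dlen ∨ (80 ≤ A ∧ A < 90)} m m' ∧
        readList m' dst dlen = select p (readList m src slen) := by
  have hpost : ∀ m₁, m₁ = m.writeNat dlen 0 0 → Reaches (forLoop 80 (var slen)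
      (.seq (assign 81 (.get src (var 80)))
        (.seq pre
          (.cond (.natLe (.const 1) (var 82))
            (.seq (.setNat dst (var dlen) (var 81)) (assign dlen (.add (var dlen) (.const 1))))
            .skip)))) m₁ ((m.nat slen 0 + 1) * (t + 30 + 2 + 20)) (fun m' =>
        (Frame {A | A = dst ∨ A = dlen ∨ (80 ≤ A ∧ A < 90)} m m' ∧
        readList m' dst dlen = select p ((List.range (m.nat slen 0)).map (m.nat src))) ∧
        m'.nat 80 0 = m.nat slen 0) := by
    rintro m₁ rfl
    refine reaches_forLoop_const (m.nat slen 0) (t + 30)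
      (fun i m' => Frame {A | A = dst ∨ A = dlen ∨ (80 ≤ A ∧ A < 90)} m m' ∧
        readList m' dst dlen = select p ((List.range i).map (m.nat src))) ?_ ?_ ?_ ?_
    · refine ⟨(Frame.refl _ _).writeNat (by simp) _ _, ?_⟩
      simp [readList, Memory.nat_writeNat, select]
    · rintro i m' v ⟨hf, hl⟩
      refine ⟨hf.writeNat (by simp) _ _, ?_⟩
      rw [← hl]
      exact readList_congr
        (by funext j; rw [Memory.nat_writeNat, if_neg (by omega)])
        (by funext j; rw [Memory.nat_writeNat, if_neg (by omega)])
    · rintro i m' ⟨hf, hl⟩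
      simp only [NatExp.eval]
      rw [(hf slen (by simp; omega)).1]
    · rintro i hi m' ⟨hf, hl⟩ hci
      have hsrc := (hf src (by simp; omega)).1
      set x := m.nat src i with hx
      have ha : Reaches (assign 81 (.get src (var 80))) m' 6 (fun m'' => m'' = m'.writeNat 81 0 x) := by
        refine (reaches_of_loopFree (by trivial) ?_).mono (by simp [Program.maxCost, NatExp.cost])
          (fun _ h => h)
        simp [Program.exec, NatExp.eval, hci, hsrc, hx]
      refine (ha.seq (T₂ := t + 24) ?_).mono (by omega) (fun _ h => h)
      rintro _ rfl
      have hb := hpre (m'.writeNat 81 0 x) x (hf.writeNat (by simp) _ _)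
        (by simp [Memory.nat_writeNat]) (mem_readList.2 ⟨i, hi, rfl⟩)
      refine (hb.seq (T₂ := 24) ?_).mono (by omega) (fun _ h => h)
      rintro m₂ ⟨hf₂, hp₂⟩
      have hdst₂ : m₂.nat dst = m'.nat dst := by
        rw [(hf₂ dst (by simp; omega)).1]; funext j; simp [Memory.nat_writeNat]; omega
      have hdlen₂ : m₂.nat dlen = m'.nat dlen := by
        rw [(hf₂ dlen (by simp; omega)).1]; funext j; simp [Memory.nat_writeNat]; omega
      have h80 : m₂.nat 80 0 = i := by
        rw [(hf₂ 80 (by simp)).1]; simp [Memory.nat_writeNat, hci]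
      have h81 : m₂.nat 81 0 = x := by
        rw [(hf₂ 81 (by simp)).1]; simp [Memory.nat_writeNat]
      have hfr : Frame {A | A = dst ∨ A = dlen ∨ (80 ≤ A ∧ A < 90)} m m₂ :=
        (hf.writeNat (A := 81) (by simp) 0 x).trans (hf₂.mono (by intro A; simp; omega))
      refine (reaches_of_loopFree (by simp [Program.LoopFree]) ?_).mono
          (by simp [Program.maxCost, NatExp.cost, Test.cost]) (fun _ h => h)
      simp only [Program.exec]
      rw [List.range_succ, List.map_append, select_append, ← hl]
      have hlen : readList m₂ dst dlen = readList m' dst dlen := readList_congr hdst₂ hdlen₂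
      by_cases hp : p x
      · have h82 := hp₂.2 hp
        have hdl' : m₂.nat dlen 0 = m'.nat dlen 0 := by rw [hdlen₂]
        rw [branch_pos (show Test.Holds m₂ (.natLe (.const 1) (var 82)) from h82)]
        simp only [NatExp.eval]
        refine ⟨⟨(hfr.writeNat (by simp) _ _).writeNat (by simp) _ _, ?_⟩, ?_⟩
        · rw [← hlen]
          rw [List.map_singleton, ← hx, select_singleton_pos hp]
          refine readList_push ?_ ?_ ?_
          · simp [Memory.nat_writeNat, h5.symm]
          · intro j hj
            simp [Memory.nat_writeNat, h5, hj.ne]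
          · simp [Memory.nat_writeNat, h5, h81]
        · simp only [Memory.nat_writeNat]
          rw [if_neg (by omega), if_neg (by omega), h80]
      · have h82 : ¬ (1 ≤ m₂.nat 82 0) := fun h => hp (hp₂.1 h)
        rw [branch_neg (show ¬ Test.Holds m₂ (.natLe (.const 1) (var 82)) from h82)]
        refine ⟨⟨hfr, ?_⟩, h80⟩
        rw [List.map_singleton, ← hx, select_singleton_neg hp, List.append_nil, hlen]
  have h0 : Reaches (assign dlen (.const 0)) m 3 (fun m' => m' = m.writeNat dlen 0 0) := by
    refine (reaches_of_loopFree (by trivial) ?_).mono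
      (by simp [Program.maxCost, NatExp.cost]) (fun _ h => h)
    simp [Program.exec, NatExp.eval]
  refine (h0.seq hpost).mono ?_ (fun m' h => h.1)
  nlinarith

/-! ### Row minima of a matrix with the Monge property -/

/-- `j` is the first minimum of `f` in `[lo, hi]`. -/
def IsFirstMin (f : ℕ → ℝ) (lo hi j : ℕ) : Prop :=
  lo ≤ j ∧ j ≤ hi ∧ (∀ j', lo ≤ j' → j' ≤ hi → f j ≤ f j') ∧ ∀ j', lo ≤ j' → j' < j → f j < f j'

theorem isFirstMin_self (f : ℕ → ℝ) (lo : ℕ) : IsFirstMin f lo lo lo :=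
  ⟨le_rfl, le_rfl, fun j' h h' => by rw [le_antisymm h' h], fun j' h h' => by omega⟩

theorem IsFirstMin.step_lt {f : ℕ → ℝ} {lo hi j : ℕ} (h : IsFirstMin f lo hi j)
    (hlt : f (hi + 1) < f j) : IsFirstMin f lo (hi + 1) (hi + 1) := by
  obtain ⟨h1, h2, h3, h4⟩ := h
  refine ⟨by omega, le_rfl, fun j' h h' => ?_, fun j' h h' => ?_⟩
  · rcases Nat.lt_or_ge hi j' with hj | hj
    · rw [show j' = hi + 1 by omega]
    · exact hlt.le.trans (h3 j' h hj)
  · exact hlt.trans_le (h3 j' h (by omega))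

theorem IsFirstMin.step_le {f : ℕ → ℝ} {lo hi j : ℕ} (h : IsFirstMin f lo hi j)
    (hle : f j ≤ f (hi + 1)) : IsFirstMin f lo (hi + 1) j := by
  obtain ⟨h1, h2, h3, h4⟩ := h
  refine ⟨h1, by omega, fun j' h h' => ?_, h4⟩
  rcases Nat.lt_or_ge hi j' with hj | hj
  · rwa [show j' = hi + 1 by omega]
  · exact h3 j' h hj

theorem exists_isFirstMin (f : ℕ → ℝ) (lo d : ℕ) : ∃ j, IsFirstMin f lo (lo + d) j := by
  induction d with
  | zero => exact ⟨lo, isFirstMin_self f lo⟩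
  | succ d ih =>
    obtain ⟨j, hj⟩ := ih
    rcases lt_or_ge (f (lo + d + 1)) (f j) with h | h
    · exact ⟨_, hj.step_lt h⟩
    · exact ⟨_, hj.step_le h⟩

theorem IsFirstMin.unique {f : ℕ → ℝ} {lo hi j k : ℕ} (h : IsFirstMin f lo hi j)
    (h' : IsFirstMin f lo hi k) : j = k := by
  rcases lt_trichotomy j k with hjk | hjk | hjk
  · have := h'.2.2.2 j h.1 hjk
    have := h.2.2.1 k h'.1 h'.2.1
    linarith
  · exact hjk
  · have := h.2.2.2 k h'.1 hjk
    have := h'.2.2.1 j h.1 h.2.1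
    linarith

theorem IsFirstMin.restrict {f : ℕ → ℝ} {lo hi lo' hi' j : ℕ} (h : IsFirstMin f lo hi j)
    (h1 : lo ≤ lo') (h2 : hi' ≤ hi) (h3 : lo' ≤ j) (h4 : j ≤ hi') : IsFirstMin f lo' hi' j :=
  ⟨h3, h4, fun j' h5 h6 => h.2.2.1 j' (by omega) (by omega),
    fun j' h5 h6 => h.2.2.2 j' (by omega) h6⟩

/-- The Monge property of a matrix with rows `1, …, R` and columns `0, …, C - 1`. -/
def Monge (M : ℕ → ℕ → ℝ) (R C : ℕ) : Prop :=
  ∀ r r' j j', 1 ≤ r → r ≤ r' → r' ≤ R → j ≤ j' → j' < C → M r' j' + M r j ≤ M r j' + M r' j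

/-- The column of the first minimum of row `r`; the rows `0` and `R + 1, …` are sentinels. -/
noncomputable def rowArgmin (M : ℕ → ℕ → ℝ) (R C r : ℕ) : ℕ :=
  if r = 0 then 0 else if r ≤ R then Classical.epsilon (IsFirstMin (M r) 0 (C - 1)) else C - 1

theorem isFirstMin_rowArgmin (M : ℕ → ℕ → ℝ) {R C r : ℕ} (h1 : 1 ≤ r) (hR : r ≤ R) :
    IsFirstMin (M r) 0 (C - 1) (rowArgmin M R C r) := by
  rw [rowArgmin, if_neg (by omega), if_pos hR]
  obtain ⟨j, hj⟩ := exists_isFirstMin (M r) 0 (C - 1)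
  rw [zero_add] at hj
  exact Classical.epsilon_spec (p := IsFirstMin (M r) 0 (C - 1)) ⟨j, hj⟩

theorem rowArgmin_le (M : ℕ → ℕ → ℝ) (R C r : ℕ) : rowArgmin M R C r ≤ C - 1 := by
  by_cases h : 1 ≤ r ∧ r ≤ R
  · exact (isFirstMin_rowArgmin M h.1 h.2).2.1
  · unfold rowArgmin
    split_ifs <;> omega

/-- Were the first minimum of the later row strictly to the left, the Monge inequality for these two
columns, added to minimality in row `r'`, would contradict the strict inequality that row `r`
satisfies to the left of its first minimum. Working with first minima supplies this strictness. -/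
theorem Monge.rowArgmin_mono {M : ℕ → ℕ → ℝ} {R C : ℕ} (hC : 1 ≤ C) (hM : Monge M R C) :
    Monotone (rowArgmin M R C) := by
  intro r r' hr
  rcases Nat.eq_zero_or_pos r with h0 | h0
  · simp [h0, rowArgmin]
  rcases Nat.lt_or_ge R r' with hR | hR
  · have : rowArgmin M R C r' = C - 1 := by
      rw [rowArgmin, if_neg (by omega), if_neg (by omega)]
    rw [this]
    exact rowArgmin_le M R C r
  have h1 := isFirstMin_rowArgmin M (C := C) h0 (hr.trans hR)
  have h2 := isFirstMin_rowArgmin M (C := C) (le_trans h0 hr) hR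
  by_contra! hlt
  have h3 := hM r r' (rowArgmin M R C r') (rowArgmin M R C r) h0 hr hR hlt.le
    (by have := h1.2.1; omega)
  have h4 := h1.2.2.2 _ h2.1 hlt
  have h5 := h2.2.2.1 _ h1.1 h1.2.1
  linarith

/-- By monotonicity a row need only be searched between the minima of one row before it and one row
after it. Where no such row exists, a sentinel row supplies the extreme column. -/
theorem Monge.rowArgmin_eq {M : ℕ → ℕ → ℝ} {R C a r b j : ℕ} (hC : 1 ≤ C) (hM : Monge M R C)
    (h1 : 1 ≤ r) (hR : r ≤ R) (ha : a ≤ r) (hb : r ≤ b)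
    (hj : IsFirstMin (M r) (rowArgmin M R C a) (rowArgmin M R C b) j) :
    j = rowArgmin M R C r :=
  hj.unique ((isFirstMin_rowArgmin M h1 hR).restrict (Nat.zero_le _) (rowArgmin_le _ _ _ _)
    (hM.rowArgmin_mono hC ha) (hM.rowArgmin_mono hC hb))

/-- Height over `X q` of the upper unit half-circle around `w`, reflected if `s = -1`. -/
noncomputable def arcHeight (X Y : ℕ → ℝ) (s : ℝ) (q w : ℕ) : ℝ :=
  s * Y w + √(1 - (X q - X w) * (X q - X w))

/-- The expression for `arcHeight`, for the point `q` in variable `97` and the point `w` at the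
position in variable `94` of the list `W`. -/
def arcExp (W : ℕ) (sE : RealExp) : RealExp :=
  .add (.mul sE (.get 4 (.get W (var 94))))
    (.sqrt (.sub (.const 1) (.mul
      (.sub (.get 3 (var 97)) (.get 3 (.get W (var 94))))
      (.sub (.get 3 (var 97)) (.get 3 (.get W (var 94)))))))

/-- Find the first minimum of a row between the columns in variables `94` and `95`. -/
def scanLoop (W : ℕ) (sE : RealExp) : Program :=
  .loop (.natLt (var 94) (var 95))
    (.seq (assign 94 (.add (var 94) (.const 1)))
      (.seq (.setReal 99 (.const 0) (arcExp W sE))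
        (.cond (.not (.realLe (.get 98 (.const 0)) (.get 99 (.const 0))))
          (.seq (.setReal 98 (.const 0) (.get 99 (.const 0))) (assign 96 (var 94)))
          .skip)))

/-- The cost is linear in the length of the scanned range, so that it telescopes over the rows of
one pass. The constant is fixed before the memory and hence does not depend on the input. -/
theorem reaches_scanLoop (W : ℕ) (sE : RealExp) (hW : W < 80) : ∃ c, ∀ (m : Memory) (s : ℝ)
    (f : ℕ → ℝ), (∀ m', sE.eval m' = s) →
    (∀ j, f j = arcHeight (m.real 3) (m.real 4) s (m.nat 97 0) (m.nat W j)) →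
    m.nat 94 0 ≤ m.nat 95 0 → m.real 98 0 = f (m.nat 94 0) → m.nat 96 0 = m.nat 94 0 →
    Reaches (scanLoop W sE) m ((m.nat 95 0 - m.nat 94 0) * c + c) fun m' =>
      Frame {A | A = 94 ∨ A = 96 ∨ A = 98 ∨ A = 99} m m' ∧
      IsFirstMin f (m.nat 94 0) (m.nat 95 0) (m'.nat 96 0) ∧ m'.real 98 0 = f (m'.nat 96 0) := by
  refine ⟨(arcExp W sE).cost + 100, fun m s f hs hf hle h98 h96 => ?_⟩
  set lo := m.nat 94 0 with hlo
  set hi := m.nat 95 0 with hhi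
  refine (Reaches.loop (fun i m' => Frame {A | A = 94 ∨ A = 96 ∨ A = 98 ∨ A = 99} m m' ∧
      m'.nat 94 0 = lo + i ∧ IsFirstMin f lo (lo + i) (m'.nat 96 0) ∧
      m'.real 98 0 = f (m'.nat 96 0)) (fun _ => (arcExp W sE).cost + 50) (hi - lo) ?_ ?_ ?_).mono
      ?_ ?_
  · rintro i hi' m' ⟨hfr, hj, hmin, hv⟩
    have h95 : m'.nat 95 0 = hi := by rw [(hfr 95 (by simp)).1]
    have hW' : m'.nat W = m.nat W := (hfr W (by simp; omega)).1
    have h97 : m'.nat 97 = m.nat 97 := (hfr 97 (by simp)).1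
    have h3 : m'.real 3 = m.real 3 := (hfr 3 (by simp)).2
    have h4 : m'.real 4 = m.real 4 := (hfr 4 (by simp)).2
    refine ⟨by simp [Test.Holds, NatExp.eval, h95, hj]; omega, ?_⟩
    refine (reaches_of_loopFree (by simp [Program.LoopFree]) ?_).mono
      (by simp [Program.maxCost, NatExp.cost, RealExp.cost, Test.cost]; omega) (fun _ h => h)
    simp only [Program.exec]
    have hE : (arcExp W sE).eval (m'.writeNat 94 0 (lo + i + 1)) = f (lo + i + 1) := by
      have hW94 : W ≠ 94 := by omega
      simp [arcExp, RealExp.eval, NatExp.eval, hs, hf, arcHeight, Memory.nat_writeNat, hW',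
        h97, h3, h4, hW94]
    have hfr1 : Frame {A | A = 94 ∨ A = 96 ∨ A = 98 ∨ A = 99} m
        ((m'.writeNat 94 0 (lo + i + 1)).writeReal 99 0 (f (lo + i + 1))) :=
      (hfr.writeNat (by simp) _ _).writeReal (by simp) _ _
    simp only [Test.Holds, RealExp.eval, NatExp.eval, Memory.real_writeReal, hv, hj, hE,
      Memory.real_writeNat, Memory.nat_writeReal, Memory.nat_writeNat, not_le]
    simp only [if_true, and_self, and_true, if_false, show (98 : ℕ) ≠ 99 by decide]
    by_cases hcond : f (lo + i + 1) < f (m'.nat 96 0)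
    · rw [branch_pos hcond]
      refine ⟨(hfr1.writeReal (by simp) _ _).writeNat (by simp) _ _, ?_, ?_, ?_⟩
      · simp [Memory.nat_writeNat]; omega
      · simpa [Memory.nat_writeNat, ← add_assoc] using hmin.step_lt hcond
      · simp [Memory.nat_writeNat, Memory.real_writeReal]
    · rw [branch_neg hcond]
      rw [not_lt] at hcond
      refine ⟨hfr1, ?_, ?_, ?_⟩
      · simp [Memory.nat_writeNat]; omega
      · simpa [Memory.nat_writeNat, ← add_assoc] using hmin.step_le hcond
      · simp [Memory.nat_writeNat, Memory.real_writeReal, hv]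
  · rintro m' ⟨hfr, hj, -⟩
    have h95 : m'.nat 95 0 = hi := by rw [(hfr 95 (by simp)).1]
    simp [Test.Holds, NatExp.eval, h95, hj]; omega
  · refine ⟨Frame.refl _ _, by simp [hlo], ?_, ?_⟩
    · rw [h96]; exact isFirstMin_self _ _
    · rw [h98, h96]
  · simp only [Finset.sum_const, Finset.card_range, smul_eq_mul, Test.cost, NatExp.cost]
    exact add_le_add (Nat.mul_le_mul_left _ (by omega)) (by omega)
  · rintro m' ⟨hfr, hj, hmin, hv⟩
    rw [show lo + (hi - lo) = hi by omega] at hmin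
    exact ⟨hfr, hmin, hv⟩

/-- Find the minimum of the row in variable `93`, from those of the rows at distance `92`. -/
def rowStep (src slen W wlen : ℕ) (sE : RealExp) : Program :=
  .seq (.seq (assign 94 (.get 90 (.sub (var 93) (var 92))))
    (.seq (.cond (.natLe (.add (var 93) (var 92)) (var slen))
        (assign 95 (.get 90 (.add (var 93) (var 92))))
        (assign 95 (.sub (var wlen) (.const 1))))
      (.seq (assign 97 (.get src (.sub (var slen) (var 93))))
        (.seq (.setReal 98 (.const 0) (arcExp W sE)) (assign 96 (var 94))))))
    (.seq (scanLoop W sE)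
      (.seq (.setNat 90 (var 93) (var 96))
        (.seq (.setReal 100 (var 97) (.get 98 (.const 0)))
          (assign 93 (.add (.add (var 93) (var 92)) (var 92))))))

/-- The arrays used by `rowMinima`. -/
def rowArrays : Set ℕ := {A | 90 ≤ A}

/-- `v` is the least value of the row of the point `q`. -/
def IsRowMin (X Y : ℕ → ℝ) (s : ℝ) (w : ℕ → ℕ) (C q : ℕ) (v : ℝ) : Prop :=
  (∃ j < C, v = arcHeight X Y s q (w j)) ∧ ∀ j < C, v ≤ arcHeight X Y s q (w j)

/-- The matrix whose row minima are computed. -/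
noncomputable def arcMatrix (m : Memory) (s : ℝ) (src slen W : ℕ) (r j : ℕ) : ℝ :=
  arcHeight (m.real 3) (m.real 4) s (m.nat src (m.nat slen 0 - r)) (m.nat W j)

/-- Row `r` is done. -/
def RowDone (m m' : Memory) (s : ℝ) (src slen W wlen r : ℕ) : Prop :=
  m'.nat 90 r = rowArgmin (arcMatrix m s src slen W) (m.nat slen 0) (m.nat wlen 0) r ∧
  (1 ≤ r → IsRowMin (m.real 3) (m.real 4) s (m.nat W) (m.nat wlen 0)
    (m.nat src (m.nat slen 0 - r)) (m'.real 100 (m.nat src (m.nat slen 0 - r))))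

theorem reaches_rowStep (src slen W wlen : ℕ) (sE : RealExp) (h1 : src < 80) (h2 : slen < 80)
    (h3 : W < 80) (h4 : wlen < 80) : ∃ c, ∀ (m m' : Memory) (s : ℝ) (r d : ℕ),
    (∀ m', sE.eval m' = s) → Monge (arcMatrix m s src slen W) (m.nat slen 0) (m.nat wlen 0) →
    1 ≤ m.nat wlen 0 → Frame rowArrays m m' →
    m'.nat 93 0 = r → m'.nat 92 0 = d → d ≤ r → 1 ≤ d → r ≤ m.nat slen 0 →
    RowDone m m' s src slen W wlen (r - d) →
    (r + d ≤ m.nat slen 0 → RowDone m m' s src slen W wlen (r + d)) →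
    Reaches (rowStep src slen W wlen sE) m'
      ((rowArgmin (arcMatrix m s src slen W) (m.nat slen 0) (m.nat wlen 0) (r + d) -
        rowArgmin (arcMatrix m s src slen W) (m.nat slen 0) (m.nat wlen 0) (r - d)) * c + c)
      fun m'' => Frame rowArrays m m'' ∧ m''.nat 93 0 = r + d + d ∧ m''.nat 92 0 = d ∧
        m''.nat 7 = m'.nat 7 ∧ m''.nat 91 = m'.nat 91 ∧
        RowDone m m'' s src slen W wlen r ∧
        ∀ r', RowDone m m' s src slen W wlen r' → r' ≠ r → RowDone m m'' s src slen W wlen r' := by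
  obtain ⟨c, hc⟩ := reaches_scanLoop W sE h3
  refine ⟨c + (arcExp W sE).cost + 200, fun m m' s r d hs hM hC hfr h93 h92 hdr hd1 hrR hlo hhi => ?_⟩
  set g := rowArgmin (arcMatrix m s src slen W) (m.nat slen 0) (m.nat wlen 0) with hg
  have hsrc : m'.nat src = m.nat src := (hfr src (by simp [rowArrays]; omega)).1
  have hslen : m'.nat slen = m.nat slen := (hfr slen (by simp [rowArrays]; omega)).1
  have hW : m'.nat W = m.nat W := (hfr W (by simp [rowArrays]; omega)).1
  have hwlen : m'.nat wlen = m.nat wlen := (hfr wlen (by simp [rowArrays]; omega)).1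
  have hX : m'.real 3 = m.real 3 := (hfr 3 (by simp [rowArrays])).2
  have hY : m'.real 4 = m.real 4 := (hfr 4 (by simp [rowArrays])).2
  have hmono : g (r - d) ≤ g (r + d) := hM.rowArgmin_mono hC (by omega)
  set q := m.nat src (m.nat slen 0 - r) with hq
  -- preparation
  have hA : Reaches (.seq (assign 94 (.get 90 (.sub (var 93) (var 92))))
    (.seq (.cond (.natLe (.add (var 93) (var 92)) (var slen))
        (assign 95 (.get 90 (.add (var 93) (var 92))))
        (assign 95 (.sub (var wlen) (.const 1))))
      (.seq (assign 97 (.get src (.sub (var slen) (var 93))))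
        (.seq (.setReal 98 (.const 0) (arcExp W sE)) (assign 96 (var 94)))))) m'
      ((arcExp W sE).cost + 100) (fun m₁ => m₁ = (((((m'.writeNat 94 0 (g (r - d))).writeNat 95 0
        (g (r + d))).writeNat 97 0 q).writeReal 98 0
          (arcMatrix m s src slen W r (g (r - d)))).writeNat 96 0 (g (r - d)))) := by
    refine (reaches_of_loopFree (by simp [Program.LoopFree]) ?_).mono
      (by simp [Program.maxCost, NatExp.cost, Test.cost]; omega) (fun _ h => h)
    have hs1 : slen ≠ 94 := by omega
    have hs2 : slen ≠ 95 := by omega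
    have hs3 : src ≠ 94 := by omega
    have hs4 : src ≠ 95 := by omega
    have hs5 : W ≠ 94 := by omega
    have hs6 : W ≠ 95 := by omega
    have hs7 : W ≠ 97 := by omega
    have hs8 : wlen ≠ 94 := by omega
    -- If `r + d` is past the last row, the range ends at the column `C - 1` of the sentinel row.
    have e1 : branch (r + d ≤ m.nat slen 0)
        ((m'.writeNat 94 0 (g (r - d))).writeNat 95 0 (m'.nat 90 (r + d)))
        ((m'.writeNat 94 0 (g (r - d))).writeNat 95 0 (m.nat wlen 0 - 1)) =
        (m'.writeNat 94 0 (g (r - d))).writeNat 95 0 (g (r + d)) := by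
      by_cases hle : r + d ≤ m.nat slen 0
      · rw [branch_pos hle, (hhi hle).1]
      · have : g (r + d) = m.nat wlen 0 - 1 := by
          rw [hg, rowArgmin, if_neg (by omega), if_neg hle]
        rw [branch_neg hle, this]
    have e0 : m'.nat 90 (r - d) = g (r - d) := hlo.1
    simp only [Program.exec, NatExp.eval, Test.Holds, Memory.nat_writeNat, h93, h92, e0, hs1, hs8,
      show (93 : ℕ) ≠ 94 by decide, show (92 : ℕ) ≠ 94 by decide, show (90 : ℕ) ≠ 94 by decide,
      false_and, if_false, hslen, hwlen, e1]
    simp [Memory.nat_writeNat, arcExp, RealExp.eval, NatExp.eval, hs, h93, hs1, hs2, hs3, hs4, hs5,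
      hs6, hs7, hslen, hsrc, hX, hY, hW, arcMatrix, arcHeight, hq]
  refine (hA.seq (T₂ := (g (r + d) - g (r - d)) * c + c + 30) ?_).mono ?_ (fun _ h => h)
  · rintro m₁ hm₁
    have hfr₁ : Frame rowArrays m m₁ := by
      rw [hm₁]
      exact ((((hfr.writeNat (by simp [rowArrays]) _ _).writeNat (by simp [rowArrays]) _ _).writeNat
        (by simp [rowArrays]) _ _).writeReal (by simp [rowArrays]) _ _).writeNat
        (by simp [rowArrays]) _ _
    have e94 : m₁.nat 94 0 = g (r - d) := by simp [hm₁, Memory.nat_writeNat]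
    have e95 : m₁.nat 95 0 = g (r + d) := by simp [hm₁, Memory.nat_writeNat]
    have e97 : m₁.nat 97 0 = q := by simp [hm₁, Memory.nat_writeNat]
    have e96 : m₁.nat 96 0 = g (r - d) := by simp [hm₁, Memory.nat_writeNat]
    have e98 : m₁.real 98 0 = arcMatrix m s src slen W r (g (r - d)) := by
      simp [hm₁, Memory.real_writeReal]
    have e93 : m₁.nat 93 0 = r := by simp [hm₁, Memory.nat_writeNat, h93]
    have e92 : m₁.nat 92 0 = d := by simp [hm₁, Memory.nat_writeNat, h92]
    have e90 : m₁.nat 90 = m'.nat 90 := by funext j; simp [hm₁, Memory.nat_writeNat]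
    have e91 : m₁.nat 91 = m'.nat 91 := by funext j; simp [hm₁, Memory.nat_writeNat]
    have e7 : m₁.nat 7 = m'.nat 7 := by funext j; simp [hm₁, Memory.nat_writeNat]
    have e100 : m₁.real 100 = m'.real 100 := by funext j; simp [hm₁, Memory.real_writeReal]
    have hscan := hc m₁ s (arcMatrix m s src slen W r) hs (fun j => by
      rw [(hfr₁ 3 (by simp [rowArrays])).2, (hfr₁ 4 (by simp [rowArrays])).2, e97,
        (hfr₁ W (by simp [rowArrays]; omega)).1, hq, arcMatrix]) (by rw [e94, e95]; exact hmono)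
        (by rw [e98, e94]) (by rw [e96, e94])
    rw [e94, e95] at hscan
    refine (hscan.seq (T₂ := 30) ?_).mono (by omega) (fun _ h => h)
    rintro m₂ ⟨hfr₂, hmin, hv⟩
    have hj := hM.rowArgmin_eq hC (by omega) hrR (Nat.sub_le r d) (Nat.le_add_right r d) hmin
    rw [← hg] at hj
    have f93 : m₂.nat 93 0 = r := by rw [(hfr₂ 93 (by simp)).1, e93]
    have f92 : m₂.nat 92 0 = d := by rw [(hfr₂ 92 (by simp)).1, e92]
    have f97 : m₂.nat 97 0 = q := by rw [(hfr₂ 97 (by simp)).1, e97]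
    have f90 : m₂.nat 90 = m'.nat 90 := by rw [(hfr₂ 90 (by simp)).1, e90]
    have f91 : m₂.nat 91 = m'.nat 91 := by rw [(hfr₂ 91 (by simp)).1, e91]
    have f7 : m₂.nat 7 = m'.nat 7 := by rw [(hfr₂ 7 (by simp)).1, e7]
    have f100 : m₂.real 100 = m'.real 100 := by rw [(hfr₂ 100 (by simp)).2, e100]
    have hfr₃ : Frame rowArrays m m₂ := hfr₁.trans (hfr₂.mono (by
      intro A; simp [rowArrays]; omega))
    rw [hj] at hv
    have hmin' : IsRowMin (m.real 3) (m.real 4) s (m.nat W) (m.nat wlen 0) q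
        (arcMatrix m s src slen W r (g r)) := by
      have hm := isFirstMin_rowArgmin (arcMatrix m s src slen W) (C := m.nat wlen 0)
        (by omega : 1 ≤ r) hrR
      rw [← hg] at hm
      exact ⟨⟨g r, by have := hm.2.1; omega, rfl⟩, fun j hj => hm.2.2.1 j (Nat.zero_le _) (by omega)⟩
    refine (reaches_of_loopFree (by simp [Program.LoopFree]) ?_).mono
      (by simp [Program.maxCost, NatExp.cost, RealExp.cost]) (fun _ h => h)
    simp only [Program.exec, NatExp.eval, RealExp.eval, Memory.nat_writeNat, Memory.nat_writeReal,
      Memory.real_writeNat, f93, f92, f97, hj, hv]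
    simp only [show (93 : ℕ) ≠ 90 by decide, show (92 : ℕ) ≠ 90 by decide,
      show (97 : ℕ) ≠ 90 by decide, false_and, if_false, f97, f92, f93]
    refine ⟨((hfr₃.writeNat (by simp [rowArrays]) _ _).writeReal (by simp [rowArrays]) _ _).writeNat
      (by simp [rowArrays]) _ _, ?_, ?_, ?_, ?_, ?_, ?_⟩
    · simp [Memory.nat_writeNat]
    · simp [Memory.nat_writeNat, f92]
    · funext j; simp [Memory.nat_writeNat, f7]
    · funext j; simp [Memory.nat_writeNat, f91]
    · refine ⟨by simp [Memory.nat_writeNat, hg], fun _ => ?_⟩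
      rw [← hq]
      simpa [Memory.real_writeReal] using hmin'
    · rintro r' ⟨hr1, hr2⟩ hne
      refine ⟨by simp [Memory.nat_writeNat, hne, f90, hr1], fun h => ?_⟩
      have := hr2 h
      -- Minima are stored by point and not by row. If two rows belong to the same point, the
      -- overwritten entry is still a correct minimum.
      by_cases hqq : m.nat src (m.nat slen 0 - r') = q
      · rw [hqq]
        simpa [Memory.real_writeReal] using hmin'
      · simpa [Memory.real_writeReal, hqq, f100] using this
  · have := Nat.mul_le_mul_left (g (r + d) - g (r - d))
      (show c ≤ c + (arcExp W sE).cost + 200 by omega)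
    omega

/-- Find the minima of all rows, by successively halved strides. -/
def rowMinima (src slen W wlen : ℕ) (sE : RealExp) : Program :=
  .seq (.setNat 90 (.const 0) (.const 0))
    (forLoop 91 (var 8)
      (.seq (.seq (assign 92 (.get 7 (.sub (.sub (var 8) (var 91)) (.const 1)))) (assign 93 (var 92)))
        (.loop (.natLe (var 93) (var slen)) (rowStep src slen W wlen sE))))

theorem sum_sub_of_monotone {g : ℕ → ℕ} (hg : Monotone g) (n : ℕ) :
    ∑ i ∈ Finset.range n, (g (i + 1) - g i) ≤ g n := by
  induction n with
  | zero => simp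
  | succ n ih =>
    rw [Finset.sum_range_succ]
    have := hg (Nat.le_succ n)
    simp only [Nat.succ_eq_add_one] at this
    omega

/-- After `k` passes all rows divisible by `2 ^ (L - k)` are done; initially this is only the
sentinel row `0`, as `R < 2 ^ L`. A pass with stride `d` treats the odd multiples of `d`, whose
neighbours at distance `d` are multiples of `2 * d` and already done. The ranges scanned in a pass
meet only at their ends, so a pass costs O(R + C). -/
theorem reaches_rowMinima (src slen W wlen : ℕ) (sE : RealExp) (h1 : src < 80) (h2 : slen < 80)
    (h3 : W < 80) (h4 : wlen < 80) : ∃ c, ∀ (m : Memory) (s : ℝ),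
    (∀ m', sE.eval m' = s) → Monge (arcMatrix m s src slen W) (m.nat slen 0) (m.nat wlen 0) →
    1 ≤ m.nat wlen 0 → m.nat slen 0 < 2 ^ m.nat 8 0 → (∀ i < m.nat 8 0, m.nat 7 i = 2 ^ i) →
    Reaches (rowMinima src slen W wlen sE) m
      (c * ((m.nat 8 0 + 1) * (m.nat slen 0 + m.nat wlen 0 + 1)))
      fun m' => Frame rowArrays m m' ∧ ∀ i < m.nat slen 0,
        IsRowMin (m.real 3) (m.real 4) s (m.nat W) (m.nat wlen 0) (m.nat src i)
          (m'.real 100 (m.nat src i)) := by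
  obtain ⟨c, hc⟩ := reaches_rowStep src slen W wlen sE h1 h2 h3 h4
  refine ⟨c + 100, fun m s hs hM hC hL hpow => ?_⟩
  set R := m.nat slen 0 with hR
  set C := m.nat wlen 0 with hCdef
  set L := m.nat 8 0 with hLdef
  set g := rowArgmin (arcMatrix m s src slen W) R C with hg
  have hgm : Monotone g := hM.rowArgmin_mono hC
  have h0 : Reaches (.setNat 90 (.const 0) (.const 0)) m 3 (fun m' => m' = m.writeNat 90 0 0) := by
    refine (reaches_of_loopFree (by trivial) ?_).mono
      (by simp [Program.maxCost, NatExp.cost]) (fun _ h => h)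
    simp [Program.exec, NatExp.eval]
  have hloop : ∀ m₁, m₁ = m.writeNat 90 0 0 → Reaches (forLoop 91 (var 8)
      (.seq (.seq (assign 92 (.get 7 (.sub (.sub (var 8) (var 91)) (.const 1)))) (assign 93 (var 92)))
        (.loop (.natLe (var 93) (var slen)) (rowStep src slen W wlen sE)))) m₁
      ((L + 1) * ((C * c + R * (c + 6) + 24) + 2 + 20))
      (fun m' => (Frame rowArrays m m' ∧
        ∀ r ≤ R, 2 ^ (L - L) ∣ r → RowDone m m' s src slen W wlen r) ∧ m'.nat 91 0 = L) := by
    rintro m₁ rfl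
    refine reaches_forLoop_const L (C * c + R * (c + 6) + 24) (fun k m' => Frame rowArrays m m' ∧
        ∀ r ≤ R, 2 ^ (L - k) ∣ r → RowDone m m' s src slen W wlen r) ?_ ?_ ?_ ?_
    · refine ⟨(Frame.refl _ _).writeNat (by simp [rowArrays]) _ _, fun r hr hdvd => ?_⟩
      have : r = 0 := Nat.eq_zero_of_dvd_of_lt hdvd (by simpa using lt_of_le_of_lt hr hL)
      subst this
      exact ⟨by simp [Memory.nat_writeNat, rowArgmin], by simp⟩
    · rintro k m' v ⟨hfr, hd⟩
      refine ⟨hfr.writeNat (by simp [rowArrays]) _ _, fun r hr hdvd => ?_⟩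
      simpa [RowDone, Memory.nat_writeNat] using hd r hr hdvd
    · rintro k m' ⟨hfr, -⟩
      simp only [NatExp.eval, (hfr 8 (by simp [rowArrays])).1, hLdef]
    · rintro k hk m' ⟨hfr, hd⟩ h91
      set d := 2 ^ (L - k - 1) with hdd
      have hd1 : 1 ≤ d := Nat.one_le_two_pow
      have h2d : 2 ^ (L - k) = 2 * d := by
        rw [hdd, ← pow_succ']; congr 1; omega
      have h8 : m'.nat 8 0 = L := by rw [(hfr 8 (by simp [rowArrays])).1]
      have h7 : m'.nat 7 = m.nat 7 := (hfr 7 (by simp [rowArrays])).1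
      have hA : Reaches (.seq (assign 92 (.get 7 (.sub (.sub (var 8) (var 91)) (.const 1))))
          (assign 93 (var 92))) m' 15 (fun m₁ => m₁ = (m'.writeNat 92 0 d).writeNat 93 0 d) := by
        refine (reaches_of_loopFree (by simp [Program.LoopFree]) ?_).mono
          (by simp [Program.maxCost, NatExp.cost]) (fun _ h => h)
        simp [Program.exec, NatExp.eval, Memory.nat_writeNat, h91, h8, h7, hpow (L - k - 1) (by omega),
          hdd]
      -- The number of odd multiples of `d` among the rows up to `R`.
      set N := (R + d) / (2 * d) with hN
      have hNiff : ∀ i, i < N ↔ (2 * i + 1) * d ≤ R := by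
        intro i
        rw [hN, Nat.lt_iff_add_one_le, Nat.le_div_iff_mul_le (by omega)]
        constructor <;> intro h <;> nlinarith
      have hNR : N ≤ R := by
        rcases Nat.eq_zero_or_pos N with h | h
        · omega
        · have := (hNiff (N - 1)).1 (by omega)
          have h' : 2 * (N - 1) + 1 ≤ (2 * (N - 1) + 1) * d := Nat.le_mul_of_pos_right _ hd1
          omega
      have hB : ∀ m₁, m₁ = (m'.writeNat 92 0 d).writeNat 93 0 d →
          Reaches (.loop (.natLe (var 93) (var slen)) (rowStep src slen W wlen sE)) m₁
          (∑ i ∈ Finset.range N, ((g ((i + 1) * (2 * d)) - g (i * (2 * d))) * c + c + (5 + 1)) +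
            (5 + 1)) (fun m₂ => Frame rowArrays m m₂ ∧ m₂.nat 93 0 = (2 * N + 1) * d ∧
            m₂.nat 92 0 = d ∧ m₂.nat 91 = m'.nat 91 ∧
            ∀ r ≤ R, (2 * d ∣ r ∨ (d ∣ r ∧ r < (2 * N + 1) * d)) →
              RowDone m m₂ s src slen W wlen r) := by
        rintro m₁ rfl
        refine Reaches.loop (fun i m₂ => Frame rowArrays m m₂ ∧ m₂.nat 93 0 = (2 * i + 1) * d ∧
            m₂.nat 92 0 = d ∧ m₂.nat 91 = m'.nat 91 ∧
            ∀ r ≤ R, (2 * d ∣ r ∨ (d ∣ r ∧ r < (2 * i + 1) * d)) →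
              RowDone m m₂ s src slen W wlen r)
            (fun i => (g ((i + 1) * (2 * d)) - g (i * (2 * d))) * c + c) N ?_ ?_ ?_
        · rintro i hi m₂ ⟨hfr₂, e93, e92, e91, hd₂⟩
          have hiR := (hNiff i).1 hi
          have hsl : m₂.nat slen 0 = R := by rw [(hfr₂ slen (by simp [rowArrays]; omega)).1]
          have hlow : (2 * i + 1) * d - d = i * (2 * d) := by
            rw [Nat.add_mul, one_mul, Nat.add_sub_cancel]; ring
          have hhigh : (2 * i + 1) * d + d = (i + 1) * (2 * d) := by ring
          refine ⟨by simp [Test.Holds, NatExp.eval, e93, hsl, hiR], ?_⟩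
          have := hc m m₂ s ((2 * i + 1) * d) d hs hM hC hfr₂ e93 e92
            (Nat.le_mul_of_pos_left _ (by omega)) hd1 hiR
            (hd₂ _ (by omega) (Or.inl (by rw [hlow]; exact Dvd.intro_left _ rfl)))
            (fun h => hd₂ _ h (Or.inl (by rw [hhigh]; exact Dvd.intro_left _ rfl)))
          rw [hlow, hhigh] at this
          refine this.mono le_rfl ?_
          rintro m₃ ⟨hfr₃, f93, f92, -, f91, hdone, hold⟩
          refine ⟨hfr₃, by rw [f93]; ring, f92, f91.trans e91, fun r hr hor => ?_⟩
          by_cases hrr : r = (2 * i + 1) * d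
          · rw [hrr]; exact hdone
          · refine hold r (hd₂ r hr ?_) hrr
            rcases hor with h | ⟨⟨x, rfl⟩, h⟩
            · exact Or.inl h
            · have hx : x < 2 * (i + 1) + 1 := by
                rw [mul_comm d x] at h
                exact Nat.lt_of_mul_lt_mul_right h
              rcases Nat.lt_or_ge x (2 * i + 1) with hx1 | hx1
              · right
                refine ⟨Dvd.intro _ rfl, ?_⟩
                rw [mul_comm]
                exact Nat.mul_lt_mul_of_pos_right hx1 hd1
              · have hx2 : x ≠ 2 * i + 1 := by rintro rfl; exact hrr (mul_comm _ _)
                left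
                obtain rfl : x = 2 * (i + 1) := by omega
                exact ⟨i + 1, by ring⟩
        · rintro m₂ ⟨hfr₂, e93, -⟩
          have hsl : m₂.nat slen 0 = R := by rw [(hfr₂ slen (by simp [rowArrays]; omega)).1]
          have := (hNiff N).not.1 (lt_irrefl _)
          simpa [Test.Holds, NatExp.eval, e93, hsl] using this
        · refine ⟨(hfr.writeNat (by simp [rowArrays]) _ _).writeNat (by simp [rowArrays]) _ _,
            by simp [Memory.nat_writeNat], by simp [Memory.nat_writeNat],
            by funext j; simp [Memory.nat_writeNat], fun r hr hor => ?_⟩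
          have : RowDone m m' s src slen W wlen r := by
            refine hd r hr ?_
            rw [h2d]
            rcases hor with h | ⟨h, h'⟩
            · exact h
            · have : r = 0 := Nat.eq_zero_of_dvd_of_lt h (by omega)
              simp [this]
          simpa [RowDone, Memory.nat_writeNat] using this
      refine ((hA.seq hB)).mono ?_ ?_
      · have hsum := sum_sub_of_monotone (g := fun i => g (i * (2 * d)))
          (fun a b hab => hgm (Nat.mul_le_mul_right _ hab)) N
        have hgC : g (N * (2 * d)) ≤ C := (rowArgmin_le _ _ _ _).trans (Nat.sub_le _ _)
        rw [Finset.sum_add_distrib, Finset.sum_add_distrib, ← Finset.sum_mul]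
        simp only [Finset.sum_const, Finset.card_range, smul_eq_mul]
        have e1 := Nat.mul_le_mul_right c (hsum.trans hgC)
        have e2 := Nat.mul_le_mul_right (c + 6) hNR
        rw [Nat.mul_add] at e2
        omega
      · rintro m₂ ⟨hfr₂, -, -, e91, hd₂⟩
        refine ⟨⟨hfr₂, fun r hr hdvd => hd₂ r hr ?_⟩, by rw [e91, h91]⟩
        right
        rw [show L - (k + 1) = L - k - 1 by omega, ← hdd] at hdvd
        obtain ⟨x, rfl⟩ := hdvd
        refine ⟨Dvd.intro _ rfl, ?_⟩
        have h3 := (hNiff N).not.1 (lt_irrefl _)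
        omega
  refine (h0.seq hloop).mono ?_ ?_
  · have : C * c + R * (c + 6) + 24 + 2 + 20 + 3 ≤ (c + 100) * (R + C + 1) := by nlinarith
    calc 3 + (L + 1) * (C * c + R * (c + 6) + 24 + 2 + 20)
        ≤ (L + 1) * (C * c + R * (c + 6) + 24 + 2 + 20 + 3) := by nlinarith
      _ ≤ (L + 1) * ((c + 100) * (R + C + 1)) := Nat.mul_le_mul_left _ this
      _ = _ := by ring
  · rintro m' ⟨⟨hfr, hd⟩, -⟩
    refine ⟨hfr, fun i hi => ?_⟩
    -- After the last pass the stride is `2 ^ 0`, so every row is done; entry `i` of the list is row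
    -- `R - i`.
    have := (hd (R - i) (by omega) (by simp)).2 (by omega)
    rwa [show m.nat slen 0 - (R - i) = i by omega] at this

/-! ### Disks that cover a list of points -/

/-- Set the flag of `filterLoop` to the truth value of `b`. -/
def testFlag (b : Test) : Program := .cond b (assign 82 (.const 1)) (assign 82 (.const 0))

theorem reaches_filterTest {src slen dst dlen : ℕ} {b : Test} {m : Memory} (p : ℕ → Prop)
    (hs : src < 80) (hsl : slen < 80) (hd : dst < 80) (hdl : dlen < 80)
    (h1 : dst ≠ src) (h2 : dst ≠ slen) (h3 : dlen ≠ src) (h4 : dlen ≠ slen) (h5 : dst ≠ dlen)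
    (hb : ∀ m' x, Frame {A | A = dst ∨ A = dlen ∨ (80 ≤ A ∧ A < 90)} m m' → m'.nat 81 0 = x →
      x ∈ readList m src slen → (b.Holds m' ↔ p x)) :
    Reaches (filterLoop src slen dst dlen (testFlag b)) m
      ((m.nat slen 0 + 1) * (b.cost + 70))
      fun m' => Frame {A | A = dst ∨ A = dlen ∨ (80 ≤ A ∧ A < 90)} m m' ∧
        readList m' dst dlen = select p (readList m src slen) := by
  refine reaches_filterLoop p (b.cost + 10) hs hsl hd hdl h1 h2 h3 h4 h5 fun m' x hf hx hm => ?_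
  refine (Reaches.cond (T := 3) (fun h => ?_) (fun h => ?_)).mono (by omega) (fun _ h => h)
  · refine (reaches_of_loopFree (by trivial) ?_).mono
      (by simp [Program.maxCost, NatExp.cost]) (fun _ h => h)
    refine ⟨(Frame.refl _ _).writeNat (by simp) _ _, ?_⟩
    simpa [Program.exec, NatExp.eval, Memory.nat_writeNat] using (hb m' x hf hx hm).1 h
  · refine (reaches_of_loopFree (by trivial) ?_).mono
      (by simp [Program.maxCost, NatExp.cost]) (fun _ h => h)
    refine ⟨(Frame.refl _ _).writeNat (by simp) _ _, ?_⟩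
    simpa [Program.exec, NatExp.eval, Memory.nat_writeNat] using (hb m' x hf hx hm).not.1 h

/-! ### Half-circles and the Monge property -/

/-- The points with indices `a` and `b` are at distance at most `1`. -/
def Near (X Y : ℕ → ℝ) (a b : ℕ) : Prop :=
  (X a - X b) * (X a - X b) + (Y a - Y b) * (Y a - Y b) ≤ 1

theorem near_comm {X Y : ℕ → ℝ} {a b : ℕ} : Near X Y a b ↔ Near X Y b a := by
  unfold Near
  rw [show (X a - X b) * (X a - X b) + (Y a - Y b) * (Y a - Y b) =
    (X b - X a) * (X b - X a) + (Y b - Y a) * (Y b - Y a) by ring]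

theorem near_self (X Y : ℕ → ℝ) (a : ℕ) : Near X Y a a := by simp [Near]

/-- After squaring, concavity comes down to `u * v + x * y ≤ 1` for two points `(x, u)`, `(y, v)` of
the unit circle. -/
theorem concaveOn_halfCircle : ConcaveOn ℝ (Set.Icc (-1) 1) fun t : ℝ => √(1 - t * t) := by
  refine ⟨convex_Icc _ _, fun x hx y hy a b ha hb hab => ?_⟩
  simp only [smul_eq_mul]
  have h1 : 0 ≤ 1 - x * x := by nlinarith [hx.1, hx.2]
  have h2 : 0 ≤ 1 - y * y := by nlinarith [hy.1, hy.2]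
  refine Real.le_sqrt_of_sq_le ?_
  have e1 := Real.sq_sqrt h1
  have e2 := Real.sq_sqrt h2
  set u := √(1 - x * x)
  set v := √(1 - y * y)
  have h3 : u * v ≤ 1 - x * y := by nlinarith [sq_nonneg (u - v), sq_nonneg (x - y)]
  have h4 : (a * u + b * v) ^ 2 = a ^ 2 * (1 - x * x) + b ^ 2 * (1 - y * y) + 2 * (a * b) * (u * v) := by
    rw [← e1, ← e2]; ring
  have h5 : (1 : ℝ) = a ^ 2 + b ^ 2 + 2 * (a * b) := by rw [← one_pow 2, ← hab]; ring
  rw [h4]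
  nlinarith [mul_le_mul_of_nonneg_left h3 (mul_nonneg ha hb)]

/-- The inner points `b` and `c` are convex combinations of `a` and `d` with interchanged weights;
the two concavity inequalities are added. -/
theorem ConcaveOn.add_le_add_of_mem_Icc {s : Set ℝ} {f : ℝ → ℝ} (hf : ConcaveOn ℝ s f) {a b c d : ℝ}
    (ha : a ∈ s) (hd : d ∈ s) (hab : a ≤ b) (hbd : b ≤ d) (h : a + d = b + c) :
    f a + f d ≤ f b + f c := by
  rcases eq_or_lt_of_le (hab.trans hbd) with rfl | hlt
  · obtain rfl : b = a := le_antisymm hbd hab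
    obtain rfl : b = c := by linarith
    rfl
  set t := (b - a) / (d - a) with ht
  have hda : 0 < d - a := by linarith
  have ht0 : 0 ≤ t := div_nonneg (by linarith) hda.le
  have ht1 : t ≤ 1 := (div_le_one hda).2 (by linarith)
  have hb : t * (d - a) = b - a := div_mul_cancel₀ _ hda.ne'
  have e1 := hf.2 ha hd (sub_nonneg.2 ht1) ht0 (by ring)
  have e2 := hf.2 ha hd ht0 (sub_nonneg.2 ht1) (by ring)
  simp only [smul_eq_mul] at e1 e2
  rw [show (1 - t) * a + t * d = b by linarith] at e1
  rw [show t * a + (1 - t) * d = c by linarith] at e2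
  linarith

/-- A list of indices sorted by the `X`-coordinate. -/
def SortedX (X : ℕ → ℝ) (l : List ℕ) : Prop := l.Pairwise fun a b => X a ≤ X b

theorem SortedX.select {X : ℕ → ℝ} {l : List ℕ} (h : SortedX X l) (p : ℕ → Prop) :
    SortedX X (_root_.select p l) :=
  List.Pairwise.filter _ h

theorem SortedX.le {m : Memory} {A B : ℕ} {X : ℕ → ℝ} (h : SortedX X (readList m A B)) {i j : ℕ}
    (hij : i ≤ j) (hj : j < m.nat B 0) : X (m.nat A i) ≤ X (m.nat A j) := by
  rcases eq_or_lt_of_le hij with rfl | hlt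
  · rfl
  have := List.pairwise_iff_getElem.1 h i j (by simp [readList]; omega) (by simpa [readList]) hlt
  simpa [readList] using this

/-- An entry is a term depending on the column only plus a concave function of `X q - X w`. Rows
traverse the candidates backwards, so this difference decreases both along rows and along columns:
it is least at `(r', j')` and greatest at `(r, j)`, and the outer and inner pairs have the same sum.
The hypothesis `hdom` keeps the differences where the half-circle is concave and the square root is
genuine. -/
theorem monge_arcMatrix {m : Memory} {s : ℝ} {src slen W wlen : ℕ}
    (hQ : SortedX (m.real 3) (readList m src slen)) (hW : SortedX (m.real 3) (readList m W wlen))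
    (hdom : ∀ q ∈ readList m src slen, ∀ w ∈ readList m W wlen,
      |m.real 3 q - m.real 3 w| ≤ 1) :
    Monge (arcMatrix m s src slen W) (m.nat slen 0) (m.nat wlen 0) := by
  intro r r' j j' h1 hr hR hj hC
  have hq := hQ.le (i := m.nat slen 0 - r') (j := m.nat slen 0 - r) (by omega) (by omega)
  have hw := hW.le hj hC
  have hdm : ∀ a b, 1 ≤ a → a ≤ m.nat slen 0 → b < m.nat wlen 0 →
      m.real 3 (m.nat src (m.nat slen 0 - a)) - m.real 3 (m.nat W b) ∈ Set.Icc (-1 : ℝ) 1 := by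
    intro a b ha ha' hb
    have := hdom _ (mem_readList.2 ⟨m.nat slen 0 - a, by omega, rfl⟩) _ (mem_readList.2 ⟨b, hb, rfl⟩)
    rw [abs_le] at this
    exact this
  have := concaveOn_halfCircle.add_le_add_of_mem_Icc (hdm r' j' (by omega) hR hC)
    (hdm r j h1 (by omega) (by omega))
    (b := m.real 3 (m.nat src (m.nat slen 0 - r)) - m.real 3 (m.nat W j'))
    (c := m.real 3 (m.nat src (m.nat slen 0 - r')) - m.real 3 (m.nat W j))
    (by linarith) (by linarith) (by ring)
  simp only [arcMatrix, arcHeight]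
  linarith

/-- A point is in the disk around `w` when it is below the upper half-circle and above the lower
one. Reflection turns the second condition into the first; `0 - 1` stands for the sign because
expressions have no negative constants. -/
theorem near_iff_arcHeight {X Y : ℕ → ℝ} {q w : ℕ} (h : |X q - X w| ≤ 1) :
    Near X Y q w ↔ 1 * Y q ≤ arcHeight X Y 1 q w ∧ (0 - 1) * Y q ≤ arcHeight X Y (0 - 1) q w := by
  unfold Near arcHeight
  have h0 : 0 ≤ 1 - (X q - X w) * (X q - X w) := by
    rw [abs_le] at h; nlinarith [h.1, h.2]
  constructor
  · intro hn
    have : |Y q - Y w| ≤ √(1 - (X q - X w) * (X q - X w)) := Real.abs_le_sqrt (by nlinarith)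
    rw [abs_le] at this
    constructor <;> linarith [this.1, this.2]
  · rintro ⟨h1, h2⟩
    have hs := Real.sq_sqrt h0
    have h3 := Real.sqrt_nonneg (1 - (X q - X w) * (X q - X w))
    have : |Y q - Y w| ≤ √(1 - (X q - X w) * (X q - X w)) := abs_le.2 ⟨by linarith, by linarith⟩
    have := sq_le_sq' (by linarith [(abs_le.1 this).1]) (abs_le.1 this).2
    nlinarith

/-- Select the points below all the arcs. -/
def arcFilter (src slen dst dlen W wlen : ℕ) (sE : RealExp) : Program :=
  .seq (rowMinima src slen W wlen sE)
    (filterLoop src slen dst dlen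
      (testFlag (.realLe (.mul sE (.get 4 (var 81))) (.get 100 (var 81)))))

/-- Being below all arcs is being below the row minimum, which is attained by one of the arcs, so a
single comparison per candidate is exact. -/
theorem reaches_arcFilter (src slen dst dlen W wlen : ℕ) (sE : RealExp) (h1 : src < 80)
    (h2 : slen < 80) (h3 : W < 80) (h4 : wlen < 80) (hd : 10 ≤ dst) (hd' : dst < 80) (hl : 10 ≤ dlen)
    (hl' : dlen < 80) (n1 : dst ≠ src) (n2 : dst ≠ slen) (n3 : dlen ≠ src) (n4 : dlen ≠ slen)
    (n5 : dst ≠ dlen) : ∃ c, ∀ (m : Memory) (s : ℝ),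
    (∀ m', sE.eval m' = s) → SortedX (m.real 3) (readList m src slen) →
    SortedX (m.real 3) (readList m W wlen) →
    (∀ q ∈ readList m src slen, ∀ w ∈ readList m W wlen, |m.real 3 q - m.real 3 w| ≤ 1) →
    1 ≤ m.nat wlen 0 → m.nat slen 0 < 2 ^ m.nat 8 0 → (∀ i < m.nat 8 0, m.nat 7 i = 2 ^ i) →
    Reaches (arcFilter src slen dst dlen W wlen sE) m
      (c * ((m.nat 8 0 + 1) * (m.nat slen 0 + m.nat wlen 0 + 1)))
      fun m' => Frame {A | A = dst ∨ A = dlen ∨ 80 ≤ A} m m' ∧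
        readList m' dst dlen = select (fun q => ∀ w ∈ readList m W wlen,
          s * m.real 4 q ≤ arcHeight (m.real 3) (m.real 4) s q w) (readList m src slen) := by
  obtain ⟨c, hc⟩ := reaches_rowMinima src slen W wlen sE h1 h2 h3 h4
  refine ⟨c + (sE.cost + 80), fun m s hs hQ hW hdom hC hL hpow => ?_⟩
  refine ((hc m s hs (monge_arcMatrix hQ hW hdom) hC hL hpow).seq
    (T₂ := (m.nat slen 0 + 1) * (sE.cost + 80)) ?_).mono ?_ (fun _ h => h)
  · rintro m₁ ⟨hfr, hmin⟩
    have esl : m₁.nat slen = m.nat slen := (hfr slen (by simp [rowArrays]; omega)).1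
    have er : readList m₁ src slen = readList m src slen :=
      hfr.readList (by simp [rowArrays]; omega) (by simp [rowArrays]; omega)
    refine (reaches_filterTest (m := m₁) (fun q => ∀ w ∈ readList m W wlen,
      s * m.real 4 q ≤ arcHeight (m.real 3) (m.real 4) s q w) h1 h2 hd' hl' n1 n2 n3 n4 n5
      ?_).mono ?_ ?_
    · intro m₂ x hf hx hmem
      rw [er] at hmem
      obtain ⟨i, hi, rfl⟩ := mem_readList.1 hmem
      have e100 : m₂.real 100 = m₁.real 100 := (hf 100 (by simp; omega)).2
      have e4 : m₂.real 4 = m.real 4 := by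
        rw [(hf 4 (by simp; omega)).2, (hfr 4 (by simp [rowArrays])).2]
      obtain ⟨⟨j, hj, hv⟩, hle⟩ := hmin i hi
      simp only [Test.Holds, RealExp.eval, NatExp.eval, hs, hx, e100, e4]
      constructor
      · rintro h w hw
        obtain ⟨j', hj', rfl⟩ := mem_readList.1 hw
        exact h.trans (hle j' hj')
      · intro h
        rw [hv]
        exact h _ (mem_readList.2 ⟨j, hj, rfl⟩)
    · rw [esl]
      exact Nat.mul_le_mul_left _ (by simp [Test.cost, RealExp.cost, NatExp.cost])
    · rintro m₂ ⟨hf, hl⟩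
      rw [er] at hl
      exact ⟨(hfr.mono (by intro A; simp [rowArrays]; omega)).trans
        (hf.mono (by intro A; simp; omega)), hl⟩
  · rw [Nat.add_mul c]
    refine Nat.add_le_add_left ?_ _
    rw [mul_comm]
    refine Nat.mul_le_mul_left _ ?_
    nlinarith [Nat.zero_le (m.nat 8 0 * (m.nat slen 0 + m.nat wlen 0 + 1))]

/-- Collect in the list `(76, 77)` the points of the list `(16, 17)` whose disks cover the points of
the list `(W, wlen)`. -/
def coverLoop (W wlen : ℕ) : Program :=
  .cond (.natLe (var wlen) (.const 0))
    (filterLoop 16 17 76 77 (testFlag (.natLe (.const 0) (.const 0))))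
    (.seq (filterLoop 16 17 72 73 (testFlag (.and
        (.realLe (.get 3 (.get W (.sub (var wlen) (.const 1)))) (.add (.get 3 (var 81)) (.const 1)))
        (.realLe (.get 3 (var 81)) (.add (.get 3 (.get W (.const 0))) (.const 1))))))
      (.seq (arcFilter 72 73 74 75 W wlen (.const 1))
        (arcFilter 74 75 76 77 W wlen (.sub (.const 0) (.const 1)))))

/-- Checking all pairs would be quadratic. Horizontal distance at most 1 to every `w` needs a
comparison with the extreme entries of the sorted list only; after that, one filter for the upper
and one for the lower arcs remain. The filters keep the list sorted. An empty list of points to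
cover has no extreme entries and is treated apart. -/
theorem reaches_coverLoop (W wlen : ℕ) (h3 : W < 72) (h4 : wlen < 72) : ∃ c, ∀ (m : Memory),
    SortedX (m.real 3) (readList m 16 17) → SortedX (m.real 3) (readList m W wlen) →
    m.nat 17 0 < 2 ^ m.nat 8 0 → (∀ i < m.nat 8 0, m.nat 7 i = 2 ^ i) →
    Reaches (coverLoop W wlen) m (c * ((m.nat 8 0 + 1) * (m.nat 17 0 + m.nat wlen 0 + 1)))
      fun m' => Frame {A | 72 ≤ A} m m' ∧ readList m' 76 77 = select (fun q =>
        ∀ w ∈ readList m W wlen, Near (m.real 3) (m.real 4) q w) (readList m 16 17) := by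
  obtain ⟨c₁, hc₁⟩ := reaches_arcFilter 72 73 74 75 W wlen (.const 1) (by omega) (by omega)
    (by omega) (by omega) (by omega) (by omega) (by omega) (by omega) (by omega) (by omega)
    (by omega) (by omega) (by omega)
  obtain ⟨c₂, hc₂⟩ := reaches_arcFilter 74 75 76 77 W wlen (.sub (.const 0) (.const 1)) (by omega)
    (by omega) (by omega) (by omega) (by omega) (by omega) (by omega) (by omega) (by omega)
    (by omega) (by omega) (by omega) (by omega)
  refine ⟨200 + c₁ + c₂, fun m hQ hW hL hpow => ?_⟩
  set S := (m.nat 8 0 + 1) * (m.nat 17 0 + m.nat wlen 0 + 1) with hS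
  have hSle : m.nat 17 0 + 1 ≤ S := by
    rw [hS]; nlinarith [Nat.zero_le (m.nat 8 0 * (m.nat 17 0 + m.nat wlen 0 + 1))]
  refine (Reaches.cond (T := 150 * S + c₁ * S + c₂ * S) (fun h => ?_) (fun h => ?_)).mono ?_
    (fun _ h => h)
  · simp only [Test.Holds, NatExp.eval, Nat.le_zero] at h
    have hnil : readList m W wlen = [] := by simp [readList, h]
    refine (reaches_filterTest (fun q => ∀ w ∈ readList m W wlen, Near (m.real 3) (m.real 4) q w)
      (by omega) (by omega) (by omega) (by omega) (by omega) (by omega) (by omega) (by omega)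
      (by omega) ?_).mono ?_ ?_
    · intro m' x _ _ _
      simp [Test.Holds, hnil]
    · simp [Test.cost, NatExp.cost]; nlinarith
    · rintro m' ⟨hf, hl⟩
      exact ⟨hf.mono (by intro A; simp; omega), hl⟩
  · simp only [Test.Holds, NatExp.eval, Nat.le_zero] at h
    have hC : 1 ≤ m.nat wlen 0 := by omega
    have hF := reaches_filterTest (m := m) (src := 16) (slen := 17) (dst := 72) (dlen := 73)
      (b := .and
        (.realLe (.get 3 (.get W (.sub (var wlen) (.const 1)))) (.add (.get 3 (var 81)) (.const 1)))
        (.realLe (.get 3 (var 81)) (.add (.get 3 (.get W (.const 0))) (.const 1))))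
      (fun q => ∀ w ∈ readList m W wlen, |m.real 3 q - m.real 3 w| ≤ 1)
      (by omega) (by omega) (by omega) (by omega) (by omega) (by omega) (by omega) (by omega)
      (by omega) (by
        intro m' x hf hx _
        have e1 : m'.nat W = m.nat W := (hf W (by simp; omega)).1
        have e2 : m'.nat wlen = m.nat wlen := (hf wlen (by simp; omega)).1
        have e3 : m'.real 3 = m.real 3 := (hf 3 (by simp)).2
        simp only [Test.Holds, RealExp.eval, NatExp.eval, hx, e1, e2, e3, Nat.cast_one]
        constructor
        · rintro ⟨ha, hb⟩ w hw
          obtain ⟨j, hj, rfl⟩ := mem_readList.1 hw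
          have := hW.le (Nat.zero_le j) hj
          have := hW.le (i := j) (j := m.nat wlen 0 - 1) (by omega) (by omega)
          rw [abs_le]
          constructor <;> linarith
        · intro h
          have ha := abs_le.1 (h _ (mem_readList.2 ⟨m.nat wlen 0 - 1, by omega, rfl⟩))
          have hb := abs_le.1 (h _ (mem_readList.2 ⟨0, by omega, rfl⟩))
          constructor <;> linarith [ha.1, hb.2])
    refine (hF.seq (T₂ := c₁ * S + c₂ * S) ?_).mono ?_ (fun _ h => h)
    · rintro m₁ ⟨hf₁, hl₁⟩
      have e3 : m₁.real 3 = m.real 3 := (hf₁ 3 (by simp)).2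
      have e4 : m₁.real 4 = m.real 4 := (hf₁ 4 (by simp)).2
      have e7 : m₁.nat 7 = m.nat 7 := (hf₁ 7 (by simp)).1
      have e8 : m₁.nat 8 = m.nat 8 := (hf₁ 8 (by simp)).1
      have eW : readList m₁ W wlen = readList m W wlen := hf₁.readList (by simp; omega)
        (by simp; omega)
      have el : m₁.nat wlen = m.nat wlen := (hf₁ wlen (by simp; omega)).1
      have h73 : m₁.nat 73 0 ≤ m.nat 17 0 := by
        rw [← length_readList m₁ 72 73, hl₁, ← length_readList m 16 17]
        exact length_select_le _ _
      refine ((hc₁ m₁ 1 (by simp [RealExp.eval]) ?_ ?_ ?_ ?_ ?_ ?_).seq (T₂ := c₂ * S) ?_).mono ?_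
        (fun _ h => h)
      · rw [e3, hl₁]; exact hQ.select _
      · rw [e3, eW]; exact hW
      · rw [e3, hl₁, eW]
        intro q hq w hw
        exact (mem_select.1 hq).2 w hw
      · rw [el]; exact hC
      · rw [e8]; omega
      · rw [e7, e8]; exact hpow
      · rintro m₂ ⟨hf₂, hl₂⟩
        have e3' : m₂.real 3 = m.real 3 := by rw [(hf₂ 3 (by simp)).2, e3]
        have e4' : m₂.real 4 = m.real 4 := by rw [(hf₂ 4 (by simp)).2, e4]
        have e7' : m₂.nat 7 = m.nat 7 := by rw [(hf₂ 7 (by simp)).1, e7]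
        have e8' : m₂.nat 8 = m.nat 8 := by rw [(hf₂ 8 (by simp)).1, e8]
        have eW' : readList m₂ W wlen = readList m W wlen := by
          rw [hf₂.readList (by simp; omega) (by simp; omega), eW]
        have el' : m₂.nat wlen = m.nat wlen := by rw [(hf₂ wlen (by simp; omega)).1, el]
        have h75 : m₂.nat 75 0 ≤ m.nat 17 0 := by
          rw [← length_readList m₂ 74 75, hl₂]
          exact (length_select_le _ _).trans (by rw [length_readList]; exact h73)
        refine (hc₂ m₂ (0 - 1) (by simp [RealExp.eval]) ?_ ?_ ?_ ?_ ?_ ?_).mono ?_ ?_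
        · rw [e3', hl₂, hl₁]; exact (hQ.select _).select _
        · rw [e3', eW']; exact hW
        · rw [e3', hl₂, hl₁, eW']
          intro q hq w hw
          exact (mem_select.1 (mem_select.1 hq).1).2 w hw
        · rw [el']; exact hC
        · rw [e8']; omega
        · rw [e7', e8']; exact hpow
        · rw [e8', el']
          refine Nat.mul_le_mul_left _ ?_
          rw [hS]
          exact Nat.mul_le_mul_left _ (by omega)
        · rintro m₃ ⟨hf₃, hl₃⟩
          refine ⟨((hf₁.mono ?_).trans (hf₂.mono ?_)).trans (hf₃.mono ?_), ?_⟩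
          · intro A; simp; omega
          · intro A; simp; omega
          · intro A; simp; omega
          · rw [hl₃, hl₂, hl₁, select_select, select_select, e3', e4', e3, e4, eW', eW]
            refine select_congr fun q _ => ⟨?_, ?_⟩
            · rintro ⟨h1, h2, h3⟩ w hw
              exact (near_iff_arcHeight (h1 w hw)).2 ⟨h2 w hw, h3 w hw⟩
            · intro hn
              have hd : ∀ w ∈ readList m W wlen, |m.real 3 q - m.real 3 w| ≤ 1 := by
                intro w hw
                refine abs_le_one_iff_mul_self_le_one.2 ?_
                have := hn w hw
                unfold Near at this
                nlinarith [mul_self_nonneg (m.real 4 q - m.real 4 w)]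
              exact ⟨hd, fun w hw => ((near_iff_arcHeight (hd w hw)).1 (hn w hw)).1,
                fun w hw => ((near_iff_arcHeight (hd w hw)).1 (hn w hw)).2⟩
      · rw [e8, el]
        refine Nat.add_le_add_right (Nat.mul_le_mul_left _ ?_) _
        rw [hS]
        exact Nat.mul_le_mul_left _ (by omega)
    · simp only [Test.cost, RealExp.cost, NatExp.cost]
      nlinarith
  · simp only [Test.cost, NatExp.cost]
    nlinarith

/-! ### Searching for small covers -/

/-- The disks around the points of `l` cover the points of `W`. -/
def ListCovers (X Y : ℕ → ℝ) (l W : List ℕ) : Prop := ∀ w ∈ W, ∃ a ∈ l, Near X Y a w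

/-- The test whether the point in variable `81` is not covered by the `k`-th chosen point. -/
def farTest (k : ℕ) : Test :=
  .not (.realLe
    (.add (.mul (.sub (.get 3 (.get 18 (.const k))) (.get 3 (var 81)))
        (.sub (.get 3 (.get 18 (.const k))) (.get 3 (var 81))))
      (.mul (.sub (.get 4 (.get 18 (.const k))) (.get 4 (var 81)))
        (.sub (.get 4 (.get 18 (.const k))) (.get 4 (var 81))))) (.const 1))

/-- Choose the point `e` as the `k`-th point, and collect the points of the `k`-th list that it does
not cover in the next list. -/
def chooseStep (k : ℕ) (e : NatExp) : Program :=
  .seq (.setNat 18 (.const k) e)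
    (filterLoop (40 + 4 * k) (41 + 4 * k) (44 + 4 * k) (45 + 4 * k) (testFlag (farTest k)))

/-- Level `k` of the recursion owns the arrays from `40 + 4 * k` on. With `k ≤ 6` all levels stay
below `72`, where the work space of `coverLoop` begins. -/
theorem reaches_chooseStep (k : ℕ) (e : NatExp) (hk : k ≤ 6) (m : Memory) :
    Reaches (chooseStep k e) m (e.cost + 10 + (m.nat (41 + 4 * k) 0 + 1) * 200) fun m' =>
      Frame {A | A = 18 ∨ A = 44 + 4 * k ∨ A = 45 + 4 * k ∨ (80 ≤ A ∧ A < 90)} m m' ∧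
      (∀ i, i ≠ k → m'.nat 18 i = m.nat 18 i) ∧ m'.nat 18 k = e.eval m ∧
      readList m' (44 + 4 * k) (45 + 4 * k) =
        select (fun w => ¬ Near (m.real 3) (m.real 4) (e.eval m) w)
          (readList m (40 + 4 * k) (41 + 4 * k)) := by
  have h0 : Reaches (.setNat 18 (.const k) e) m (e.cost + 2)
      (fun m' => m' = m.writeNat 18 k (e.eval m)) := by
    refine (reaches_of_loopFree (by trivial) ?_).mono
      (by simp [Program.maxCost, NatExp.cost]; omega) (fun _ h => h)
    simp [Program.exec, NatExp.eval]
  refine (h0.seq (T₂ := (m.nat (41 + 4 * k) 0 + 1) * 200) ?_).mono (by omega) (fun _ h => h)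
  rintro m₁ rfl
  set a := e.eval m
  have hr : readList (m.writeNat 18 k a) (40 + 4 * k) (41 + 4 * k) =
      readList m (40 + 4 * k) (41 + 4 * k) := readList_congr
    (by funext j; rw [Memory.nat_writeNat, if_neg (by omega)])
    (by funext j; rw [Memory.nat_writeNat, if_neg (by omega)])
  refine (reaches_filterTest (fun w => ¬ Near (m.real 3) (m.real 4) a w) (by omega) (by omega)
    (by omega) (by omega) (by omega) (by omega) (by omega) (by omega) (by omega) ?_).mono ?_ ?_
  · intro m' x hf hx _
    have e3 : m'.real 3 = m.real 3 := (hf 3 (by simp; omega)).2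
    have e4 : m'.real 4 = m.real 4 := (hf 4 (by simp; omega)).2
    have e18 : m'.nat 18 k = a := by
      rw [(hf 18 (by simp; omega)).1]; simp [Memory.nat_writeNat]
    simp [farTest, Test.Holds, RealExp.eval, NatExp.eval, e3, e4, e18, hx, Near]
  · rw [Memory.nat_writeNat, if_neg (by omega)]
    exact Nat.mul_le_mul_left _ (by simp [farTest, Test.cost, RealExp.cost, NatExp.cost])
  · rintro m' ⟨hf, hl⟩
    have e18 : m'.nat 18 = (m.writeNat 18 k a).nat 18 := (hf 18 (by simp; omega)).1
    refine ⟨?_, ?_, ?_, ?_⟩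
    · exact ((Frame.refl _ m).writeNat (by simp) k a).trans (hf.mono (by intro A; simp; omega))
    · intro i hi; rw [e18]; simp [Memory.nat_writeNat, hi]
    · rw [e18]; simp [Memory.nat_writeNat]
    · rw [hl, hr]

/-- Look for `d + 1` disks around points of the list `(16, 17)` that cover the points of the `k`-th
list; `18` holds the points chosen, `19` their number, and `20` is set to `1` on success. -/
def search : ℕ → ℕ → Program
  | k, 0 => .seq (coverLoop (40 + 4 * k) (41 + 4 * k))
      (.cond (.natLe (.const 1) (var 77))
        (.seq (.setNat 18 (.const k) (.get 76 (.const 0)))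
          (.seq (assign 19 (.const (k + 1))) (assign 20 (.const 1))))
        .skip)
  | k, d + 1 => forLoop (42 + 4 * k) (var 17)
      (.cond (.natLe (var 20) (.const 0))
        (.seq (chooseStep k (.get 16 (var (42 + 4 * k)))) (search (k + 1) d))
        .skip)

/-- The outcome of `search`. -/
def SearchResult (X Y : ℕ → ℝ) (Q W : List ℕ) (k d : ℕ) (m' : Memory) : Prop :=
  (m'.nat 20 0 = 1 ∧ m'.nat 19 0 = k + (d + 1) ∧ (∀ i ≤ d, m'.nat 18 (k + i) ∈ Q) ∧
    ∀ w ∈ W, ∃ i ≤ d, Near X Y (m'.nat 18 (k + i)) w) ∨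
  (m'.nat 20 0 = 0 ∧ ∀ l : List ℕ, l.length = d + 1 → (∀ a ∈ l, a ∈ Q) → ¬ ListCovers X Y l W)

/-- This is the recursion of the search: once the first disk is fixed, only the points it misses
matter. -/
theorem listCovers_cons {X Y : ℕ → ℝ} {a : ℕ} {l W : List ℕ} :
    ListCovers X Y (a :: l) W ↔ ListCovers X Y l (select (fun w => ¬ Near X Y a w) W) := by
  simp only [ListCovers, mem_select, List.mem_cons]
  constructor
  · rintro h w ⟨hw, hn⟩
    obtain ⟨b, rfl | hb, hbw⟩ := h w hw
    · exact absurd hbw hn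
    · exact ⟨b, hb, hbw⟩
  · intro h w hw
    by_cases hn : Near X Y a w
    · exact ⟨a, Or.inl rfl, hn⟩
    · obtain ⟨b, hb, hbw⟩ := h w ⟨hw, hn⟩
      exact ⟨b, Or.inr hb, hbw⟩

/-- The first `d` disks are enumerated by nested loops and the last comes from `coverLoop`. Finding
the last disk for all candidates at once replaces a factor that is quadratic in the list lengths by
an almost linear one. -/
theorem reaches_search (d : ℕ) : ∀ k, k + d ≤ 6 → ∃ c, ∀ (m : Memory) (N : ℕ),
    SortedX (m.real 3) (readList m 16 17) →
    SortedX (m.real 3) (readList m (40 + 4 * k) (41 + 4 * k)) →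
    m.nat 17 0 ≤ N → m.nat (41 + 4 * k) 0 ≤ N → N < 2 ^ m.nat 8 0 →
    (∀ i < m.nat 8 0, m.nat 7 i = 2 ^ i) → m.nat 20 0 = 0 →
    Reaches (search k d) m (c * ((m.nat 17 0 + 1) ^ d * ((m.nat 8 0 + 1) * (N + 1)))) fun m' =>
      Frame {A | A = 18 ∨ A = 19 ∨ A = 20 ∨ 42 + 4 * k ≤ A} m m' ∧
      (∀ i < k, m'.nat 18 i = m.nat 18 i) ∧
      SearchResult (m.real 3) (m.real 4) (readList m 16 17)
        (readList m (40 + 4 * k) (41 + 4 * k)) k d m' := by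
  induction d with
  | zero =>
    intro k hk
    obtain ⟨c, hc⟩ := reaches_coverLoop (40 + 4 * k) (41 + 4 * k) (by omega) (by omega)
    refine ⟨2 * c + 30, fun m N hQ hW hQN hWN hL hpow h20 => ?_⟩
    refine ((hc m hQ hW (by omega) hpow).seq (T₂ := 30) ?_).mono ?_ (fun _ h => h)
    · rintro m₁ ⟨hf, hl⟩
      have e20 : m₁.nat 20 0 = 0 := by rw [(hf 20 (by simp)).1, h20]
      have e18 : m₁.nat 18 = m.nat 18 := (hf 18 (by simp)).1
      refine (reaches_of_loopFree (by simp [Program.LoopFree]) ?_).mono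
        (by simp [Program.maxCost, NatExp.cost, Test.cost]) (fun _ h => h)
      simp only [Program.exec, Test.Holds, NatExp.eval]
      have hf' : Frame {A | A = 18 ∨ A = 19 ∨ A = 20 ∨ 42 + 4 * k ≤ A} m m₁ :=
        hf.mono (by intro A; simp; omega)
      by_cases h77 : 1 ≤ m₁.nat 77 0
      · rw [branch_pos h77]
        have hmem : m₁.nat 76 0 ∈ readList m₁ 76 77 := mem_readList.2 ⟨0, h77, rfl⟩
        rw [hl, mem_select] at hmem
        refine ⟨((hf'.writeNat (by simp) _ _).writeNat (by simp) _ _).writeNat (by simp) _ _,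
          ?_, Or.inl ⟨?_, ?_, ?_, ?_⟩⟩
        · intro i hi
          simp [Memory.nat_writeNat, hi.ne, e18]
        · simp [Memory.nat_writeNat]
        · simp [Memory.nat_writeNat]
        · intro i hi
          obtain rfl : i = 0 := by omega
          simpa [Memory.nat_writeNat] using hmem.1
        · intro w hw
          exact ⟨0, le_rfl, by simpa [Memory.nat_writeNat] using hmem.2 w hw⟩
      · rw [branch_neg h77]
        refine ⟨hf', fun i hi => by rw [e18], Or.inr ⟨e20, ?_⟩⟩
        intro l hlen hlQ hcov
        obtain ⟨q, rfl⟩ := List.length_eq_one_iff.1 hlen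
        have hq : q ∈ readList m₁ 76 77 := by
          rw [hl, mem_select]
          exact ⟨hlQ q (by simp), fun w hw => by simpa using hcov w hw⟩
        obtain ⟨i, hi, -⟩ := mem_readList.1 hq
        omega
    · have h1 : m.nat 17 0 + m.nat (41 + 4 * k) 0 + 1 ≤ 2 * (N + 1) := by omega
      have h2 := Nat.mul_le_mul_left c (Nat.mul_le_mul_left (m.nat 8 0 + 1) h1)
      have h3 : 1 ≤ (m.nat 8 0 + 1) * (N + 1) := Nat.mul_pos (by omega) (by omega)
      rw [pow_zero, one_mul, Nat.add_mul]
      nlinarith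
  | succ d ih =>
    intro k hk
    obtain ⟨c, hc⟩ := ih (k + 1) (by omega)
    refine ⟨c + 1000, fun m N hQ hW hQN hWN hL hpow h20 => ?_⟩
    set X := m.real 3 with hX
    set Y := m.real 4 with hY
    set Q := readList m 16 17 with hQdef
    set W := readList m (40 + 4 * k) (41 + 4 * k) with hWdef
    set F : Set ℕ := {A | A = 18 ∨ A = 19 ∨ A = 20 ∨ 42 + 4 * k ≤ A} with hF
    set B := (m.nat 17 0 + 1) ^ d * ((m.nat 8 0 + 1) * (N + 1)) with hB
    have hBN : N + 1 ≤ B := by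
      have h1 : 1 ≤ (m.nat 17 0 + 1) ^ d := Nat.one_le_pow _ _ (by omega)
      calc N + 1 = 1 * (1 * (N + 1)) := by ring
        _ ≤ B := Nat.mul_le_mul h1 (Nat.mul_le_mul_right _ (by omega))
    -- Either a cover has been found and the remaining iterations do nothing, or no cover begins
    -- with one of the first `i` candidates.
    refine (reaches_forLoop_const (m.nat 17 0) (c * B + 400 * B)
      (fun i m' => Frame F m m' ∧ (∀ i < k, m'.nat 18 i = m.nat 18 i) ∧
        ((m'.nat 20 0 = 1 ∧ m'.nat 19 0 = k + (d + 1 + 1) ∧ (∀ i ≤ d + 1, m'.nat 18 (k + i) ∈ Q) ∧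
          ∀ w ∈ W, ∃ i ≤ d + 1, Near X Y (m'.nat 18 (k + i)) w) ∨
        (m'.nat 20 0 = 0 ∧ ∀ j < i, ∀ l : List ℕ, l.length = d + 1 → (∀ a ∈ l, a ∈ Q) →
          ¬ ListCovers X Y (m.nat 16 j :: l) W))) ?_ ?_ ?_ ?_).mono ?_ ?_
    · exact ⟨Frame.refl _ _, fun _ _ => rfl, Or.inr ⟨h20, by simp⟩⟩
    · rintro i m' v ⟨hf, hp, hres⟩
      have e : ∀ A < 42 + 4 * k, (m'.writeNat (42 + 4 * k) 0 v).nat A = m'.nat A := by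
        intro A hA; funext j; rw [Memory.nat_writeNat, if_neg (by omega)]
      refine ⟨hf.writeNat (by simp [hF]) _ _, ?_, ?_⟩
      · rw [e 18 (by omega)]; exact hp
      · rw [e 18 (by omega), e 19 (by omega), e 20 (by omega)]; exact hres
    · rintro i m' ⟨hf, -⟩
      simp only [NatExp.eval, (hf 17 (by simp [hF]; omega)).1]
    · rintro i hi m' ⟨hf, hp, hres⟩ hci
      have e3 : m'.real 3 = X := (hf 3 (by simp [hF]; omega)).2
      have e4 : m'.real 4 = Y := (hf 4 (by simp [hF]; omega)).2
      have e16 : m'.nat 16 = m.nat 16 := (hf 16 (by simp [hF]; omega)).1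
      have e17 : m'.nat 17 = m.nat 17 := (hf 17 (by simp [hF]; omega)).1
      have e7 : m'.nat 7 = m.nat 7 := (hf 7 (by simp [hF]; omega)).1
      have e8 : m'.nat 8 = m.nat 8 := (hf 8 (by simp [hF]; omega)).1
      have eW : readList m' (40 + 4 * k) (41 + 4 * k) = W :=
        hf.readList (by simp [hF]; omega) (by simp [hF]; omega)
      have el : m'.nat (41 + 4 * k) = m.nat (41 + 4 * k) := (hf _ (by simp [hF]; omega)).1
      set a := m.nat 16 i with ha
      have haQ : a ∈ Q := mem_readList.2 ⟨i, hi, rfl⟩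
      refine (Reaches.cond (T := c * B + 300 * B) (fun h => ?_) (fun h => ?_)).mono ?_ (fun _ h => h)
      · simp only [Test.Holds, NatExp.eval, Nat.le_zero] at h
        have hres' := hres.resolve_left (by omega)
        have heval : (NatExp.get 16 (var (42 + 4 * k))).eval m' = a := by
          simp [NatExp.eval, hci, e16, ha]
        have hch := reaches_chooseStep k (.get 16 (var (42 + 4 * k))) (by omega) m'
        rw [heval, eW, el, e3, e4] at hch
        refine (hch.seq (T₂ := c * B) ?_).mono ?_ (fun _ h => h)
        · rintro m₁ ⟨hf₁, hp₁, hk₁, hl₁⟩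
          have g3 : m₁.real 3 = X := by rw [(hf₁ 3 (by simp; omega)).2, e3]
          have g4 : m₁.real 4 = Y := by rw [(hf₁ 4 (by simp; omega)).2, e4]
          have g16 : m₁.nat 16 = m.nat 16 := by rw [(hf₁ 16 (by simp; omega)).1, e16]
          have g17 : m₁.nat 17 = m.nat 17 := by rw [(hf₁ 17 (by simp; omega)).1, e17]
          have g7 : m₁.nat 7 = m.nat 7 := by rw [(hf₁ 7 (by simp; omega)).1, e7]
          have g8 : m₁.nat 8 = m.nat 8 := by rw [(hf₁ 8 (by simp; omega)).1, e8]
          have g20 : m₁.nat 20 0 = 0 := by rw [(hf₁ 20 (by simp; omega)).1, h]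
          have gc : m₁.nat (42 + 4 * k) = m'.nat (42 + 4 * k) := (hf₁ _ (by simp; omega)).1
          have gQ : readList m₁ 16 17 = Q := readList_congr g16 g17
          have hl' : readList m₁ (40 + 4 * (k + 1)) (41 + 4 * (k + 1)) =
              select (fun w => ¬ Near X Y a w) W := by
            rw [← hl₁]; congr 1 <;> ring
          have hlen : m₁.nat (41 + 4 * (k + 1)) 0 ≤ N := by
            rw [← length_readList m₁ (40 + 4 * (k + 1)), hl']
            refine (length_select_le _ _).trans ?_
            rw [hWdef, length_readList]; exact hWN
          have hrec := hc m₁ N (by rw [g3, gQ]; exact hQ) (by rw [g3, hl']; exact hW.select _)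
            (by rw [g17]; exact hQN) hlen (by rw [g8]; exact hL) (by rw [g7, g8]; exact hpow) g20
          rw [g17, g8, g3, g4, gQ, hl'] at hrec
          refine hrec.mono le_rfl ?_
          rintro m₂ ⟨hf₂, hp₂, hres₂⟩
          refine ⟨⟨(hf.trans (hf₁.mono ?_)).trans (hf₂.mono ?_), ?_, ?_⟩, ?_⟩
          · intro A; simp [hF]; omega
          · intro A; simp [hF]; omega
          · intro j hj
            rw [hp₂ j (by omega), hp₁ j (by omega), hp j hj]
          · rcases hres₂ with ⟨r1, r2, r3, r4⟩ | ⟨r1, r2⟩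
            · left
              have hk2 : m₂.nat 18 k = a := by rw [hp₂ k (by omega), hk₁]
              refine ⟨r1, by rw [r2]; ring, ?_, ?_⟩
              · intro j hj
                rcases j with _ | j
                · rw [add_zero, hk2]; exact haQ
                · rw [show k + (j + 1) = k + 1 + j by ring]
                  exact r3 j (by omega)
              · intro w hw
                by_cases hn : Near X Y a w
                · exact ⟨0, by omega, by rw [add_zero, hk2]; exact hn⟩
                · obtain ⟨j, hj, hjw⟩ := r4 w (mem_select.2 ⟨hw, hn⟩)
                  exact ⟨j + 1, by omega, by rwa [show k + (j + 1) = k + 1 + j by ring]⟩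
            · right
              refine ⟨r1, fun j hj l hl hlQ hcov => ?_⟩
              rcases Nat.lt_succ_iff_lt_or_eq.1 hj with hj' | rfl
              · exact hres'.2 j hj' l hl hlQ hcov
              · exact r2 l hl hlQ (listCovers_cons.1 hcov)
          · rw [(hf₂ _ (by simp; omega)).1, gc, hci]
        · simp only [NatExp.cost]
          nlinarith
      · simp only [Test.Holds, NatExp.eval, Nat.le_zero] at h
        refine (reaches_of_loopFree (by trivial) ?_).mono
          (by simp [Program.maxCost]; nlinarith [Nat.zero_le (c * B)]) (fun _ h => h)
        exact ⟨⟨hf, hp, Or.inl (hres.resolve_right (fun h' => h h'.1))⟩, hci⟩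
      · simp only [Test.cost, NatExp.cost]
        nlinarith
    · have h1 : c * B + 400 * B + (var 17).cost + 20 ≤ (c + 1000) * B := by
        simp only [NatExp.cost]; nlinarith
      calc _ ≤ (m.nat 17 0 + 1) * ((c + 1000) * B) := Nat.mul_le_mul_left _ h1
        _ = _ := by rw [hB, pow_succ]; ring
    · rintro m' ⟨⟨hf, hp, hres⟩, -⟩
      refine ⟨hf, hp, ?_⟩
      rcases hres with hr | ⟨r1, r2⟩
      · exact Or.inl hr
      · refine Or.inr ⟨r1, fun l hl hlQ hcov => ?_⟩
        obtain ⟨a, l', rfl⟩ := List.exists_of_length_succ l hl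
        obtain ⟨j, hj, rfl⟩ := mem_readList.1 (hlQ a (by simp))
        exact r2 j hj l' (by simpa using hl) (fun b hb => hlQ b (by simp [hb])) hcov

/-- Repeatedly choose an uncovered point, at most `f` times. -/
def greedy : ℕ → ℕ → Program
  | k, 0 => assign 19 (.const k)
  | k, f + 1 => .cond (.natLe (.const 1) (var (41 + 4 * k)))
      (.seq (chooseStep k (.get (40 + 4 * k) (.const 0))) (greedy (k + 1) f))
      (assign 19 (.const k))

/-- Each point is chosen among those missed by its predecessors, so the chosen points are pairwise
far apart. If `f` of them do not cover, a point still missed extends them to `f + 1` such points,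
which a packing argument rules out where this is used. -/
theorem reaches_greedy (f : ℕ) : ∀ k, k + f ≤ 7 → ∃ c, ∀ (m : Memory) (N : ℕ),
    m.nat (41 + 4 * k) 0 ≤ N →
    Reaches (greedy k f) m (c * (N + 1)) fun m' =>
      Frame {A | A = 18 ∨ A = 19 ∨ 42 + 4 * k ≤ A} m m' ∧ (∀ i < k, m'.nat 18 i = m.nat 18 i) ∧
      ∃ r ≤ f, m'.nat 19 0 = k + r ∧
        (∀ i < r, m'.nat 18 (k + i) ∈ readList m (40 + 4 * k) (41 + 4 * k)) ∧
        ((∀ w ∈ readList m (40 + 4 * k) (41 + 4 * k), ∃ i < r,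
            Near (m.real 3) (m.real 4) (m'.nat 18 (k + i)) w) ∨
          ∃ l : List ℕ, l.length = f + 1 ∧ (∀ a ∈ l, a ∈ readList m (40 + 4 * k) (41 + 4 * k)) ∧
            l.Pairwise fun a b => ¬ Near (m.real 3) (m.real 4) a b) := by
  have hassign : ∀ (k : ℕ) (m : Memory), Reaches (assign 19 (.const k)) m 3
      (fun m' => m' = m.writeNat 19 0 k) := by
    intro k m
    refine (reaches_of_loopFree (by trivial) ?_).mono
      (by simp [Program.maxCost, NatExp.cost]) (fun _ h => h)
    simp [Program.exec, NatExp.eval]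
  induction f with
  | zero =>
    intro k hk
    refine ⟨3, fun m N hN => (hassign k m).mono (by omega) ?_⟩
    rintro _ rfl
    refine ⟨(Frame.refl _ _).writeNat (by simp) _ _, fun i hi => by simp [Memory.nat_writeNat], 0,
      le_rfl, by simp [Memory.nat_writeNat], by simp, ?_⟩
    rcases List.eq_nil_or_concat' (readList m (40 + 4 * k) (41 + 4 * k)) with h | ⟨l, w, h⟩
    · left; simp [h]
    · right; exact ⟨[w], rfl, by simp [h], by simp⟩
  | succ f ih =>
    intro k hk
    obtain ⟨c, hc⟩ := ih (k + 1) (by omega)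
    refine ⟨c + 300, fun m N hN => ?_⟩
    refine (Reaches.cond (T := c * (N + 1) + 250 * (N + 1)) (fun h => ?_) (fun h => ?_)).mono ?_
      (fun _ h => h)
    · simp only [Test.Holds, NatExp.eval] at h
      have hch := reaches_chooseStep k (.get (40 + 4 * k) (.const 0)) (by omega) m
      set W := readList m (40 + 4 * k) (41 + 4 * k) with hW
      set a := (NatExp.get (40 + 4 * k) (.const 0)).eval m with ha
      have haW : a ∈ W := mem_readList.2 ⟨0, h, rfl⟩
      refine (hch.seq (T₂ := c * (N + 1)) ?_).mono ?_ (fun _ h => h)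
      · rintro m₁ ⟨hf₁, hp₁, hk₁, hl₁⟩
        have hl' : readList m₁ (40 + 4 * (k + 1)) (41 + 4 * (k + 1)) =
            select (fun w => ¬ Near (m.real 3) (m.real 4) a w) W := by
          rw [← hl₁]; congr 1 <;> ring
        have hlen : m₁.nat (41 + 4 * (k + 1)) 0 ≤ N := by
          rw [← length_readList m₁ (40 + 4 * (k + 1)), hl']
          refine (length_select_le _ _).trans ?_
          rw [hW, length_readList]; exact hN
        have hrec := hc m₁ N hlen
        rw [hl', (hf₁ 3 (by simp; omega)).2, (hf₁ 4 (by simp; omega)).2] at hrec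
        refine hrec.mono le_rfl ?_
        rintro m₂ ⟨hf₂, hp₂, r, hr, h19, hmem, hres⟩
        have hk2 : m₂.nat 18 k = a := by rw [hp₂ k (by omega), hk₁]
        have hadd : ∀ j, k + (j + 1) = k + 1 + j := fun j => by ring
        refine ⟨(hf₁.mono ?_).trans (hf₂.mono ?_), ?_, r + 1, by omega, by rw [h19]; ring, ?_, ?_⟩
        · intro A; simp; omega
        · intro A; simp; omega
        · intro i hi; rw [hp₂ i (by omega), hp₁ i hi.ne]
        · rintro (_ | j) hj
          · rw [add_zero, hk2]; exact haW
          · rw [hadd]; exact (mem_select.1 (hmem j (by omega))).1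
        · rcases hres with hcov | ⟨l, hl, hlW, hpair⟩
          · left
            intro w hw
            by_cases hn : Near (m.real 3) (m.real 4) a w
            · exact ⟨0, by omega, by rw [add_zero, hk2]; exact hn⟩
            · obtain ⟨j, hj, hjw⟩ := hcov w (mem_select.2 ⟨hw, hn⟩)
              exact ⟨j + 1, by omega, by rwa [hadd]⟩
          · right
            refine ⟨a :: l, by simp [hl], ?_, List.pairwise_cons.2 ⟨fun b hb => ?_, hpair⟩⟩
            · intro b hb
              rcases List.mem_cons.1 hb with rfl | hb
              · exact haW
              · exact (mem_select.1 (hlW b hb)).1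
            · exact (mem_select.1 (hlW b hb)).2
      · simp only [NatExp.cost]
        omega
    · simp only [Test.Holds, NatExp.eval] at h
      have hnil : readList m (40 + 4 * k) (41 + 4 * k) = [] := by
        rw [readList, show m.nat (41 + 4 * k) 0 = 0 by omega]; rfl
      refine (hassign k m).mono (by omega) ?_
      rintro _ rfl
      refine ⟨(Frame.refl _ _).writeNat (by simp) _ _, fun i hi => by simp [Memory.nat_writeNat], 0,
        by omega, by simp [Memory.nat_writeNat], by simp, ?_⟩
      left; simp [hnil]
    · simp only [Test.cost, NatExp.cost]
      nlinarith

/-! ### Solving a single septa-hexagon problem -/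

/-- `l` is a shortest list of points of `Q` whose disks cover `W`. -/
def IsOptList (X Y : ℕ → ℝ) (Q W l : List ℕ) : Prop :=
  (∀ a ∈ l, a ∈ Q) ∧ ListCovers X Y l W ∧
    ∀ l' : List ℕ, (∀ a ∈ l', a ∈ Q) → ListCovers X Y l' W → l.length ≤ l'.length

/-- Look for at most `D` disks. -/
def searchUpTo : ℕ → Program
  | 0 => assign 20 (.const 0)
  | D + 1 => .seq (searchUpTo D) (.cond (.natLe (var 20) (.const 0)) (search 0 D) .skip)

/-- The numbers of disks are tried in increasing order, so the first success is optimal. -/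
theorem reaches_searchUpTo (D : ℕ) (hD : D ≤ 6) : ∃ c, ∀ (m : Memory) (N : ℕ),
    SortedX (m.real 3) (readList m 16 17) → SortedX (m.real 3) (readList m 40 41) →
    readList m 40 41 ≠ [] → m.nat 17 0 ≤ N → m.nat 41 0 ≤ N → N < 2 ^ m.nat 8 0 →
    (∀ i < m.nat 8 0, m.nat 7 i = 2 ^ i) →
    Reaches (searchUpTo D) m
      (c * ((m.nat 17 0 + 1) * (N + 1) ^ 4 * ((m.nat 8 0 + 1) * (N + 1)))) fun m' =>
      Frame {A | A = 18 ∨ A = 19 ∨ A = 20 ∨ 42 ≤ A} m m' ∧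
      ((m'.nat 20 0 = 1 ∧ IsOptList (m.real 3) (m.real 4) (readList m 16 17) (readList m 40 41)
          (readList m' 18 19)) ∨
        (m'.nat 20 0 = 0 ∧ ∀ l : List ℕ, (∀ a ∈ l, a ∈ readList m 16 17) →
          ListCovers (m.real 3) (m.real 4) l (readList m 40 41) → D < l.length)) := by
  induction D with
  | zero =>
    refine ⟨3, fun m N hQ hW hne hQN hWN hL hpow => ?_⟩
    refine (reaches_of_loopFree (by trivial) ?_).mono
      (T' := 3 * ((m.nat 17 0 + 1) * (N + 1) ^ 4 * ((m.nat 8 0 + 1) * (N + 1)))) ?_ (fun _ h => h)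
    · refine ⟨(Frame.refl _ _).writeNat (by simp) _ _, Or.inr ⟨by
        simp [searchUpTo, Program.exec, Memory.nat_writeNat, NatExp.eval], fun l hl hcov => ?_⟩⟩
      -- A nonempty list of points is not covered by no disks at all.
      rw [List.length_pos_iff]
      rintro rfl
      obtain ⟨w, hw⟩ := List.exists_mem_of_ne_nil _ hne
      obtain ⟨a, ha, -⟩ := hcov w hw
      simp at ha
    · simp only [searchUpTo, Program.maxCost, NatExp.cost]
      have : 1 ≤ (m.nat 17 0 + 1) * (N + 1) ^ 4 * ((m.nat 8 0 + 1) * (N + 1)) := Nat.succ_le_of_lt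
        (by positivity)
      omega
  | succ D ih =>
    obtain ⟨c, hc⟩ := ih (by omega)
    obtain ⟨c', hc'⟩ := reaches_search D 0 (by omega)
    refine ⟨c + c' + 10, fun m N hQ hW hne hQN hWN hL hpow => ?_⟩
    set B := (m.nat 17 0 + 1) * (N + 1) ^ 4 * ((m.nat 8 0 + 1) * (N + 1)) with hB
    have hB1 : 1 ≤ B := Nat.succ_le_of_lt (by positivity)
    -- Here `D ≤ 5`. Of the factors counting candidates one is kept and at most four are bounded by
    -- `N + 1`; the one kept is what is later summed over all septa-hexagons.
    have hpw : (m.nat 17 0 + 1) ^ D * ((m.nat 8 0 + 1) * (N + 1)) ≤ B := by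
      refine Nat.mul_le_mul_right _ ?_
      rcases D with _ | D
      · rw [pow_zero]; exact Nat.succ_le_of_lt (by positivity)
      · rw [pow_succ']
        refine Nat.mul_le_mul_left _ ?_
        calc (m.nat 17 0 + 1) ^ D ≤ (N + 1) ^ D := Nat.pow_le_pow_left (by omega) _
          _ ≤ (N + 1) ^ 4 := Nat.pow_le_pow_right (by omega) (by omega)
    refine ((hc m N hQ hW hne hQN hWN hL hpow).seq (T₂ := 5 + (c' * B + 1)) ?_).mono ?_
      (fun _ h => h)
    · rintro m₁ ⟨hf, hres⟩
      refine (Reaches.cond (T := c' * B + 1) (fun h => ?_) (fun h => ?_)).mono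
        (by simp [Test.cost, NatExp.cost]) (fun _ h => h)
      · simp only [Test.Holds, NatExp.eval, Nat.le_zero] at h
        have hres' := hres.resolve_left (by omega)
        have e16 : readList m₁ 16 17 = readList m 16 17 := hf.readList (by simp) (by simp)
        have e40 : readList m₁ 40 41 = readList m 40 41 := hf.readList (by simp) (by simp)
        have e3 : m₁.real 3 = m.real 3 := (hf 3 (by simp)).2
        have e4 : m₁.real 4 = m.real 4 := (hf 4 (by simp)).2
        have e7 : m₁.nat 7 = m.nat 7 := (hf 7 (by simp)).1
        have e8 : m₁.nat 8 = m.nat 8 := (hf 8 (by simp)).1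
        have e17 : m₁.nat 17 = m.nat 17 := (hf 17 (by simp)).1
        have e41 : m₁.nat 41 = m.nat 41 := (hf 41 (by simp)).1
        have hs := hc' m₁ N (by rw [e3, e16]; exact hQ) (by rw [e3]; exact e40 ▸ hW)
          (by rw [e17]; exact hQN) (by show m₁.nat 41 0 ≤ N; rw [e41]; exact hWN)
          (by rw [e8]; exact hL) (by rw [e7, e8]; exact hpow) h
        rw [e17, e8, e3, e4, e16] at hs
        simp only [mul_zero, add_zero, e40] at hs
        refine hs.mono ((Nat.mul_le_mul_left _ hpw).trans (Nat.le_succ _)) ?_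
        rintro m₂ ⟨hf₂, -, hr⟩
        refine ⟨hf.trans hf₂, ?_⟩
        rcases hr with ⟨r1, r2, r3, r4⟩ | ⟨r1, r2⟩
        · left
          simp only [zero_add] at r2 r3 r4
          refine ⟨r1, ?_, ?_, ?_⟩
          · intro a ha
            obtain ⟨i, hi, rfl⟩ := mem_readList.1 ha
            exact r3 i (by omega)
          · intro w hw
            obtain ⟨i, hi, hiw⟩ := r4 w hw
            exact ⟨_, mem_readList.2 ⟨i, by omega, rfl⟩, hiw⟩
          · intro l' hl' hcov
            rw [length_readList, r2]
            exact hres'.2 l' hl' hcov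
        · right
          refine ⟨r1, fun l hl hcov => ?_⟩
          have h1 := hres'.2 l hl hcov
          have h2 : l.length ≠ D + 1 := fun h => r2 l h hl hcov
          omega
      · simp only [Test.Holds, NatExp.eval, Nat.le_zero] at h
        refine (reaches_of_loopFree (by trivial) ?_).mono
          (by simp [Program.maxCost]) (fun _ h => h)
        exact ⟨hf, Or.inl (hres.resolve_right fun h' => h h'.1)⟩
    · nlinarith

/-- Find a shortest list of points of the list `(16, 17)` whose disks cover the points of the list
`(40, 41)`. -/
def solveTile : Program :=
  .seq (searchUpTo 6) (.cond (.natLe (var 20) (.const 0)) (greedy 0 7) .skip)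

/-- If six disks do not suffice, every cover has at least seven, and the greedy choice ends with at
most seven because the last hypothesis forbids eight pairwise distant points. So the costlier search
for seven disks is never made. -/
theorem reaches_solveTile : ∃ c, ∀ (m : Memory) (N : ℕ),
    SortedX (m.real 3) (readList m 16 17) → SortedX (m.real 3) (readList m 40 41) →
    readList m 40 41 ≠ [] → m.nat 17 0 ≤ N → m.nat 41 0 ≤ N → N < 2 ^ m.nat 8 0 →
    (∀ i < m.nat 8 0, m.nat 7 i = 2 ^ i) → (∀ w ∈ readList m 40 41, w ∈ readList m 16 17) →
    (∀ l : List ℕ, l.length = 8 → (∀ a ∈ l, a ∈ readList m 40 41) →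
      ¬ l.Pairwise fun a b => ¬ Near (m.real 3) (m.real 4) a b) →
    Reaches solveTile m
      (c * ((m.nat 17 0 + 1) * (N + 1) ^ 4 * ((m.nat 8 0 + 1) * (N + 1)))) fun m' =>
      Frame {A | A = 18 ∨ A = 19 ∨ A = 20 ∨ 42 ≤ A} m m' ∧
      IsOptList (m.real 3) (m.real 4) (readList m 16 17) (readList m 40 41) (readList m' 18 19) := by
  obtain ⟨c, hc⟩ := reaches_searchUpTo 6 le_rfl
  obtain ⟨c', hc'⟩ := reaches_greedy 7 0 (by omega)
  refine ⟨c + c' + 10, fun m N hQ hW hne hQN hWN hL hpow hWQ hpig => ?_⟩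
  set B := (m.nat 17 0 + 1) * (N + 1) ^ 4 * ((m.nat 8 0 + 1) * (N + 1)) with hB
  have hB1 : N + 1 ≤ B := by
    rw [hB, ← mul_assoc]
    exact Nat.le_mul_of_pos_left _ (by positivity)
  refine ((hc m N hQ hW hne hQN hWN hL hpow).seq (T₂ := 5 + (c' * B + 1)) ?_).mono ?_
    (fun _ h => h)
  · rintro m₁ ⟨hf, hres⟩
    refine (Reaches.cond (T := c' * B + 1) (fun h => ?_) (fun h => ?_)).mono
      (by simp [Test.cost, NatExp.cost]) (fun _ h => h)
    · simp only [Test.Holds, NatExp.eval, Nat.le_zero] at h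
      have hres' := hres.resolve_left (by omega)
      have e40 : readList m₁ 40 41 = readList m 40 41 := hf.readList (by simp) (by simp)
      have e3 : m₁.real 3 = m.real 3 := (hf 3 (by simp)).2
      have e4 : m₁.real 4 = m.real 4 := (hf 4 (by simp)).2
      have e41 : m₁.nat 41 = m.nat 41 := (hf 41 (by simp)).1
      have hs := hc' m₁ N (by show m₁.nat 41 0 ≤ N; rw [e41]; exact hWN)
      simp only [mul_zero, add_zero, zero_add, e40, e3, e4] at hs
      refine hs.mono ((Nat.mul_le_mul_left _ hB1).trans (Nat.le_succ _)) ?_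
      rintro m₂ ⟨hf₂, -, r, hr, h19, hmem, hor⟩
      refine ⟨hf.trans (hf₂.mono (by intro A; simp; omega)), ?_, ?_, ?_⟩
      · intro a ha
        obtain ⟨i, hi, rfl⟩ := mem_readList.1 ha
        exact hWQ _ (hmem i (by omega))
      · rcases hor with hcov | ⟨l, hl, hlW, hp⟩
        · intro w hw
          obtain ⟨i, hi, hiw⟩ := hcov w hw
          exact ⟨_, mem_readList.2 ⟨i, by omega, rfl⟩, hiw⟩
        · exact absurd hp (hpig l hl hlW)
      · intro l' hl' hcov
        rw [length_readList, h19]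
        have := hres'.2 l' hl' hcov
        omega
    · simp only [Test.Holds, NatExp.eval, Nat.le_zero] at h
      refine (reaches_of_loopFree (by trivial) ?_).mono
        (by simp [Program.maxCost]) (fun _ h => h)
      exact ⟨hf, (hres.resolve_right fun h' => h h'.1).2⟩
  · nlinarith

/-! ### Solving all septa-hexagon problems -/

/-- The points `i` and `j` have been placed in the same septa-hexagon. -/
def SameTile (m : Memory) (i j : ℕ) : Prop :=
  m.real 9 i = m.real 9 j ∧ m.real 10 i = m.real 10 j ∧ m.real 11 i = m.real 11 j ∧
    m.real 12 i = m.real 12 j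

/-- Test for equality. -/
def realEq (a b : RealExp) : Test := .and (.realLe a b) (.realLe b a)

/-- Test for `SameTile`. -/
def sameTileTest (i j : NatExp) : Test :=
  .and (realEq (.get 9 i) (.get 9 j)) (.and (realEq (.get 10 i) (.get 10 j))
    (.and (realEq (.get 11 i) (.get 11 j)) (realEq (.get 12 i) (.get 12 j))))

theorem holds_sameTileTest (m : Memory) (i j : NatExp) :
    (sameTileTest i j).Holds m ↔ SameTile m (i.eval m) (j.eval m) := by
  simp only [sameTileTest, realEq, Test.Holds, RealExp.eval, SameTile, ← le_antisymm_iff]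

/-- The indices of the points in the septa-hexagon of the point `i`. -/
noncomputable def tileList (m : Memory) (n i : ℕ) : List ℕ :=
  select (fun j => SameTile m j i) (List.range n)

/-- The indices of the points whose disks meet the septa-hexagon of the point `i`. -/
noncomputable def coverList (m : Memory) (n i : ℕ) : List ℕ :=
  select (fun q => ∃ j ∈ tileList m n i, Near (m.real 3) (m.real 4) j q) (List.range n)

/-- The point `i` is the first one in its septa-hexagon. -/
def IsRep (m : Memory) (i : ℕ) : Prop := ∀ j < i, ¬ SameTile m j i

/-- Collect the points in the septa-hexagon of the point in variable `13`, and the points whose disks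
meet it. -/
def collectTile : Program :=
  .seq (filterLoop 6 0 40 41 (testFlag (sameTileTest (var 81) (var 13))))
    (filterLoop 6 0 16 17 (.seq (assign 82 (.const 0)) (forLoop 83 (var 41)
      (.cond (.realLe (.add
          (.mul (.sub (.get 3 (.get 40 (var 83))) (.get 3 (var 81)))
            (.sub (.get 3 (.get 40 (var 83))) (.get 3 (var 81))))
          (.mul (.sub (.get 4 (.get 40 (var 83))) (.get 4 (var 81)))
            (.sub (.get 4 (.get 40 (var 83))) (.get 4 (var 81))))) (.const 1))
        (assign 82 (.const 1)) .skip))))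

theorem SameTile.congr {m m' : Memory} (h9 : m'.real 9 = m.real 9) (h10 : m'.real 10 = m.real 10)
    (h11 : m'.real 11 = m.real 11) (h12 : m'.real 12 = m.real 12) (i j : ℕ) :
    SameTile m' i j ↔ SameTile m i j := by
  simp [SameTile, h9, h10, h11, h12]

theorem Frame.sameTile {N : Set ℕ} {m m' : Memory} (h : Frame N m m') (h9 : 9 ∉ N) (h10 : 10 ∉ N)
    (h11 : 11 ∉ N) (h12 : 12 ∉ N) (i j : ℕ) : SameTile m' i j ↔ SameTile m i j :=
  SameTile.congr (h 9 h9).2 (h 10 h10).2 (h 11 h11).2 (h 12 h12).2 i j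

theorem reaches_collectTile : ∃ c, ∀ (m : Memory) (n i : ℕ), m.nat 0 0 = n →
    readList m 6 0 = List.range n → m.nat 13 0 = i →
    Reaches collectTile m (c * ((n + 1) * (n + 1))) fun m' =>
      Frame {A | A = 16 ∨ A = 17 ∨ 40 ≤ A} m m' ∧ readList m' 40 41 = tileList m n i ∧
      readList m' 16 17 = coverList m n i := by
  refine ⟨1000, fun m n i h0 hid h13 => ?_⟩
  have h1 := reaches_filterTest (m := m) (src := 6) (slen := 0) (dst := 40) (dlen := 41)
    (b := sameTileTest (var 81) (var 13)) (fun j => SameTile m j i) (by omega) (by omega)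
    (by omega) (by omega) (by omega) (by omega) (by omega) (by omega) (by omega) (by
      intro m' x hf hx _
      rw [holds_sameTileTest, hf.sameTile (by simp) (by simp) (by simp) (by simp)]
      simp only [NatExp.eval, hx, (hf 13 (by simp)).1, h13])
  rw [hid, h0] at h1
  refine (h1.seq (T₂ := (n + 1) * (((n + 1) * 100 + 10) + 60)) ?_).mono ?_ (fun _ h => h)
  · rintro m₁ ⟨hf₁, hl₁⟩
    have e6 : readList m₁ 6 0 = List.range n := by rw [hf₁.readList (by simp) (by simp), hid]
    have e0 : m₁.nat 0 0 = n := by rw [(hf₁ 0 (by simp)).1, h0]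
    have e3 : m₁.real 3 = m.real 3 := (hf₁ 3 (by simp)).2
    have e4 : m₁.real 4 = m.real 4 := (hf₁ 4 (by simp)).2
    have hlen : m₁.nat 41 0 ≤ n := by
      rw [← length_readList m₁ 40 41, hl₁]
      exact (length_select_le _ _).trans (by simp)
    have h2 := reaches_filterLoop (m := m₁) (src := 6) (slen := 0) (dst := 16) (dlen := 17)
      (pre := .seq (assign 82 (.const 0)) (forLoop 83 (var 41)
      (.cond (.realLe (.add
          (.mul (.sub (.get 3 (.get 40 (var 83))) (.get 3 (var 81)))
            (.sub (.get 3 (.get 40 (var 83))) (.get 3 (var 81))))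
          (.mul (.sub (.get 4 (.get 40 (var 83))) (.get 4 (var 81)))
            (.sub (.get 4 (.get 40 (var 83))) (.get 4 (var 81))))) (.const 1))
        (assign 82 (.const 1)) .skip)))
      (fun q => ∃ j ∈ tileList m n i, Near (m.real 3) (m.real 4) j q) ((n + 1) * 100 + 10)
      (by omega) (by omega)
      (by omega) (by omega) (by omega) (by omega) (by omega) (by omega) (by omega) (by
        intro m' x hf hx _
        have g40 : m'.nat 40 = m₁.nat 40 := (hf 40 (by simp)).1
        have g41 : m'.nat 41 = m₁.nat 41 := (hf 41 (by simp)).1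
        have g3 : m'.real 3 = m.real 3 := by rw [(hf 3 (by simp)).2, e3]
        have g4 : m'.real 4 = m.real 4 := by rw [(hf 4 (by simp)).2, e4]
        have ha : Reaches (assign 82 (.const 0)) m' 3 (fun m'' => m'' = m'.writeNat 82 0 0) := by
          refine (reaches_of_loopFree (by trivial) ?_).mono
            (by simp [Program.maxCost, NatExp.cost]) (fun _ h => h)
          simp [Program.exec, NatExp.eval]
        refine (ha.seq (T₂ := (n + 1) * 100) ?_).mono (by omega) (fun _ h => h)
        rintro _ rfl
        refine (reaches_forLoop_const (m₁.nat 41 0) 70 (fun k m'' =>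
          Frame {A | 82 ≤ A ∧ A < 90} m' m'' ∧ (1 ≤ m''.nat 82 0 ↔
            ∃ j < k, Near (m.real 3) (m.real 4) (m₁.nat 40 j) x)) ?_ ?_ ?_ ?_).mono ?_ ?_
        · exact ⟨(Frame.refl _ _).writeNat (by simp) _ _, by simp [Memory.nat_writeNat]⟩
        · rintro k m'' v ⟨hf', hr⟩
          exact ⟨hf'.writeNat (by simp) _ _, by simpa [Memory.nat_writeNat] using hr⟩
        · rintro k m'' ⟨hf', -⟩
          simp only [NatExp.eval, (hf' 41 (by simp)).1, g41]
        · rintro k hk m'' ⟨hf', hr⟩ hck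
          have k3 : m''.real 3 = m.real 3 := by rw [(hf' 3 (by simp)).2, g3]
          have k4 : m''.real 4 = m.real 4 := by rw [(hf' 4 (by simp)).2, g4]
          have k40 : m''.nat 40 = m₁.nat 40 := by rw [(hf' 40 (by simp)).1, g40]
          have k81 : m''.nat 81 0 = x := by rw [(hf' 81 (by simp)).1, hx]
          refine (reaches_of_loopFree (by simp [Program.LoopFree]) ?_).mono
            (by simp [Program.maxCost, NatExp.cost, RealExp.cost, Test.cost]) (fun _ h => h)
          simp only [Program.exec, Test.Holds, RealExp.eval, NatExp.eval, k3, k4, k40, k81, hck,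
            Nat.cast_one]
          by_cases hn : Near (m.real 3) (m.real 4) (m₁.nat 40 k) x
          · have hn' := hn
            unfold Near at hn'
            rw [branch_pos hn']
            refine ⟨⟨hf'.writeNat (by simp) _ _, ?_⟩, by simp [Memory.nat_writeNat, hck]⟩
            simp only [Memory.nat_writeNat, and_self, if_true, le_refl, true_iff]
            exact ⟨k, by omega, hn⟩
          · have hn' := hn
            unfold Near at hn'
            rw [branch_neg hn']
            refine ⟨⟨hf', hr.trans ⟨?_, ?_⟩⟩, hck⟩
            · rintro ⟨j, hj, hjn⟩
              exact ⟨j, by omega, hjn⟩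
            · rintro ⟨j, hj, hjn⟩
              have : j ≠ k := by rintro rfl; exact hn hjn
              exact ⟨j, by omega, hjn⟩
        · simp only [NatExp.cost]
          nlinarith
        · rintro m'' ⟨⟨hf', hr⟩, -⟩
          refine ⟨hf', hr.trans ?_⟩
          rw [tileList, ← hl₁]
          constructor
          · rintro ⟨j, hj, hn⟩; exact ⟨_, mem_readList.2 ⟨j, hj, rfl⟩, hn⟩
          · rintro ⟨w, hw, hn⟩
            obtain ⟨j, hj, rfl⟩ := mem_readList.1 hw
            exact ⟨j, hj, hn⟩)
    rw [e6, e0] at h2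
    refine h2.mono le_rfl ?_
    rintro m₂ ⟨hf₂, hl₂⟩
    refine ⟨(hf₁.mono (by intro A; simp; omega)).trans (hf₂.mono (by intro A; simp; omega)), ?_, hl₂⟩
    rw [hf₂.readList (by simp) (by simp), hl₁]; rfl
  · simp only [sameTileTest, realEq, Test.cost, RealExp.cost, NatExp.cost]
    nlinarith

/-- Append the solution to the output. -/
def appendSolution : Program :=
  forLoop 22 (var 19) (.seq (.setNat 2 (var 1) (.get 5 (.get 18 (var 22))))
    (assign 1 (.add (var 1) (.const 1))))

/-- Lists refer to the sorted order; array `5` translates positions back to the indices of the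
input. -/
theorem reaches_appendSolution (m : Memory) :
    Reaches appendSolution m ((m.nat 19 0 + 1) * 50) fun m' =>
      Frame {A | A = 1 ∨ A = 2 ∨ A = 22} m m' ∧
      readList m' 2 1 = readList m 2 1 ++ (readList m 18 19).map (m.nat 5) := by
  refine (reaches_forLoop_const (m.nat 19 0) 20 (fun i m' =>
    Frame {A | A = 1 ∨ A = 2 ∨ A = 22} m m' ∧
      readList m' 2 1 = readList m 2 1 ++ ((List.range i).map (m.nat 18)).map (m.nat 5))
      ?_ ?_ ?_ ?_).mono ?_ ?_
  · exact ⟨Frame.refl _ _, by simp⟩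
  · rintro i m' v ⟨hf, hl⟩
    refine ⟨hf.writeNat (by simp) _ _, ?_⟩
    rw [← hl]
    exact readList_congr (by funext j; simp [Memory.nat_writeNat])
      (by funext j; simp [Memory.nat_writeNat])
  · rintro i m' ⟨hf, -⟩
    simp only [NatExp.eval, (hf 19 (by simp)).1]
  · rintro i hi m' ⟨hf, hl⟩ hci
    refine (reaches_of_loopFree (by simp [Program.LoopFree]) ?_).mono
      (by simp [Program.maxCost, NatExp.cost]) (fun _ h => h)
    have e18 : m'.nat 18 = m.nat 18 := (hf 18 (by simp)).1
    have e5 : m'.nat 5 = m.nat 5 := (hf 5 (by simp)).1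
    simp only [Program.exec, NatExp.eval, hci, e18, e5]
    refine ⟨⟨(hf.writeNat (by simp) _ _).writeNat (by simp) _ _, ?_⟩,
      by simp [Memory.nat_writeNat, hci]⟩
    rw [List.range_succ, List.map_append, List.map_append, ← List.append_assoc, ← hl]
    refine readList_push ?_ ?_ ?_
    · simp [Memory.nat_writeNat]
    · intro j hj
      simp [Memory.nat_writeNat, hj.ne]
    · simp [Memory.nat_writeNat]
  · simp [NatExp.cost]
  · rintro m' ⟨⟨hf, hl⟩, -⟩
    exact ⟨hf, hl⟩

/-- Solve the problem of the septa-hexagon of the point in variable `13`, if this is its first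
point. -/
def tileStep : Program :=
  .seq (.seq (assign 21 (.const 1))
    (forLoop 22 (var 13) (.cond (sameTileTest (var 22) (var 13)) (assign 21 (.const 0)) .skip)))
    (.cond (.natLe (.const 1) (var 21))
      (.seq collectTile (.seq solveTile appendSolution)) .skip)

theorem reaches_repCheck (m : Memory) : Reaches (.seq (assign 21 (.const 1))
    (forLoop 22 (var 13) (.cond (sameTileTest (var 22) (var 13)) (assign 21 (.const 0)) .skip))) m
    ((m.nat 13 0 + 1) * 300) fun m' => Frame {A | A = 21 ∨ A = 22} m m' ∧
      (1 ≤ m'.nat 21 0 ↔ IsRep m (m.nat 13 0)) := by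
  have ha : Reaches (assign 21 (.const 1)) m 3 (fun m'' => m'' = m.writeNat 21 0 1) := by
    refine (reaches_of_loopFree (by trivial) ?_).mono
      (by simp [Program.maxCost, NatExp.cost]) (fun _ h => h)
    simp [Program.exec, NatExp.eval]
  refine (ha.seq (T₂ := (m.nat 13 0 + 1) * 250) ?_).mono (by omega) (fun _ h => h)
  rintro _ rfl
  refine (reaches_forLoop_const (m.nat 13 0) 150 (fun i m' => Frame {A | A = 21 ∨ A = 22} m m' ∧
      (1 ≤ m'.nat 21 0 ↔ ∀ j < i, ¬ SameTile m j (m.nat 13 0))) ?_ ?_ ?_ ?_).mono ?_ ?_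
  · exact ⟨(Frame.refl _ _).writeNat (by simp) _ _, by simp [Memory.nat_writeNat]⟩
  · rintro i m' v ⟨hf, hr⟩
    exact ⟨hf.writeNat (by simp) _ _, by simpa [Memory.nat_writeNat] using hr⟩
  · rintro i m' ⟨hf, -⟩
    simp only [NatExp.eval, (hf 13 (by simp)).1]
  · rintro i hi m' ⟨hf, hr⟩ hci
    refine (reaches_of_loopFree (by simp [Program.LoopFree]) ?_).mono
      (by simp [Program.maxCost, NatExp.cost, Test.cost, sameTileTest, realEq, RealExp.cost])
      (fun _ h => h)
    simp only [Program.exec, holds_sameTileTest]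
    rw [hf.sameTile (by simp) (by simp) (by simp) (by simp)]
    simp only [NatExp.eval, hci, (hf 13 (by simp)).1]
    by_cases hs : SameTile m i (m.nat 13 0)
    · rw [branch_pos hs]
      refine ⟨⟨hf.writeNat (by simp) _ _, ?_⟩, by simp [Memory.nat_writeNat, hci]⟩
      simp only [Memory.nat_writeNat, and_self, if_true]
      exact ⟨by omega, fun h => absurd hs (h i (by omega))⟩
    · rw [branch_neg hs]
      refine ⟨⟨hf, hr.trans ⟨fun h j hj => ?_, fun h j hj => h j (by omega)⟩⟩, hci⟩
      rcases Nat.lt_succ_iff_lt_or_eq.1 hj with hj | rfl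
      · exact h j hj
      · exact hs
  · exact Nat.mul_le_mul_left _ (by simp [NatExp.cost])
  · rintro m' ⟨⟨hf, hr⟩, -⟩
    exact ⟨hf, hr⟩

theorem tileList_congr {N : Set ℕ} {m m' : Memory} (h : Frame N m m') (h9 : 9 ∉ N) (h10 : 10 ∉ N)
    (h11 : 11 ∉ N) (h12 : 12 ∉ N) (n i : ℕ) : tileList m' n i = tileList m n i :=
  select_congr fun _ _ => h.sameTile h9 h10 h11 h12 _ _

theorem coverList_congr {N : Set ℕ} {m m' : Memory} (h : Frame N m m') (h9 : 9 ∉ N) (h10 : 10 ∉ N)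
    (h11 : 11 ∉ N) (h12 : 12 ∉ N) (h3 : 3 ∉ N) (h4 : 4 ∉ N) (n i : ℕ) :
    coverList m' n i = coverList m n i := by
  unfold coverList
  rw [tileList_congr h h9 h10 h11 h12, (h 3 h3).2, (h 4 h4).2]

theorem tileList_subset_coverList (m : Memory) (n i : ℕ) :
    ∀ w ∈ tileList m n i, w ∈ coverList m n i := fun w hw =>
  mem_select.2 ⟨(mem_select.1 hw).1, w, hw, near_self _ _ _⟩

open Classical in
/-- The cost measure of `tileStep`. -/
noncomputable def tileWork (m : Memory) (n i : ℕ) : ℕ :=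
  if IsRep m i then (coverList m n i).length else 0

/-- The memory is ready for `tileStep`. -/
structure Prepared (m : Memory) (n : ℕ) : Prop where
  size : m.nat 0 0 = n
  ids : readList m 6 0 = List.range n
  sorted : SortedX (m.real 3) (List.range n)
  large : n < 2 ^ m.nat 8 0
  powers : ∀ i < m.nat 8 0, m.nat 7 i = 2 ^ i
  pigeon : ∀ i, ∀ l : List ℕ, l.length = 8 → (∀ a ∈ l, a ∈ tileList m n i) →
    ¬ l.Pairwise fun a b => ¬ Near (m.real 3) (m.real 4) a b

/-- A point that is not the first of its septa-hexagon pays only for the check, so its `tileWork` is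
`0` and each problem is solved once. -/
theorem reaches_tileStep : ∃ c, ∀ (m : Memory) (n i : ℕ), Prepared m n → m.nat 13 0 = i → i < n →
    Reaches tileStep m (c * ((n + 1) ^ 5 * (m.nat 8 0 + 1) * (tileWork m n i + 1))) fun m' =>
      Frame {A | A = 1 ∨ A = 2 ∨ 16 ≤ A} m m' ∧
      ((¬ IsRep m i ∧ readList m' 2 1 = readList m 2 1) ∨
        (IsRep m i ∧ ∃ l, IsOptList (m.real 3) (m.real 4) (coverList m n i) (tileList m n i) l ∧
          readList m' 2 1 = readList m 2 1 ++ l.map (m.nat 5))) := by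
  obtain ⟨c₁, hc₁⟩ := reaches_collectTile
  obtain ⟨c₂, hc₂⟩ := reaches_solveTile
  refine ⟨c₁ + c₂ + 1000, fun m n i hm h13 hi => ?_⟩
  set L := m.nat 8 0 with hL
  set B := (n + 1) ^ 5 * (L + 1) * (tileWork m n i + 1) with hB
  have hBn2 : (n + 1) * (n + 1) ≤ B := by
    have h1 : (n + 1) ^ 2 ≤ (n + 1) ^ 5 := Nat.pow_le_pow_right (by omega) (by omega)
    calc (n + 1) * (n + 1) = (n + 1) ^ 2 := by ring
      _ ≤ (n + 1) ^ 5 * ((L + 1) * (tileWork m n i + 1)) :=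
        h1.trans (Nat.le_mul_of_pos_right _ (by positivity))
      _ = B := by rw [hB]; ring
  have hBn : n + 1 ≤ B := (Nat.le_mul_of_pos_left _ (by omega)).trans hBn2
  have hr := reaches_repCheck m
  rw [h13] at hr
  refine (hr.seq (T₂ := (c₁ + c₂ + 600) * B) ?_).mono ?_ (fun _ h => h)
  · rintro m₁ ⟨hf₁, hrep⟩
    refine (Reaches.cond (T := (c₁ + c₂ + 500) * B) (fun h => ?_) (fun h => ?_)).mono ?_
      (fun _ h => h)
    · have hR : IsRep m i := hrep.1 h
      have ew : tileWork m n i = (coverList m n i).length := if_pos hR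
      have hcol := hc₁ m₁ n i (by rw [(hf₁ 0 (by simp)).1]; exact hm.size)
        (by rw [hf₁.readList (by simp) (by simp)]; exact hm.ids)
        (by rw [(hf₁ 13 (by simp)).1]; exact h13)
      rw [tileList_congr hf₁ (by simp) (by simp) (by simp) (by simp),
        coverList_congr hf₁ (by simp) (by simp) (by simp) (by simp) (by simp) (by simp)] at hcol
      refine (hcol.seq (T₂ := (c₂ + 500) * B) ?_).mono ?_ (fun _ h => h)
      · rintro m₂ ⟨hf₂, hW, hQ⟩
        have hf : Frame {A | A = 16 ∨ A = 17 ∨ A = 21 ∨ A = 22 ∨ 40 ≤ A} m m₂ :=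
          (hf₁.mono (by intro A; simp; omega)).trans (hf₂.mono (by intro A; simp; omega))
        have e3 : m₂.real 3 = m.real 3 := (hf 3 (by simp)).2
        have e4 : m₂.real 4 = m.real 4 := (hf 4 (by simp)).2
        have e7 : m₂.nat 7 = m.nat 7 := (hf 7 (by simp)).1
        have e8 : m₂.nat 8 = m.nat 8 := (hf 8 (by simp)).1
        have l17 : m₂.nat 17 0 = (coverList m n i).length := by rw [← hQ, length_readList]
        have l41 : m₂.nat 41 0 = (tileList m n i).length := by rw [← hW, length_readList]
        have hQn : (coverList m n i).length ≤ n := (length_select_le _ _).trans (by simp)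
        have hWn : (tileList m n i).length ≤ n := (length_select_le _ _).trans (by simp)
        have hne : tileList m n i ≠ [] := by
          refine List.ne_nil_of_mem (a := i) (mem_select.2 ⟨List.mem_range.2 hi, ?_⟩)
          exact ⟨rfl, rfl, rfl, rfl⟩
        have hsol := hc₂ m₂ n (by rw [e3, hQ]; exact hm.sorted.select _)
          (by rw [e3, hW]; exact hm.sorted.select _) (by rw [hW]; exact hne) (by omega) (by omega)
          (by rw [e8]; exact hm.large) (by rw [e7, e8]; exact hm.powers)
          (by rw [hW, hQ]; exact tileList_subset_coverList m n i)
          (by rw [hW, e3, e4]; exact hm.pigeon i)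
        rw [hQ, hW, e3, e4, l17, e8, ← ew, ← hL] at hsol
        refine (hsol.seq (T₂ := 400 * B) ?_).mono ?_ (fun _ h => h)
        · rintro m₃ ⟨hf₃, hopt⟩
          -- The points of the septa-hexagon cover themselves, so an optimum is no longer than their
          -- list.
          have hlen : m₃.nat 19 0 ≤ n := by
            rw [← length_readList m₃ 18 19]
            exact (hopt.2.2 _ (tileList_subset_coverList m n i)
              (fun w hw => ⟨w, hw, near_self _ _ _⟩)).trans hWn
          refine (reaches_appendSolution m₃).mono
            ((Nat.mul_le_mul_right 50 (Nat.succ_le_succ hlen)).trans (by omega)) ?_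
          rintro m₄ ⟨hf₄, hl⟩
          refine ⟨((hf.mono ?_).trans (hf₃.mono ?_)).trans (hf₄.mono ?_), Or.inr ⟨hR, _, hopt, ?_⟩⟩
          · intro A; simp; omega
          · intro A; simp; omega
          · intro A; simp; omega
          · rw [hl, hf₃.readList (by simp) (by simp), hf.readList (by simp) (by simp),
              (hf₃ 5 (by simp)).1, (hf 5 (by simp)).1]
        · have : (tileWork m n i + 1) * (n + 1) ^ 4 * ((L + 1) * (n + 1)) = B := by rw [hB]; ring
          rw [this]
          simp only [Nat.add_mul]
          omega
      · have := Nat.mul_le_mul_left c₁ hBn2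
        nlinarith
    · have hR : ¬ IsRep m i := fun h' => h (hrep.2 h')
      refine (reaches_of_loopFree (by trivial) ?_).mono
        (by simp only [Program.maxCost, Nat.add_mul]; omega) (fun _ h => h)
      refine ⟨hf₁.mono (by intro A; simp; omega), Or.inl ⟨hR, ?_⟩⟩
      exact hf₁.readList (by simp) (by simp)
    · simp only [Test.cost, NatExp.cost, Nat.add_mul]
      omega
  · simp only [Nat.add_mul c₁, Nat.add_mul (c₁ + c₂)]
    omega

/-- Solve all septa-hexagon problems. -/
def solveAll : Program := forLoop 13 (var 0) tileStep

/-- The cost of an iteration is kept as a function of `i`, so that the total contains the sum of the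
`tileWork` and not `n` times its maximum. -/
theorem reaches_solveAll : ∃ c, ∀ (m : Memory) (n : ℕ), Prepared m n → m.nat 1 0 = 0 →
    Reaches solveAll m
      (c * ((n + 1) ^ 5 * (m.nat 8 0 + 1) * (∑ i ∈ Finset.range n, tileWork m n i + n + 1)))
      fun m' => ∃ sol : ℕ → List ℕ,
        (∀ i < n, IsRep m i →
          IsOptList (m.real 3) (m.real 4) (coverList m n i) (tileList m n i) (sol i)) ∧
        ∀ x, x ∈ readList m' 2 1 ↔ ∃ i < n, IsRep m i ∧ ∃ a ∈ sol i, m.nat 5 a = x := by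
  obtain ⟨c, hc⟩ := reaches_tileStep
  refine ⟨c + 100, fun m n hm h1 => ?_⟩
  set B := (n + 1) ^ 5 * (m.nat 8 0 + 1) with hB
  refine (reaches_forLoop n (fun i => c * (B * (tileWork m n i + 1))) (fun i m' =>
    Frame {A | A = 1 ∨ A = 2 ∨ 13 ≤ A} m m' ∧ ∃ sol : ℕ → List ℕ,
        (∀ j < i, IsRep m j →
          IsOptList (m.real 3) (m.real 4) (coverList m n j) (tileList m n j) (sol j)) ∧
        ∀ x, x ∈ readList m' 2 1 ↔ ∃ j < i, IsRep m j ∧ ∃ a ∈ sol j, m.nat 5 a = x)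
        ?_ ?_ ?_ ?_).mono ?_ ?_
  · exact ⟨Frame.refl _ _, fun _ => [], by simp, by simp [readList, h1]⟩
  · rintro i m' v ⟨hf, sol, h1, h2⟩
    refine ⟨hf.writeNat (by simp) _ _, sol, h1, fun x => ?_⟩
    rw [← h2 x, readList_congr (m := m') (by funext j; simp [Memory.nat_writeNat])
      (by funext j; simp [Memory.nat_writeNat])]
  · rintro i m' ⟨hf, -⟩
    simp only [NatExp.eval, (hf 0 (by simp)).1, hm.size]
  · rintro i hi m' ⟨hf, sol, hs1, hs2⟩ hci
    have e3 : m'.real 3 = m.real 3 := (hf 3 (by simp)).2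
    have e4 : m'.real 4 = m.real 4 := (hf 4 (by simp)).2
    have e5 : m'.nat 5 = m.nat 5 := (hf 5 (by simp)).1
    have e8 : m'.nat 8 = m.nat 8 := (hf 8 (by simp)).1
    have eT : ∀ j, tileList m' n j = tileList m n j :=
      fun j => tileList_congr hf (by simp) (by simp) (by simp) (by simp) n j
    have eC : ∀ j, coverList m' n j = coverList m n j :=
      fun j => coverList_congr hf (by simp) (by simp) (by simp) (by simp) (by simp) (by simp) n j
    have eR : ∀ j, IsRep m' j ↔ IsRep m j := fun j => by
      have := hf.sameTile (by simp) (by simp) (by simp) (by simp)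
      simp only [IsRep, this]
    have eWk : tileWork m' n i = tileWork m n i := by
      unfold tileWork
      rw [eC]
      by_cases h : IsRep m i
      · rw [if_pos h, if_pos ((eR i).2 h)]
      · rw [if_neg h, if_neg fun h' => h ((eR i).1 h')]
    have hm' : Prepared m' n :=
      { size := by rw [(hf 0 (by simp)).1]; exact hm.size
        ids := by rw [hf.readList (by simp) (by simp)]; exact hm.ids
        sorted := by rw [e3]; exact hm.sorted
        large := by rw [e8]; exact hm.large
        powers := by rw [e8, (hf 7 (by simp)).1]; exact hm.powers
        pigeon := by simp only [e3, e4, eT]; exact hm.pigeon }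
    have hstep := hc m' n i hm' hci hi
    rw [e8, eWk, ← hB, e3, e4, e5, eT, eC, eR] at hstep
    refine hstep.mono le_rfl ?_
    rintro m'' ⟨hf', hor⟩
    refine ⟨⟨hf.trans (hf'.mono (by intro A; simp; omega)), ?_⟩, ?_⟩
    · rcases hor with ⟨hR, hl⟩ | ⟨hR, l, hopt, hl⟩
      · refine ⟨sol, fun j hj hjR => ?_, fun x => ?_⟩
        · rcases Nat.lt_succ_iff_lt_or_eq.1 hj with hj | rfl
          · exact hs1 j hj hjR
          · exact absurd hjR hR
        · rw [hl, hs2]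
          constructor
          · rintro ⟨j, hj, h⟩; exact ⟨j, by omega, h⟩
          · rintro ⟨j, hj, hjR, h⟩
            have : j ≠ i := by rintro rfl; exact hR hjR
            exact ⟨j, by omega, hjR, h⟩
      · refine ⟨Function.update sol i l, fun j hj hjR => ?_, fun x => ?_⟩
        · rcases Nat.lt_succ_iff_lt_or_eq.1 hj with hj | rfl
          · rw [Function.update_of_ne hj.ne]; exact hs1 j hj hjR
          · rw [Function.update_self]; exact hopt
        · rw [hl, List.mem_append, hs2, List.mem_map]
          constructor
          · rintro (⟨j, hj, hjR, h⟩ | h)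
            · exact ⟨j, by omega, hjR, by rwa [Function.update_of_ne hj.ne]⟩
            · exact ⟨i, by omega, hR, by rwa [Function.update_self]⟩
          · rintro ⟨j, hj, hjR, h⟩
            rcases Nat.lt_succ_iff_lt_or_eq.1 hj with hj | rfl
            · rw [Function.update_of_ne hj.ne] at h
              exact Or.inl ⟨j, hj, hjR, h⟩
            · rw [Function.update_self] at h
              exact Or.inr h
    · rw [(hf' 13 (by simp)).1, hci]
  · rw [← Finset.mul_sum, ← Finset.mul_sum, Finset.sum_add_distrib]
    simp only [Finset.sum_const, Finset.card_range, smul_eq_mul, mul_one, NatExp.cost]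
    set tot := ∑ i ∈ Finset.range n, tileWork m n i
    have hB1 : 1 ≤ B := Nat.succ_le_of_lt (by positivity)
    have h2 : n + 1 ≤ B * (tot + n + 1) := by nlinarith [Nat.zero_le (tot * B)]
    have h3 : c * (B * (tot + n)) ≤ c * (B * (tot + n + 1)) :=
      Nat.mul_le_mul_left _ (Nat.mul_le_mul_left _ (by omega))
    nlinarith
  · rintro m' ⟨⟨-, h⟩, -⟩
    exact h

/-! ### The geometry of cells and septa-hexagons -/

/-- A coordinate on the plane in which the cells are described by integers. -/
noncomputable def xi (x : Plane) : ℝ := x 0 * 4 / √3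

/-- See `xi`. -/
noncomputable def eta (x : Plane) : ℝ := x 1 * 4

/-- The closed cell centred at `0` in the coordinates `xi`, `eta`. -/
def ClosedCell (x y : ℝ) : Prop := |x| ≤ 1 ∧ |x + y| ≤ 2 ∧ |x - y| ≤ 2

/-- The open cell. -/
def OpenCell (x y : ℝ) : Prop := |x| < 1 ∧ |x + y| < 2 ∧ |x - y| < 2

/-- The half-open cell. -/
def HalfCell (x y : ℝ) : Prop := -1 ≤ x ∧ x < 1 ∧ -2 ≤ x + y ∧ x + y < 2 ∧ -2 ≤ x - y ∧ x - y < 2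

/-- The lattice coordinates of the seven cells of a septa-hexagon. -/
def IsOffset (p q : ℤ) : Prop := |p| ≤ 1 ∧ |q| ≤ 1 ∧ |p + q| ≤ 1

/-- The union of the seven cells of a septa-hexagon centred at `0`. -/
def Tile (C : ℝ → ℝ → Prop) (x y : ℝ) : Prop :=
  ∃ p q : ℤ, IsOffset p q ∧ C (x - (2 * p + q)) (y - 3 * q)

instance (p q : ℤ) : Decidable (IsOffset p q) :=
  inferInstanceAs (Decidable (|p| ≤ 1 ∧ |q| ≤ 1 ∧ |p + q| ≤ 1))

theorem OpenCell.closed {x y : ℝ} (h : OpenCell x y) : ClosedCell x y :=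
  ⟨h.1.le, h.2.1.le, h.2.2.le⟩

/-- Only the fractional parts `α`, `β` of the lattice coordinates matter. The six cases are the
pieces into which the cells around the corners cut the fundamental parallelogram; weak and strict
inequalities follow the half-open sides. -/
theorem exists_halfCell (x y : ℝ) : ∃ p q : ℤ, HalfCell (x - (2 * p + q)) (y - 3 * q) := by
  set β := Int.fract (y / 3) with hβ
  set α := Int.fract ((x - y / 3) / 2) with hα
  have hβ0 := Int.fract_nonneg (y / 3)
  have hβ1 := Int.fract_lt_one (y / 3)
  have hα0 := Int.fract_nonneg ((x - y / 3) / 2)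
  have hα1 := Int.fract_lt_one ((x - y / 3) / 2)
  have e1 : y = 3 * (⌊y / 3⌋ + β) := by rw [hβ, Int.floor_add_fract]; ring
  have e2 : x = 2 * (⌊(x - y / 3) / 2⌋ + α) + (⌊y / 3⌋ + β) := by
    rw [hβ, hα, Int.floor_add_fract, Int.floor_add_fract]; ring
  set s := ⌊y / 3⌋
  set r := ⌊(x - y / 3) / 2⌋
  have key : ∃ i j : ℤ, HalfCell (2 * (α - i) + (β - j)) (3 * (β - j)) := by
    unfold HalfCell
    rcases le_or_gt β α with h | h
    · rcases le_or_gt 2 (α + 2 * β) with h1 | h1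
      · exact ⟨1, 1, by push_cast; refine ⟨?_, ?_, ?_, ?_, ?_, ?_⟩ <;> linarith⟩
      · rcases le_or_gt 1 (2 * α + β) with h2 | h2
        · exact ⟨1, 0, by push_cast; refine ⟨?_, ?_, ?_, ?_, ?_, ?_⟩ <;> linarith⟩
        · exact ⟨0, 0, by push_cast; refine ⟨?_, ?_, ?_, ?_, ?_, ?_⟩ <;> linarith⟩
    · rcases le_or_gt 2 (2 * α + β) with h1 | h1
      · exact ⟨1, 1, by push_cast; refine ⟨?_, ?_, ?_, ?_, ?_, ?_⟩ <;> linarith⟩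
      · rcases le_or_gt 1 (α + 2 * β) with h2 | h2
        · exact ⟨0, 1, by push_cast; refine ⟨?_, ?_, ?_, ?_, ?_, ?_⟩ <;> linarith⟩
        · exact ⟨0, 0, by push_cast; refine ⟨?_, ?_, ?_, ?_, ?_, ?_⟩ <;> linarith⟩
  obtain ⟨i, j, hij⟩ := key
  refine ⟨r + i, s + j, ?_⟩
  have f1 : x - (2 * ((r + i : ℤ) : ℝ) + ((s + j : ℤ) : ℝ)) = 2 * (α - i) + (β - j) := by
    push_cast; linarith
  have f2 : y - 3 * ((s + j : ℤ) : ℝ) = 3 * (β - j) := by push_cast; linarith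
  rw [f1, f2]
  exact hij

/-- The cells `(2 * a - b, a + 3 * b)` are those with `3 * p + q` divisible by 7, and `3 * p + q`
takes each residue exactly once on the seven offsets. If `7 * k` is the value at `(p - p', q - q')`,
then `a = k` and `b = 2 * k - (p - p')`. -/
theorem exists_offset (p q : ℤ) : ∃ a b p' q' : ℤ, IsOffset p' q' ∧ p = 2 * a - b + p' ∧
    q = a + 3 * b + q' := by
  have h : ∃ p' q' : ℤ, IsOffset p' q' ∧ (7 : ℤ) ∣ 3 * (p - p') + (q - q') := by
    have h7 : (3 * p + q) % 7 = 0 ∨ (3 * p + q) % 7 = 1 ∨ (3 * p + q) % 7 = 2 ∨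
      (3 * p + q) % 7 = 3 ∨ (3 * p + q) % 7 = 4 ∨ (3 * p + q) % 7 = 5 ∨ (3 * p + q) % 7 = 6 := by
      omega
    rcases h7 with h | h | h | h | h | h | h
    · exact ⟨0, 0, by decide, by omega⟩
    · exact ⟨0, 1, by decide, by omega⟩
    · exact ⟨1, -1, by decide, by omega⟩
    · exact ⟨1, 0, by decide, by omega⟩
    · exact ⟨-1, 0, by decide, by omega⟩
    · exact ⟨-1, 1, by decide, by omega⟩
    · exact ⟨0, -1, by decide, by omega⟩
  obtain ⟨p', q', ho, k, hk⟩ := h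
  exact ⟨k, 2 * k - (p - p'), p', q', ho, by omega, by omega⟩

theorem exists_halfTile (x y : ℝ) :
    ∃ a b : ℤ, Tile HalfCell (x - (5 * a + b)) (y - (3 * a + 9 * b)) := by
  obtain ⟨p, q, h⟩ := exists_halfCell x y
  obtain ⟨a, b, p', q', ho, rfl, rfl⟩ := exists_offset p q
  refine ⟨a, b, p', q', ho, ?_⟩
  convert h using 1 <;> push_cast <;> ring

theorem HalfCell.closed {x y : ℝ} (h : HalfCell x y) : ClosedCell x y := by
  obtain ⟨h1, h2, h3, h4, h5, h6⟩ := h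
  exact ⟨abs_le.2 ⟨h1, h2.le⟩, abs_le.2 ⟨h3, h4.le⟩, abs_le.2 ⟨h5, h6.le⟩⟩

theorem Tile.mono {C C' : ℝ → ℝ → Prop} (h : ∀ x y, C x y → C' x y) {x y : ℝ} (ht : Tile C x y) :
    Tile C' x y := by
  obtain ⟨p, q, ho, hc⟩ := ht
  exact ⟨p, q, ho, h _ _ hc⟩

theorem IsOffset.cast {p q : ℤ} (h : IsOffset p q) :
    |(p : ℝ)| ≤ 1 ∧ |(q : ℝ)| ≤ 1 ∧ |(p + q : ℝ)| ≤ 1 := by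
  obtain ⟨h1, h2, h3⟩ := h
  exact ⟨by exact_mod_cast h1, by exact_mod_cast h2, by exact_mod_cast h3⟩

/-- A septa-hexagon lies in three strips. -/
theorem Tile.bound {x y : ℝ} (h : Tile ClosedCell x y) :
    |x| ≤ 3 ∧ |y| ≤ 5 ∧ |3 * x + y| ≤ 10 ∧ |3 * x - y| ≤ 10 := by
  obtain ⟨p, q, ho, h1, h2, h3⟩ := h
  obtain ⟨o1, o2, o3⟩ := ho.cast
  rw [abs_le] at h1 h2 h3 o1 o2 o3
  refine ⟨abs_le.2 ⟨?_, ?_⟩, abs_le.2 ⟨?_, ?_⟩, abs_le.2 ⟨?_, ?_⟩, abs_le.2 ⟨?_, ?_⟩⟩ <;>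
    linarith [h1.1, h1.2, h2.1, h2.2, h3.1, h3.2, o1.1, o1.2, o2.1, o2.2, o3.1, o3.2]

/-- Distinct septa-hexagons of the tiling do not overlap. -/
theorem tile_eq_of_open {x y : ℝ} {a b a' b' : ℤ}
    (h : Tile OpenCell (x - (5 * a + b)) (y - (3 * a + 9 * b)))
    (h' : Tile ClosedCell (x - (5 * a' + b')) (y - (3 * a' + 9 * b'))) : a = a' ∧ b = b' := by
  obtain ⟨p, q, ⟨o1, o2, o3⟩, h1, h2, h3⟩ := h
  obtain ⟨p', q', ⟨o1', o2', o3'⟩, h1', h2', h3'⟩ := h'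
  rw [abs_lt] at h1 h2 h3
  rw [abs_le] at h1' h2' h3' o1 o2 o3 o1' o2' o3'
  -- A point common to an open and a closed cell bounds the difference of their centres strictly in
  -- each of the three directions normal to the sides; the difference is integral in lattice
  -- coordinates.
  have c1 : (2 * (2 * a - b + p - (2 * a' - b' + p')) + (a + 3 * b + q - (a' + 3 * b' + q')) : ℤ) < 2 := by
    have : ((2 * (2 * a - b + p - (2 * a' - b' + p')) + (a + 3 * b + q - (a' + 3 * b' + q')) : ℤ) : ℝ)
      < 2 := by push_cast; linarith [h1.1, h1'.2]
    exact_mod_cast this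
  have c2 : (-2 : ℤ) < 2 * (2 * a - b + p - (2 * a' - b' + p')) +
      (a + 3 * b + q - (a' + 3 * b' + q')) := by
    have : (-2 : ℝ) < ((2 * (2 * a - b + p - (2 * a' - b' + p')) +
      (a + 3 * b + q - (a' + 3 * b' + q')) : ℤ) : ℝ) := by push_cast; linarith [h1.2, h1'.1]
    exact_mod_cast this
  have c3 : (2 * (2 * a - b + p - (2 * a' - b' + p')) +
      4 * (a + 3 * b + q - (a' + 3 * b' + q')) : ℤ) < 4 := by
    have : ((2 * (2 * a - b + p - (2 * a' - b' + p')) +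
      4 * (a + 3 * b + q - (a' + 3 * b' + q')) : ℤ) : ℝ) < 4 := by
      push_cast; linarith [h2.1, h2'.2]
    exact_mod_cast this
  have c4 : (-4 : ℤ) < 2 * (2 * a - b + p - (2 * a' - b' + p')) +
      4 * (a + 3 * b + q - (a' + 3 * b' + q')) := by
    have : (-4 : ℝ) < ((2 * (2 * a - b + p - (2 * a' - b' + p')) +
      4 * (a + 3 * b + q - (a' + 3 * b' + q')) : ℤ) : ℝ) := by
      push_cast; linarith [h2.2, h2'.1]
    exact_mod_cast this
  have c5 : (2 * (2 * a - b + p - (2 * a' - b' + p')) -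
      2 * (a + 3 * b + q - (a' + 3 * b' + q')) : ℤ) < 4 := by
    have : ((2 * (2 * a - b + p - (2 * a' - b' + p')) -
      2 * (a + 3 * b + q - (a' + 3 * b' + q')) : ℤ) : ℝ) < 4 := by
      push_cast; linarith [h3.1, h3'.2]
    exact_mod_cast this
  have c6 : (-4 : ℤ) < 2 * (2 * a - b + p - (2 * a' - b' + p')) -
      2 * (a + 3 * b + q - (a' + 3 * b' + q')) := by
    have : (-4 : ℝ) < ((2 * (2 * a - b + p - (2 * a' - b' + p')) -
      2 * (a + 3 * b + q - (a' + 3 * b' + q')) : ℤ) : ℝ) := by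
      push_cast; linarith [h3.2, h3'.1]
    exact_mod_cast this
  -- The only integral difference within the six strict bounds is zero, so the two cells coincide;
  -- as the offsets are distinct modulo the sublattice, so do the septa-hexagons.
  have d1 : 2 * a - b + p = 2 * a' - b' + p' := by omega
  have d2 : a + 3 * b + q = a' + 3 * b' + q' := by omega
  constructor <;> omega

/-! ### Translation to the coordinates `xi` and `eta`; open cells and interiors -/

theorem sqrt3_pos : 0 < √(3 : ℝ) := Real.sqrt_pos.2 (by norm_num)

theorem sqrt3_mul_self : √(3 : ℝ) * √3 = 3 := Real.mul_self_sqrt (by norm_num)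

theorem xi_eq (x : Plane) : x 0 = xi x * √3 / 4 := by
  unfold xi; field_simp [sqrt3_pos.ne']

theorem eta_eq (x : Plane) : x 1 = eta x / 4 := by
  unfold eta; ring

theorem xi_add (x y : Plane) : xi (x + y) = xi x + xi y := by simp [xi]; ring

theorem eta_add (x y : Plane) : eta (x + y) = eta x + eta y := by simp [eta]; ring

theorem xi_sub (x y : Plane) : xi (x - y) = xi x - xi y := by simp [xi]; ring

theorem eta_sub (x y : Plane) : eta (x - y) = eta x - eta y := by simp [eta]; ring

theorem xi_smul (r : ℝ) (x : Plane) : xi (r • x) = r * xi x := by simp [xi]; ring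

theorem eta_smul (r : ℝ) (x : Plane) : eta (r • x) = r * eta x := by simp [eta]; ring

theorem xi_e₁ : xi e₁ = 2 := by
  simp [xi, e₁]; field_simp [sqrt3_pos.ne']; norm_num

theorem eta_e₁ : eta e₁ = 0 := by simp [eta, e₁]

theorem xi_e₂ : xi e₂ = 1 := by
  simp [xi, e₂]

theorem eta_e₂ : eta e₂ = 3 := by simp [eta, e₂]

theorem xi_tileCentre (t : Plane) (z : ℤ × ℤ) : xi (tileCentre t z) = xi t + (5 * z.1 + z.2) := by
  simp only [tileCentre, xi_add, xi_sub, xi_smul, xi_e₁, xi_e₂]; ring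

theorem eta_tileCentre (t : Plane) (z : ℤ × ℤ) :
    eta (tileCentre t z) = eta t + (3 * z.1 + 9 * z.2) := by
  simp only [tileCentre, eta_add, eta_sub, eta_smul, eta_e₁, eta_e₂]; ring

theorem plane_ext {x y : Plane} (h1 : xi x = xi y) (h2 : eta x = eta y) : x = y := by
  ext i
  fin_cases i
  · simp [xi_eq, h1]
  · simp [eta_eq, h2]

theorem mem_cell {x c : Plane} : x ∈ cell c ↔ ClosedCell (xi x - xi c) (eta x - eta c) := by
  have h := sqrt3_pos
  have hh := sqrt3_mul_self
  have e0 : x 0 - c 0 = (xi x - xi c) * (√3 / 4) := by rw [xi_eq x, xi_eq c]; ring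
  have e1 : x 1 - c 1 = (eta x - eta c) / 4 := by rw [eta_eq x, eta_eq c]; ring
  simp only [cell, Set.mem_ofPred_eq, ClosedCell, e0, e1]
  set u := xi x - xi c
  set v := eta x - eta c
  rw [show u * (√3 / 4) / 2 + √3 / 2 * (v / 4) = (u + v) / 2 * (√3 / 4) by ring,
    show u * (√3 / 4) / 2 - √3 / 2 * (v / 4) = (u - v) / 2 * (√3 / 4) by ring]
  have hk : 0 < √3 / 4 := by positivity
  have key : ∀ w : ℝ, |w * (√3 / 4)| ≤ √3 / 4 ↔ |w| ≤ 1 := by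
    intro w
    rw [abs_mul, abs_of_pos hk]
    constructor
    · intro hw; nlinarith [abs_nonneg w]
    · intro hw; nlinarith [abs_nonneg w]
  have key2 : ∀ w : ℝ, |w / 2| ≤ 1 ↔ |w| ≤ 2 := by
    intro w
    rw [abs_div, abs_of_pos (two_pos : (0 : ℝ) < 2), div_le_iff₀ two_pos, one_mul]
  rw [key, key, key, key2, key2]

theorem mem_septaHexagon {x c : Plane} :
    x ∈ septaHexagon c ↔ Tile ClosedCell (xi x - xi c) (eta x - eta c) := by
  simp only [septaHexagon, Set.mem_union, mem_cell, xi_add, eta_add, xi_sub, eta_sub, xi_e₁, xi_e₂,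
    eta_e₁, eta_e₂]
  constructor
  · have key : ∀ (p q : ℤ) (u v : ℝ), IsOffset p q → ClosedCell u v →
        xi x - xi c - (2 * p + q) = u → eta x - eta c - 3 * q = v →
        Tile ClosedCell (xi x - xi c) (eta x - eta c) := by
      rintro p q u v ho hc rfl rfl
      exact ⟨p, q, ho, hc⟩
    rintro ((((((h | h) | h) | h) | h) | h) | h)
    · exact key 0 0 _ _ (by decide) h (by push_cast; ring) (by push_cast; ring)
    · exact key 1 0 _ _ (by decide) h (by push_cast; ring) (by push_cast; ring)
    · exact key (-1) 0 _ _ (by decide) h (by push_cast; ring) (by push_cast; ring)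
    · exact key 0 1 _ _ (by decide) h (by push_cast; ring) (by push_cast; ring)
    · exact key 0 (-1) _ _ (by decide) h (by push_cast; ring) (by push_cast; ring)
    · exact key 1 (-1) _ _ (by decide) h (by push_cast; ring) (by push_cast; ring)
    · exact key (-1) 1 _ _ (by decide) h (by push_cast; ring) (by push_cast; ring)
  · rintro ⟨p, q, ⟨h1, h2, h3⟩, hc⟩
    have key : ∀ u v : ℝ, xi x - xi c - (2 * p + q) = u → eta x - eta c - 3 * q = v →
        ClosedCell u v := by
      rintro u v rfl rfl; exact hc
    rw [abs_le] at h1 h2 h3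
    have hp : p = -1 ∨ p = 0 ∨ p = 1 := by omega
    have hq : q = -1 ∨ q = 0 ∨ q = 1 := by omega
    rcases hp with rfl | rfl | rfl <;> rcases hq with rfl | rfl | rfl
    · omega
    · iterate 4 left
      right
      exact key _ _ (by push_cast; ring) (by push_cast; ring)
    · right
      exact key _ _ (by push_cast; ring) (by push_cast; ring)
    · iterate 2 left
      right
      exact key _ _ (by push_cast; ring) (by push_cast; ring)
    · iterate 6 left
      exact key _ _ (by push_cast; ring) (by push_cast; ring)
    · iterate 3 left
      right
      exact key _ _ (by push_cast; ring) (by push_cast; ring)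
    · left
      right
      exact key _ _ (by push_cast; ring) (by push_cast; ring)
    · iterate 5 left
      right
      exact key _ _ (by push_cast; ring) (by push_cast; ring)
    · omega

theorem dist_sq_eq (x y : Plane) :
    16 * dist x y ^ 2 = 3 * (xi x - xi y) ^ 2 + (eta x - eta y) ^ 2 := by
  rw [EuclideanSpace.dist_eq, Real.sq_sqrt (by positivity), Fin.sum_univ_two, Real.dist_eq,
    Real.dist_eq, sq_abs, sq_abs, xi_eq x, xi_eq y, eta_eq x, eta_eq y]
  nlinarith [sqrt3_mul_self]

theorem continuous_xi : Continuous xi := by unfold xi; fun_prop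

theorem continuous_eta : Continuous eta := by unfold eta; fun_prop

/-- The union of the open cells of a septa-hexagon. -/
def openTile (c : Plane) : Set Plane := {x | Tile OpenCell (xi x - xi c) (eta x - eta c)}

theorem openTile_subset (c : Plane) : openTile c ⊆ septaHexagon c := fun _ hx =>
  mem_septaHexagon.2 (Tile.mono (fun _ _ => OpenCell.closed) hx)

theorem isOpen_openTile (c : Plane) : IsOpen (openTile c) := by
  have h := continuous_xi
  have h' := continuous_eta
  have : openTile c = ⋃ p : ℤ, ⋃ q : ℤ, ⋃ _ : IsOffset p q,
      {x | OpenCell (xi x - xi c - (2 * p + q)) (eta x - eta c - 3 * q)} := by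
    ext x; simp [openTile, Tile]
  rw [this]
  refine isOpen_iUnion fun p => isOpen_iUnion fun q => isOpen_iUnion fun _ => ?_
  unfold OpenCell
  refine IsOpen.and ?_ (IsOpen.and ?_ ?_) <;> exact isOpen_lt (by fun_prop) continuous_const

theorem openTile_subset_interior (c : Plane) : openTile c ⊆ interior (septaHexagon c) :=
  interior_maximal (openTile_subset c) (isOpen_openTile c)

/-- Moving a point of a closed cell slightly towards the centre `w` of that cell brings it into the
open cell. -/
theorem septaHexagon_subset_closure (c : Plane) : septaHexagon c ⊆ closure (openTile c) := by
  intro x hx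
  obtain ⟨p, q, ho, h1, h2, h3⟩ := mem_septaHexagon.1 hx
  set w : Plane := c + (p : ℝ) • e₁ + (q : ℝ) • e₂ with hw
  have hxw : xi w = xi c + (2 * p + q) := by
    simp only [hw, xi_add, xi_smul, xi_e₁, xi_e₂]; ring
  have hew : eta w = eta c + 3 * q := by
    simp only [hw, eta_add, eta_smul, eta_e₁, eta_e₂]; ring
  have hlim : Filter.Tendsto (fun s : ℝ => x + s • (w - x)) (nhdsWithin 0 (Set.Ioi 0)) (nhds x) := by
    have : Continuous fun s : ℝ => x + s • (w - x) := by fun_prop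
    have h0 := this.tendsto 0
    simp only [zero_smul, add_zero] at h0
    exact h0.mono_left nhdsWithin_le_nhds
  refine mem_closure_of_tendsto hlim ?_
  filter_upwards [Ioo_mem_nhdsGT (show (0 : ℝ) < 1 by norm_num)] with s hs
  have key : ∀ u b : ℝ, 0 < b → |u| ≤ b → |(1 - s) * u| < b := by
    intro u b hb hu
    rw [abs_mul, abs_of_pos (by linarith [hs.2])]
    nlinarith [hs.1, hs.2, abs_nonneg u]
  refine ⟨p, q, ho, ?_, ?_, ?_⟩
  · have := key _ 1 (by norm_num) h1
    rw [xi_add, xi_smul, xi_sub, hxw]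
    convert this using 2; ring
  · have := key _ 2 (by norm_num) h2
    rw [xi_add, xi_smul, xi_sub, hxw, eta_add, eta_smul, eta_sub, hew]
    convert this using 2; ring
  · have := key _ 2 (by norm_num) h3
    rw [xi_add, xi_smul, xi_sub, hxw, eta_add, eta_smul, eta_sub, hew]
    convert this using 2; ring

/-- The open cells are dense, so an open set meeting a septa-hexagon also meets its interior. This
reconciles partitions, which speak of interiors, with `pointsIn`, which uses closed septa-hexagons.
-/
theorem disjoint_septaHexagon {c c' x : Plane}
    (h : Disjoint (interior (septaHexagon c)) (interior (septaHexagon c')))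
    (hx : x ∈ interior (septaHexagon c)) : x ∉ septaHexagon c' := by
  intro hx'
  obtain ⟨y, hy, hy'⟩ := mem_closure_iff.1 (septaHexagon_subset_closure c' hx') _ isOpen_interior hx
  exact Set.disjoint_left.1 h hy (openTile_subset_interior c' hy')

/-- All three linear forms strictly increase along `e₁ + e₂`, and an interior point can be moved a
little both ways, so the weak bounds of `Tile.bound` become strict. -/
theorem interior_bound {x c : Plane} (h : x ∈ interior (septaHexagon c)) :
    |3 * (xi x - xi c) + (eta x - eta c)| < 10 ∧ |3 * (xi x - xi c) - (eta x - eta c)| < 10 ∧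
      |eta x - eta c| < 5 := by
  have hc : Continuous fun s : ℝ => x + s • (e₁ + e₂) := by fun_prop
  have hev : ∀ᶠ s in nhds (0 : ℝ), x + s • (e₁ + e₂) ∈ septaHexagon c := by
    have h0 : Filter.Tendsto (fun s : ℝ => x + s • (e₁ + e₂)) (nhds 0) (nhds x) := by
      have := hc.tendsto 0
      simpa using this
    exact h0.eventually (mem_interior_iff_mem_nhds.1 h)
  obtain ⟨ε, hε, hball⟩ := Metric.eventually_nhds_iff.1 hev
  have hp := (mem_septaHexagon.1 (hball (y := ε / 2) (by
    rw [Real.dist_eq, sub_zero, abs_of_pos] <;> linarith))).bound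
  have hm := (mem_septaHexagon.1 (hball (y := -(ε / 2)) (by
    rw [Real.dist_eq, sub_zero, abs_neg, abs_of_pos] <;> linarith))).bound
  simp only [xi_add, xi_smul, xi_e₁, xi_e₂, eta_add, eta_smul, eta_e₁, eta_e₂] at hp hm
  obtain ⟨-, p1, p2, p3⟩ := hp
  obtain ⟨-, m1, m2, m3⟩ := hm
  rw [abs_le] at p1 p2 p3 m1 m2 m3
  refine ⟨abs_lt.2 ⟨?_, ?_⟩, abs_lt.2 ⟨?_, ?_⟩, abs_lt.2 ⟨?_, ?_⟩⟩ <;>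
    linarith [p1.1, p1.2, p2.1, p2.2, p3.1, p3.2, m1.1, m1.2, m2.1, m2.2, m3.1, m3.2]

/-! ### Covering, disjointness and colours of the tiling -/

theorem iUnion_septaHexagon (t : Plane) : (⋃ z : ℤ × ℤ, septaHexagon (tileCentre t z)) = Set.univ := by
  refine Set.eq_univ_of_forall fun x => ?_
  obtain ⟨a, b, h⟩ := exists_halfTile (xi x - xi t) (eta x - eta t)
  refine Set.mem_iUnion.2 ⟨(a, b), mem_septaHexagon.2 ?_⟩
  rw [xi_tileCentre, eta_tileCentre, ← sub_sub (xi x), ← sub_sub (eta x)]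
  exact h.mono fun _ _ => HalfCell.closed

theorem nonOverlapping_tileCentre (t : Plane) : NonOverlapping (tileCentre t) := by
  intro z z' hne
  rw [Set.disjoint_left]
  intro x hx hx'
  obtain ⟨y, ⟨hy, hy'⟩, ho⟩ := mem_closure_iff.1
    (septaHexagon_subset_closure _ (interior_subset hx)) _ (isOpen_interior.inter isOpen_interior)
    ⟨hx, hx'⟩
  have h := mem_septaHexagon.1 (interior_subset hy')
  change Tile OpenCell _ _ at ho
  rw [xi_tileCentre, eta_tileCentre, ← sub_sub (xi y), ← sub_sub (eta y)] at h ho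
  obtain ⟨h1, h2⟩ := tile_eq_of_open ho h
  exact hne (Prod.ext h1 h2)

theorem even_of_tileColour_eq {z z' : ℤ × ℤ} (h : tileColour z = tileColour z') :
    Even (z.1 - z'.1) ∧ Even (z.2 - z'.2) := by
  unfold tileColour at h
  rw [Int.even_sub, Int.even_sub]
  split_ifs at h <;> simp_all [← Int.not_even_iff_odd]

/-- Centres of equal colour have index differences `2 * A`, `2 * B`. On the difference of the
centres the forms `3 * xi + eta`, `3 * xi - eta`, `eta` have the values `12 * (3 * A + 2 * B)`, `12
* (2 * A - B)`, `6 * (A + 3 * B)`. Interior points at distance at most 2 would make these less than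
10 + 10 + 16, the same, and 5 + 5 + 8 in absolute value, which forces `A = B = 0`. -/
theorem sameColourFar_tileCentre (t : Plane) : SameColourFar (tileCentre t) tileColour := by
  intro z z' hne hcol x hx y hy
  obtain ⟨⟨A, hA⟩, ⟨B, hB⟩⟩ := even_of_tileColour_eq hcol
  have hAB : A ≠ 0 ∨ B ≠ 0 := by
    by_contra hcon
    push Not at hcon
    exact hne (Prod.ext (by omega) (by omega))
  have hx' := interior_bound hx
  have hy' := interior_bound hy
  rw [xi_tileCentre, eta_tileCentre] at hx' hy'
  have hA' : (z.1 : ℝ) = z'.1 + 2 * A := by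
    have : z.1 = z'.1 + 2 * A := by omega
    rw [this]; push_cast; ring
  have hB' : (z.2 : ℝ) = z'.2 + 2 * B := by
    have : z.2 = z'.2 + 2 * B := by omega
    rw [this]; push_cast; ring
  rw [hA', hB'] at hx'
  have hd := dist_sq_eq x y
  by_contra hcon
  push Not at hcon
  have hd0 := dist_nonneg (x := x) (y := y)
  have hd4 : dist x y ^ 2 ≤ 4 := by nlinarith
  obtain ⟨x1, x2, x3⟩ := hx'
  obtain ⟨y1, y2, y3⟩ := hy'
  rw [abs_lt] at x1 x2 x3 y1 y2 y3
  set u := xi x - xi y with hu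
  set v := eta x - eta y with hv
  -- By the Cauchy–Schwarz inequality `(3 * u + v) ^ 2 ≤ 4 * (3 * u ^ 2 + v ^ 2)`, and the last
  -- factor is at most `16 * 4`.
  have g1 : |3 * u + v| ≤ 16 := abs_le_of_sq_le_sq (by nlinarith [sq_nonneg (u - v)]) (by norm_num)
  have g2 : |3 * u - v| ≤ 16 := abs_le_of_sq_le_sq (by nlinarith [sq_nonneg (u + v)]) (by norm_num)
  have g3 : |v| ≤ 8 := abs_le_of_sq_le_sq (by nlinarith [sq_nonneg u]) (by norm_num)
  rw [abs_le] at g1 g2 g3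
  have k1 : 3 * A + 2 * B < 3 := by
    have : (3 * A + 2 * B : ℝ) < 3 := by linarith
    exact_mod_cast this
  have k2 : -3 < 3 * A + 2 * B := by
    have : (-3 : ℝ) < 3 * A + 2 * B := by linarith
    exact_mod_cast this
  have k3 : 2 * A - B < 3 := by
    have : (2 * A - B : ℝ) < 3 := by linarith
    exact_mod_cast this
  have k4 : -3 < 2 * A - B := by
    have : (-3 : ℝ) < 2 * A - B := by linarith
    exact_mod_cast this
  have k5 : A + 3 * B < 3 := by
    have : (A + 3 * B : ℝ) < 3 := by linarith
    exact_mod_cast this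
  have k6 : -3 < A + 3 * B := by
    have : (-3 : ℝ) < A + 3 * B := by linarith
    exact_mod_cast this
  omega

/-! ### Positions of the tiling with no point on a boundary -/

theorem not_openCell {x y : ℝ} (h : ClosedCell x y) (h' : ¬ OpenCell x y) :
    x = 1 ∨ x = -1 ∨ x + y = 2 ∨ x + y = -2 ∨ x - y = 2 ∨ x - y = -2 := by
  by_contra hcon
  push Not at hcon
  obtain ⟨n1, n2, n3, n4, n5, n6⟩ := hcon
  obtain ⟨h1, h2, h3⟩ := h
  rw [abs_le] at h1 h2 h3
  exact h' ⟨abs_lt.2 ⟨lt_of_le_of_ne h1.1 n2.symm, lt_of_le_of_ne h1.2 n1⟩,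
    abs_lt.2 ⟨lt_of_le_of_ne h2.1 n4.symm, lt_of_le_of_ne h2.2 n3⟩,
    abs_lt.2 ⟨lt_of_le_of_ne h3.1 n6.symm, lt_of_le_of_ne h3.2 n5⟩⟩

theorem isClosed_septaHexagon (c : Plane) : IsClosed (septaHexagon c) := by
  have hc : ∀ d, IsClosed (cell d) := by
    intro d
    unfold cell
    simp only [Set.ofPred_and]
    refine IsClosed.inter ?_ (IsClosed.inter ?_ ?_) <;>
      exact isClosed_le (by fun_prop) continuous_const
  unfold septaHexagon
  exact ((((((hc _).union (hc _)).union (hc _)).union (hc _)).union (hc _)).union (hc _)).union (hc _)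

/-- A boundary point is in one of the closed cells but not in its open cell, hence on the line of a
side, and these lines have integral equations. -/
theorem frontier_integer {x c : Plane} (h : x ∈ frontier (septaHexagon c)) :
    ∃ k : ℤ, xi x - xi c = k ∨ (xi x + eta x) - (xi c + eta c) = k ∨
      (xi x - eta x) - (xi c - eta c) = k := by
  obtain ⟨p, q, ho, hcell⟩ := mem_septaHexagon.1 ((isClosed_septaHexagon c).frontier_subset h)
  have hno : ¬ OpenCell (xi x - xi c - (2 * p + q)) (eta x - eta c - 3 * q) := fun hcon =>
    h.2 (openTile_subset_interior c ⟨p, q, ho, hcon⟩)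
  rcases not_openCell hcell hno with h | h | h | h | h | h
  · exact ⟨2 * p + q + 1, Or.inl (by push_cast; linarith)⟩
  · exact ⟨2 * p + q - 1, Or.inl (by push_cast; linarith)⟩
  · exact ⟨2 * p + 4 * q + 2, Or.inr (Or.inl (by push_cast; linarith))⟩
  · exact ⟨2 * p + 4 * q - 2, Or.inr (Or.inl (by push_cast; linarith))⟩
  · exact ⟨2 * p - 2 * q + 2, Or.inr (Or.inr (by push_cast; linarith))⟩
  · exact ⟨2 * p - 2 * q - 2, Or.inr (Or.inr (by push_cast; linarith))⟩

/-- A shift by `r • e₁` changes `xi`, `xi + eta` and `xi - eta` all by `2 * r`, so one real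
parameter suffices and each point excludes countably many values of it. -/
theorem exists_generic (S : Finset Plane) :
    ∃ t : Plane, ∀ s ∈ S, ∀ z, s ∉ frontier (septaHexagon (tileCentre t z)) := by
  let bad : Set ℝ := ⋃ s ∈ S, ⋃ k : ℤ,
    {(xi s - k) / 2, (xi s + eta s - k) / 2, (xi s - eta s - k) / 2}
  have hbad : bad.Countable := S.countable_toSet.biUnion fun s _ =>
    Set.countable_iUnion fun k => Set.Finite.countable (by simp)
  obtain ⟨r, hr⟩ := (hbad.dense_compl ℝ).nonempty
  refine ⟨r • e₁, fun s hs z hz => hr ?_⟩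
  obtain ⟨k, hk⟩ := frontier_integer hz
  simp only [xi_tileCentre, eta_tileCentre, xi_smul, eta_smul, xi_e₁, eta_e₁] at hk
  simp only [bad, Set.mem_iUnion]
  refine ⟨s, hs, ?_⟩
  rcases hk with h | h | h
  · refine ⟨k + (5 * z.1 + z.2), Or.inl ?_⟩
    push_cast; linarith
  · refine ⟨k + (5 * z.1 + z.2) + (3 * z.1 + 9 * z.2), Or.inr (Or.inl ?_)⟩
    push_cast; linarith
  · refine ⟨k + (5 * z.1 + z.2) - (3 * z.1 + 9 * z.2), Or.inr (Or.inr ?_)⟩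
    simp only [Set.mem_singleton_iff]
    push_cast; linarith

theorem isColouredSeptaPartition_tileCentre {S : Finset Plane} {t : Plane}
    (h : ∀ s ∈ S, ∀ z, s ∉ frontier (septaHexagon (tileCentre t z))) :
    IsColouredSeptaPartition S (tileCentre t) tileColour := by
  refine ⟨nonOverlapping_tileCentre t, fun s hs => ?_, sameColourFar_tileCentre t⟩
  have hs' : s ∈ ⋃ z : ℤ × ℤ, septaHexagon (tileCentre t z) := by
    rw [iUnion_septaHexagon]; trivial
  obtain ⟨z, hz⟩ := Set.mem_iUnion.1 hs'
  refine ⟨z, ?_⟩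
  by_contra hcon
  exact h s hs z ⟨subset_closure hz, hcon⟩

/-! ### Optimum solutions and the approximation factor -/

/-- A cell has diameter 1. For the differences `u`, `v` one has `|u| ≤ 2` and `|u| + |v| ≤ 4`, so `3
* u ^ 2 + v ^ 2 ≤ 16 - 4 * |u| * (2 - |u|)`. -/
theorem closedCell_near {x y x' y' : ℝ} (h : ClosedCell x y) (h' : ClosedCell x' y') :
    3 * (x - x') ^ 2 + (y - y') ^ 2 ≤ 16 := by
  obtain ⟨h1, h2, h3⟩ := h
  obtain ⟨h1', h2', h3'⟩ := h'
  rw [abs_le] at h1 h2 h3 h1' h2' h3'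
  have a1 : |x - x'| ≤ 2 := abs_le.2 ⟨by linarith, by linarith⟩
  have a2 : |(x - x') + (y - y')| ≤ 4 := abs_le.2 ⟨by linarith, by linarith⟩
  have a3 : |(x - x') - (y - y')| ≤ 4 := abs_le.2 ⟨by linarith, by linarith⟩
  set u := x - x'
  set v := y - y'
  have hab : |u| + |v| ≤ 4 := by
    rw [abs_le] at a2 a3
    rcases abs_cases u with ⟨e, _⟩ | ⟨e, _⟩ <;> rcases abs_cases v with ⟨e', _⟩ | ⟨e', _⟩ <;>
      rw [e, e'] <;> linarith
  rw [← sq_abs u, ← sq_abs v]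
  have := abs_nonneg u
  have := abs_nonneg v
  nlinarith

/-- The lattice coordinates of the cells of a septa-hexagon. -/
noncomputable def offsets : Finset (ℤ × ℤ) := (Finset.Icc (-1) 1 ×ˢ Finset.Icc (-1) 1).filter fun z => |z.1 + z.2| ≤ 1

theorem mem_offsets {z : ℤ × ℤ} : z ∈ offsets ↔ IsOffset z.1 z.2 := by
  simp only [offsets, Finset.mem_filter, Finset.mem_product, Finset.mem_Icc, IsOffset, abs_le]
  tauto

theorem card_offsets : offsets.card = 7 := by
  have : offsets = {(0, 0), (1, 0), (-1, 0), (0, 1), (0, -1), (1, -1), (-1, 1)} := by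
    ext ⟨p, q⟩
    simp only [mem_offsets, IsOffset, abs_le, Finset.mem_insert, Finset.mem_singleton, Prod.mk.injEq]
    omega
  rw [this]
  decide

theorem mem_coverers {U V : Finset Plane} {q : Plane} :
    q ∈ coverers U V ↔ q ∈ V ∧ ∃ p ∈ U, dist p q ≤ 1 := by
  simp [coverers]

theorem mem_pointsIn {S : Finset Plane} {c s : Plane} :
    s ∈ pointsIn S c ↔ s ∈ S ∧ s ∈ septaHexagon c := by
  simp [pointsIn]

theorem mem_combine {S : Finset Plane} {ι : Type} {L : ι → Finset Plane} {s : Plane} :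
    s ∈ combine S L ↔ s ∈ S ∧ ∃ i, s ∈ L i := by
  simp [combine]

open Classical in
-- One point from each occupied cell covers all points of that cell.
theorem exists_cover_seven (S : Finset Plane) (c : Plane) : ∃ D, IsSeptaCover S c D ∧ D.card ≤ 7 := by
  have h : ∀ s ∈ pointsIn S c, ∃ z ∈ offsets, ClosedCell (xi s - xi c - (2 * z.1 + z.2))
      (eta s - eta c - 3 * z.2) := by
    intro s hs
    obtain ⟨p, q, ho, hcell⟩ := mem_septaHexagon.1 (mem_pointsIn.1 hs).2
    exact ⟨(p, q), mem_offsets.2 ho, hcell⟩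
  choose! f hf hcell using h
  obtain ⟨D, hD, hinj, himg⟩ := Finset.exists_subset_injOn_image_eq_of_surjOn
    (pointsIn S c : Set Plane) ((pointsIn S c).image f) (f := f) (by
      intro z hz; simpa using hz)
  refine ⟨D, ⟨fun d hd => ?_, fun s hs => ?_⟩, ?_⟩
  · have := hD hd
    exact mem_coverers.2 ⟨(mem_pointsIn.1 this).1, d, this, by simp⟩
  · have : f s ∈ D.image f := by rw [himg]; exact Finset.mem_image_of_mem f hs
    obtain ⟨d, hd, hds⟩ := Finset.mem_image.1 this
    refine ⟨d, hd, ?_⟩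
    have h1 := hcell s hs
    have h2 := hcell d (hD hd)
    rw [hds] at h2
    have h3 := closedCell_near h1 h2
    have h4 := dist_sq_eq s d
    rw [Metric.mem_closedBall]
    have h5 : dist s d ^ 2 ≤ 1 ^ 2 := by
      nlinarith [h3, h4]
    exact abs_le_of_sq_le_sq' h5 (by norm_num) |>.2
  · rw [← Finset.card_image_of_injOn hinj, himg, ← card_offsets]
    refine Finset.card_le_card fun z hz => ?_
    obtain ⟨s, hs, rfl⟩ := Finset.mem_image.1 hz
    exact hf s hs

open Classical in
theorem exists_septaOptimum (S : Finset Plane) (c : Plane) : ∃ D, IsSeptaOptimum S c D := by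
  obtain ⟨D₀, h₀, -⟩ := exists_cover_seven S c
  have hne : ((coverers (pointsIn S c) S).powerset.filter (IsSeptaCover S c)).Nonempty :=
    ⟨D₀, by simpa using ⟨h₀.1, h₀⟩⟩
  obtain ⟨D, hD, hmin⟩ := Finset.exists_min_image _ Finset.card hne
  refine ⟨D, (Finset.mem_filter.1 hD).2, fun D' hD' => hmin D' ?_⟩
  simpa using ⟨hD'.1, hD'⟩

theorem IsSeptaOptimum.card_le {S : Finset Plane} {c : Plane} {D : Finset Plane}
    (h : IsSeptaOptimum S c D) : D.card ≤ 7 := by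
  obtain ⟨D₀, h₀, h7⟩ := exists_cover_seven S c
  exact (h.2 D₀ h₀).trans h7

open Classical in
-- Double counting: the size of the union is at most the number of pairs of an element of `O` and an
-- occupied septa-hexagon that it reaches, and each element of `O` occurs in at most one pair per
-- colour.
theorem isApproxMDS_combine {S : Finset Plane} {ι : Type} {centre : ι → Plane} {colour : ι → Fin 4}
    (h : IsColouredSeptaPartition S centre colour) {L : ι → Finset Plane}
    (hL : ∀ i, IsSeptaOptimum S (centre i) (L i)) : IsApproxMDS 4 S (combine S L) := by
  obtain ⟨hno, hin, hfar⟩ := h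
  rcases S.eq_empty_or_nonempty with rfl | ⟨s₀, hs₀⟩
  · have hempty : combine ∅ L = ∅ := by ext; simp [mem_combine]
    rw [hempty]
    exact ⟨⟨subset_rfl, by simp [Covers]⟩, by simp⟩
  have : Nonempty ι := ⟨(hin s₀ hs₀).choose⟩
  choose! τ hτ using hin
  have huniq : ∀ s ∈ S, ∀ i, s ∈ septaHexagon (centre i) → τ s = i := by
    intro s hs i hi
    by_contra hne
    exact disjoint_septaHexagon (hno _ _ hne) (hτ s hs) hi
  refine ⟨⟨fun s hs => (mem_combine.1 hs).1, fun s hs => ?_⟩, fun O hO => ?_⟩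
  · obtain ⟨d, hd, hsd⟩ := (hL (τ s)).1.2 s (mem_pointsIn.2 ⟨hs, interior_subset (hτ s hs)⟩)
    exact ⟨d, mem_combine.2 ⟨(mem_coverers.1 ((hL (τ s)).1.1 hd)).1, _, hd⟩, hsd⟩
  -- A septa-hexagon without points of `S` has an empty optimum, so the sum may be restricted to the
  -- finitely many occupied ones although `ι` may be infinite.
  · have hsub : combine S L ⊆ (S.image τ).biUnion L := by
      intro x hx
      obtain ⟨-, i, hi⟩ := mem_combine.1 hx
      obtain ⟨-, p, hp, -⟩ := mem_coverers.1 ((hL i).1.1 hi)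
      obtain ⟨hpS, hp⟩ := mem_pointsIn.1 hp
      exact Finset.mem_biUnion.2 ⟨i, Finset.mem_image.2 ⟨p, hpS, huniq p hpS i hp⟩, hi⟩
    -- The part of `O` that reaches a septa-hexagon is a feasible solution there.
    have hopt : ∀ i, (L i).card ≤ (coverers (pointsIn S (centre i)) O).card := by
      intro i
      refine (hL i).2 _ ⟨fun q hq => ?_, fun s hs => ?_⟩
      · obtain ⟨hq, hp⟩ := mem_coverers.1 hq
        exact mem_coverers.2 ⟨hO.1 hq, hp⟩
      · obtain ⟨d, hd, hsd⟩ := hO.2 s (mem_pointsIn.1 hs).1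
        exact ⟨d, mem_coverers.2 ⟨hd, s, hs, hsd⟩, hsd⟩
    calc (combine S L).card ≤ ((S.image τ).biUnion L).card := Finset.card_le_card hsub
      _ ≤ ∑ i ∈ S.image τ, (L i).card := Finset.card_biUnion_le
      _ ≤ ∑ i ∈ S.image τ, (coverers (pointsIn S (centre i)) O).card :=
        Finset.sum_le_sum fun i _ => hopt i
      _ = ∑ i ∈ S.image τ, ∑ q ∈ O, if ∃ p ∈ pointsIn S (centre i), p ∈ Metric.closedBall q 1
            then 1 else 0 := by
        refine Finset.sum_congr rfl fun i _ => ?_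
        rw [coverers, Finset.card_filter]
      _ = ∑ q ∈ O, ∑ i ∈ S.image τ, if ∃ p ∈ pointsIn S (centre i), p ∈ Metric.closedBall q 1
            then 1 else 0 := Finset.sum_comm
      _ ≤ ∑ q ∈ O, 4 := by
        refine Finset.sum_le_sum fun q _ => ?_
        rw [← Finset.card_filter]
        -- The colour is injective on the septa-hexagons reached by `q`: two points in its disk are
        -- at distance at most 2.
        refine (Finset.card_le_card_of_injOn (t := Finset.univ) colour (by simp) ?_).trans (by simp)
        intro i hi j hj hij
        by_contra hne
        obtain ⟨p, hp, hpq⟩ := (Finset.mem_filter.1 hi).2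
        obtain ⟨p', hp', hpq'⟩ := (Finset.mem_filter.1 hj).2
        obtain ⟨hpS, hp⟩ := mem_pointsIn.1 hp
        obtain ⟨hpS', hp'⟩ := mem_pointsIn.1 hp'
        have h1 := hτ p hpS
        have h2 := hτ p' hpS'
        rw [huniq p hpS i hp] at h1
        rw [huniq p' hpS' j hp'] at h2
        have h3 := hfar i j hne hij p h1 p' h2
        have h4 := dist_triangle_right p p' q
        rw [Metric.mem_closedBall] at hpq hpq'
        linarith
      _ = 4 * O.card := by rw [Finset.sum_const, smul_eq_mul, mul_comm]

/-! ### Preparing the input -/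

/-- The lexicographic order of the points with first coordinates `x`, ties broken by the index. -/
def Before (x : ℕ → ℝ) (j i : ℕ) : Prop := x j ≤ x i ∧ ¬ (x i ≤ x j ∧ i ≤ j)

theorem Before.trans {x : ℕ → ℝ} {i j k : ℕ} (h : Before x i j) (h' : Before x j k) :
    Before x i k := by
  obtain ⟨h1, h2⟩ := h
  obtain ⟨h3, h4⟩ := h'
  refine ⟨h1.trans h3, fun ⟨h5, h6⟩ => ?_⟩
  have h7 : ¬ j ≤ i := fun h => h2 ⟨h3.trans h5, h⟩
  have h8 : ¬ k ≤ j := fun h => h4 ⟨h5.trans h1, h⟩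
  omega

theorem not_before_self (x : ℕ → ℝ) (i : ℕ) : ¬ Before x i i := fun h => h.2 ⟨le_rfl, le_rfl⟩

theorem before_total {x : ℕ → ℝ} {i j : ℕ} (h : i ≠ j) : Before x i j ∨ Before x j i := by
  unfold Before
  rcases lt_trichotomy (x i) (x j) with h1 | h1 | h1
  · exact Or.inl ⟨h1.le, fun h => absurd h.1 h1.not_ge⟩
  · rcases Nat.lt_or_gt_of_ne h with h2 | h2
    · exact Or.inl ⟨h1.le, fun h => by omega⟩
    · exact Or.inr ⟨h1.ge, fun h => by omega⟩
  · exact Or.inr ⟨h1.le, fun h => absurd h.1 h1.not_ge⟩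

open Classical in
/-- The number of indices below `n` before `i`. -/
noncomputable def rank (x : ℕ → ℝ) (n i : ℕ) : ℕ := ((Finset.range n).filter fun j => Before x j i).card

theorem rank_zero (x : ℕ → ℝ) (i : ℕ) : rank x 0 i = 0 := by simp [rank]

theorem rank_succ_pos {x : ℕ → ℝ} {n i : ℕ} (h : Before x n i) : rank x (n + 1) i = rank x n i + 1 := by
  classical
  rw [rank, Finset.range_add_one, Finset.filter_insert, if_pos h, Finset.card_insert_of_notMem (by simp),
    rank]

theorem rank_succ_neg {x : ℕ → ℝ} {n i : ℕ} (h : ¬ Before x n i) : rank x (n + 1) i = rank x n i := by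
  classical
  rw [rank, Finset.range_add_one, Finset.filter_insert, if_neg h, rank]

theorem rank_lt_rank {x : ℕ → ℝ} {n i j : ℕ} (hi : i < n) (h : Before x i j) :
    rank x n i < rank x n j := by
  classical
  refine Finset.card_lt_card ⟨fun k hk => ?_, fun hsub => ?_⟩
  · obtain ⟨hk, hki⟩ := Finset.mem_filter.1 hk
    exact Finset.mem_filter.2 ⟨hk, hki.trans h⟩
  · have := hsub (Finset.mem_filter.2 ⟨Finset.mem_range.2 hi, h⟩)
    exact not_before_self x i (Finset.mem_filter.1 this).2

theorem rank_lt {x : ℕ → ℝ} {n i : ℕ} (hi : i < n) : rank x n i < n := by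
  classical
  have : rank x n i < (Finset.range n).card := by
    refine Finset.card_lt_card ⟨Finset.filter_subset _ _, fun hsub => ?_⟩
    exact not_before_self x i (Finset.mem_filter.1 (hsub (Finset.mem_range.2 hi))).2
  simpa using this

theorem rank_inj {x : ℕ → ℝ} {n i j : ℕ} (hi : i < n) (hj : j < n) (h : rank x n i = rank x n j) :
    i = j := by
  by_contra hne
  rcases before_total (x := x) hne with h1 | h1
  · exact absurd h (rank_lt_rank hi h1).ne
  · exact absurd h (rank_lt_rank hj h1).ne'

theorem exists_rank_eq {x : ℕ → ℝ} {n k : ℕ} (hk : k < n) : ∃ i < n, rank x n i = k := by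
  have h := Finset.surj_on_of_inj_on_of_card_le (s := Finset.range n) (t := Finset.range n)
    (fun i _ => rank x n i) (fun i hi => Finset.mem_range.2 (rank_lt (Finset.mem_range.1 hi)))
    (fun i j hi hj hij => rank_inj (Finset.mem_range.1 hi) (Finset.mem_range.1 hj) hij) le_rfl k
    (Finset.mem_range.2 hk)
  obtain ⟨i, hi, h⟩ := h
  exact ⟨i, Finset.mem_range.1 hi, h.symm⟩

/-- The points `(X k, Y k)` are the points `(x i, y i)` sorted by the first coordinate, `idx` being
the permutation. -/
structure IsSorted (n : ℕ) (x y X Y : ℕ → ℝ) (idx : ℕ → ℕ) : Prop where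
  lt : ∀ k < n, idx k < n
  inj : ∀ k < n, ∀ l < n, idx k = idx l → k = l
  surj : ∀ i < n, ∃ k < n, idx k = i
  fst : ∀ k < n, X k = x (idx k)
  snd : ∀ k < n, Y k = y (idx k)
  mono : ∀ k l, k < l → l < n → X k ≤ X l

theorem isSorted_of_rank {n : ℕ} {x y X Y : ℕ → ℝ} {idx : ℕ → ℕ}
    (h : ∀ i < n, idx (rank x n i) = i ∧ X (rank x n i) = x i ∧ Y (rank x n i) = y i) :
    IsSorted n x y X Y idx where
  lt k hk := by
    obtain ⟨i, hi, rfl⟩ := exists_rank_eq (x := x) hk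
    rwa [(h i hi).1]
  inj k hk l hl hkl := by
    obtain ⟨i, hi, rfl⟩ := exists_rank_eq (x := x) hk
    obtain ⟨j, hj, rfl⟩ := exists_rank_eq (x := x) hl
    rw [(h i hi).1, (h j hj).1] at hkl
    rw [hkl]
  surj i hi := ⟨_, rank_lt hi, (h i hi).1⟩
  fst k hk := by
    obtain ⟨i, hi, rfl⟩ := exists_rank_eq (x := x) hk
    rw [(h i hi).1, (h i hi).2.1]
  snd k hk := by
    obtain ⟨i, hi, rfl⟩ := exists_rank_eq (x := x) hk
    rw [(h i hi).1, (h i hi).2.2]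
  mono k l hkl hl := by
    obtain ⟨i, hi, rfl⟩ := exists_rank_eq (x := x) (hkl.trans hl)
    obtain ⟨j, hj, rfl⟩ := exists_rank_eq (x := x) hl
    rw [(h i hi).2.1, (h j hj).2.1]
    by_contra hcon
    have := rank_lt_rank (n := n) hj
      (show Before x j i from ⟨(not_le.1 hcon).le, fun h' => hcon h'.1⟩)
    omega

/-- The temporary variables used below, and the arrays in `s`. -/
def scratch (s : Set ℕ) : Set ℕ := {A | A ∈ s ∨ (21 ≤ A ∧ A < 40)}

/-- Sort the points by the first coordinate. -/
def sortPoints : Program :=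
  forLoop 21 (var 0) (.seq (assign 23 (.const 0)) (.seq
    (forLoop 22 (var 0) (.cond
      (.and (.realLe (.get 0 (var 22)) (.get 0 (var 21)))
        (.not (.and (.realLe (.get 0 (var 21)) (.get 0 (var 22))) (.natLe (var 21) (var 22)))))
      (assign 23 (.add (var 23) (.const 1))) .skip))
    (.seq (.setNat 5 (var 23) (var 21))
      (.seq (.setReal 3 (var 23) (.get 0 (var 21))) (.setReal 4 (var 23) (.get 1 (var 21)))))))

theorem reaches_computeRank (m : Memory) (n : ℕ) (h0 : m.nat 0 0 = n) :
    Reaches (forLoop 22 (var 0) (.cond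
      (.and (.realLe (.get 0 (var 22)) (.get 0 (var 21)))
        (.not (.and (.realLe (.get 0 (var 21)) (.get 0 (var 22))) (.natLe (var 21) (var 22)))))
      (assign 23 (.add (var 23) (.const 1))) .skip)) (m.writeNat 23 0 0) ((n + 1) * 100) fun m' =>
      Frame {A | A = 22 ∨ A = 23} m m' ∧ m'.nat 23 0 = rank (m.real 0) n (m.nat 21 0) := by
  refine (reaches_forLoop_const n 70 (fun k m' => Frame {A | A = 22 ∨ A = 23} m m' ∧
    m'.nat 23 0 = rank (m.real 0) k (m.nat 21 0)) ?_ ?_ ?_ ?_).mono ?_ ?_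
  · exact ⟨(Frame.refl _ _).writeNat (by simp) _ _, by simp [Memory.nat_writeNat, rank_zero]⟩
  · rintro k m' v ⟨hf, hr⟩
    exact ⟨hf.writeNat (by simp) _ _, by simpa [Memory.nat_writeNat] using hr⟩
  · rintro k m' ⟨hf, -⟩
    simp only [NatExp.eval, (hf 0 (by simp)).1, h0]
  · rintro k hk m' ⟨hf, hr⟩ hck
    have e0 : m'.real 0 = m.real 0 := (hf 0 (by simp)).2
    have e21 : m'.nat 21 = m.nat 21 := (hf 21 (by simp)).1
    refine (reaches_of_loopFree (by simp [Program.LoopFree]) ?_).mono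
      (by simp [Program.maxCost, NatExp.cost, RealExp.cost, Test.cost]) (fun _ h => h)
    simp only [Program.exec, Test.Holds, RealExp.eval, NatExp.eval, e0, e21, hck]
    by_cases h : Before (m.real 0) k (m.nat 21 0)
    · have h' := h
      unfold Before at h'
      rw [branch_pos h', rank_succ_pos h]
      exact ⟨⟨hf.writeNat (by simp) _ _, by simp [Memory.nat_writeNat, hr]⟩,
        by simp [Memory.nat_writeNat, hck]⟩
    · have h' := h
      unfold Before at h'
      rw [branch_neg h', rank_succ_neg h]
      exact ⟨⟨hf, hr⟩, hck⟩
  · simp only [NatExp.cost]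
    nlinarith
  · rintro m' ⟨h, -⟩
    exact h

/-- Each point is written directly to the position given by its rank; the quadratic time is well
within the budget. -/
theorem reaches_sortPoints (m : Memory) (n : ℕ) (h0 : m.nat 0 0 = n) :
    Reaches sortPoints m (1000 * (n + 1) ^ 2) fun m' =>
      Frame (scratch {3, 4, 5}) m m' ∧
        IsSorted n (m.real 0) (m.real 1) (m'.real 3) (m'.real 4) (m'.nat 5) := by
  refine (reaches_forLoop_const n ((n + 1) * 100 + 100) (fun k m' =>
    Frame (scratch {3, 4, 5}) m m' ∧ ∀ i < k, m'.nat 5 (rank (m.real 0) n i) = i ∧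
      m'.real 3 (rank (m.real 0) n i) = m.real 0 i ∧ m'.real 4 (rank (m.real 0) n i) = m.real 1 i)
      ?_ ?_ ?_ ?_).mono ?_ ?_
  · exact ⟨Frame.refl _ _, by simp⟩
  · rintro k m' v ⟨hf, hr⟩
    exact ⟨hf.writeNat (by simp [scratch]) _ _, by simpa [Memory.nat_writeNat] using hr⟩
  · rintro k m' ⟨hf, -⟩
    simp only [NatExp.eval, (hf 0 (by simp [scratch])).1, h0]
  · rintro k hk m' ⟨hf, hr⟩ hck
    have ha : Reaches (assign 23 (.const 0)) m' 3 (fun m'' => m'' = m'.writeNat 23 0 0) := by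
      refine (reaches_of_loopFree (by trivial) ?_).mono
        (by simp [Program.maxCost, NatExp.cost]) (fun _ h => h)
      simp [Program.exec, NatExp.eval]
    refine (ha.seq (T₂ := (n + 1) * 100 + 50) ?_).mono (by omega) (fun _ h => h)
    rintro _ rfl
    refine ((reaches_computeRank m' n (by rw [(hf 0 (by simp [scratch])).1, h0])).seq ?_).mono
      le_rfl (fun _ h => h)
    rintro m₁ ⟨hf₁, h23⟩
    have e0 : m₁.real 0 = m.real 0 := by rw [(hf₁ 0 (by simp)).2, (hf 0 (by simp [scratch])).2]
    have e1 : m₁.real 1 = m.real 1 := by rw [(hf₁ 1 (by simp)).2, (hf 1 (by simp [scratch])).2]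
    have e21 : m₁.nat 21 0 = k := by rw [(hf₁ 21 (by simp)).1, hck]
    have e3 : m₁.real 3 = m'.real 3 := (hf₁ 3 (by simp)).2
    have e4 : m₁.real 4 = m'.real 4 := (hf₁ 4 (by simp)).2
    have e5 : m₁.nat 5 = m'.nat 5 := (hf₁ 5 (by simp)).1
    rw [(hf 0 (by simp [scratch])).2, hck] at h23
    refine (reaches_of_loopFree (by simp [Program.LoopFree]) ?_).mono
      (by simp [Program.maxCost, NatExp.cost, RealExp.cost, Test.cost]) (fun _ h => h)
    simp only [Program.exec, RealExp.eval, NatExp.eval]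
    refine ⟨⟨?_, ?_⟩, ?_⟩
    · refine Frame.writeReal (Frame.writeReal (Frame.writeNat (hf.trans (hf₁.mono ?_)) ?_ _ _) ?_ _ _)
        ?_ _ _
      · intro A; simp [scratch]; omega
      all_goals simp [scratch]
    · intro i hi
      simp only [Memory.real_writeReal, Memory.nat_writeNat, Memory.nat_writeReal,
        Memory.real_writeNat, h23, e21, e0, e1, e3, e4, e5]
      by_cases hik : i = k
      · subst hik; simp [h23, e21]
      · have hne : rank (m.real 0) n i ≠ rank (m.real 0) n k := fun h =>
          hik (rank_inj (by omega) hk h)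
        have := hr i (by omega)
        simp [hne, h23, this]
    · simp [Memory.nat_writeNat, e21]
  · simp only [NatExp.cost]
    nlinarith
  · rintro m' ⟨⟨hf, hr⟩, -⟩
    exact ⟨hf, isSorted_of_rank hr⟩

/-- Fill array `6` with the indices. -/
def fillIds : Program := forLoop 21 (var 0) (.setNat 6 (var 21) (var 21))

theorem reaches_fillIds (m : Memory) (n : ℕ) (h0 : m.nat 0 0 = n) :
    Reaches fillIds m (100 * (n + 1)) fun m' =>
      Frame (scratch {6}) m m' ∧ readList m' 6 0 = List.range n := by
  refine (reaches_forLoop_const n 20 (fun k m' =>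
    Frame (scratch {6}) m m' ∧ ∀ i < k, m'.nat 6 i = i) ?_ ?_ ?_ ?_).mono ?_ ?_
  · exact ⟨Frame.refl _ _, by simp⟩
  · rintro k m' v ⟨hf, hr⟩
    exact ⟨hf.writeNat (by simp [scratch]) _ _, by simpa [Memory.nat_writeNat] using hr⟩
  · rintro k m' ⟨hf, -⟩
    simp only [NatExp.eval, (hf 0 (by simp [scratch])).1, h0]
  · rintro k hk m' ⟨hf, hr⟩ hck
    refine (reaches_of_loopFree (by simp [Program.LoopFree]) ?_).mono
      (by simp [Program.maxCost, NatExp.cost]) (fun _ h => h)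
    simp only [Program.exec, NatExp.eval, hck]
    refine ⟨⟨hf.writeNat (by simp [scratch]) _ _, fun i hi => ?_⟩,
      by simp [Memory.nat_writeNat, hck]⟩
    by_cases hik : i = k
    · subst hik; simp [Memory.nat_writeNat]
    · simp [Memory.nat_writeNat, hik, hr i (by omega)]
  · simp only [NatExp.cost]
    omega
  · rintro m' ⟨⟨hf, hr⟩, -⟩
    refine ⟨hf, ?_⟩
    simp only [readList, (hf 0 (by simp [scratch])).1, h0]
    conv_rhs => rw [← List.map_id (List.range n)]
    exact List.map_congr_left fun i hi => hr i (List.mem_range.1 hi)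

/-- Fill array `7` with the powers of two up to the first one above the number of points. -/
def fillPowers : Program :=
  .seq (.seq (assign 8 (.const 0)) (.setNat 7 (.const 0) (.const 1)))
    (.loop (.natLe (.get 7 (var 8)) (var 0))
      (.seq (.setNat 7 (.add (var 8) (.const 1)) (.add (.get 7 (var 8)) (.get 7 (var 8))))
        (assign 8 (.add (var 8) (.const 1)))))

/-- `Nat.size n` is the least exponent whose power of two exceeds `n`, so the strides are large
enough for every list of indices. -/
theorem reaches_fillPowers (m : Memory) (n : ℕ) (h0 : m.nat 0 0 = n) :
    Reaches fillPowers m (100 * (n + 1)) fun m' =>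
      Frame {A | A = 7 ∨ A = 8} m m' ∧ m'.nat 8 0 = Nat.size n ∧
        ∀ i < Nat.size n, m'.nat 7 i = 2 ^ i := by
  have hsize : Nat.size n ≤ n := Nat.size_le.2 Nat.lt_two_pow_self
  have h1 : Reaches (.seq (assign 8 (.const 0)) (.setNat 7 (.const 0) (.const 1))) m 6
      fun m' => Frame {A | A = 7 ∨ A = 8} m m' ∧ m'.nat 8 0 = 0 ∧
        ∀ i ≤ 0, m'.nat 7 i = 2 ^ i := by
    refine (reaches_of_loopFree (by simp [Program.LoopFree]) ?_).mono
      (by simp [Program.maxCost, NatExp.cost]) (fun _ h => h)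
    refine ⟨((Frame.refl _ _).writeNat (by simp) _ _).writeNat (by simp) _ _, ?_, ?_⟩
    · simp [Program.exec, Memory.nat_writeNat, NatExp.eval]
    · intro i hi
      obtain rfl : i = 0 := by omega
      simp [Program.exec, Memory.nat_writeNat, NatExp.eval]
  refine (h1.seq fun m₁ hm₁ => Reaches.loop (fun k m' => Frame {A | A = 7 ∨ A = 8} m m' ∧
    m'.nat 8 0 = k ∧ ∀ i ≤ k, m'.nat 7 i = 2 ^ i) (fun _ => 40) (Nat.size n) ?_ ?_ hm₁).mono ?_ ?_
  · rintro k hk m' ⟨hf, h8, h7⟩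
    refine ⟨?_, ?_⟩
    · simp only [Test.Holds, NatExp.eval, h8, h7 k le_rfl, (hf 0 (by simp)).1, h0]
      exact Nat.lt_size.1 hk
    · refine (reaches_of_loopFree (by simp [Program.LoopFree]) ?_).mono
        (by simp [Program.maxCost, NatExp.cost]) (fun _ h => h)
      simp only [Program.exec, NatExp.eval, h8, h7 k le_rfl]
      refine ⟨(hf.writeNat (by simp) _ _).writeNat (by simp) _ _, ?_, fun i hi => ?_⟩
      · simp [Memory.nat_writeNat, h8]
      · by_cases hik : i = k + 1
        · subst hik; simp [Memory.nat_writeNat, h8, pow_succ, mul_two]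
        · simp [Memory.nat_writeNat, h8, hik, h7 i (by omega)]
  · rintro m' ⟨hf, h8, h7⟩
    simp only [Test.Holds, NatExp.eval, h8, h7 _ le_rfl, (hf 0 (by simp)).1, h0, not_le]
    exact Nat.lt_size_self n
  · simp [Test.cost, NatExp.cost]
    omega
  · rintro m' ⟨hf, h8, h7⟩
    exact ⟨hf, h8, fun i hi => h7 i hi.le⟩

/-! ### Roots: splitting each coordinate at its large gaps -/

/-- There is a gap of length more than `8` below `b`. -/
def Bottom (f : ℕ → ℝ) (n : ℕ) (b : ℝ) : Prop := ∀ k < n, f k < b → f k + 8 < b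

/-- `v` is the largest value of `f` not above `f i` with a gap below it. -/
structure IsRoot (f : ℕ → ℝ) (n i : ℕ) (v : ℝ) : Prop where
  le : v ≤ f i
  bottom : Bottom f n v
  max : ∀ k < n, Bottom f n (f k) → f k ≤ f i → f k ≤ v
  mem : ∃ k < n, f k = v
  near : f i ≤ v + 8 * n

/-- If `w` is not above `f i`, maximality of `v` applies. Otherwise the gap below `w` gives `f i + 8
< w ≤ f j`, contrary to `h`. -/
theorem IsRoot.le_of_near {f : ℕ → ℝ} {n i j : ℕ} {v w : ℝ} (hi : i < n)
    (hv : IsRoot f n i v) (hw : IsRoot f n j w) (h : f j ≤ f i + 8) : w ≤ v := by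
  obtain ⟨k, hk, rfl⟩ := hw.mem
  rcases le_or_gt (f k) (f i) with h1 | h1
  · exact hv.max k hk hw.bottom h1
  · have := hw.bottom i hi h1
    linarith [hw.le]

theorem IsRoot.eq_of_near {f : ℕ → ℝ} {n i j : ℕ} {v w : ℝ} (hi : i < n) (hj : j < n)
    (hv : IsRoot f n i v) (hw : IsRoot f n j w) (h : |f i - f j| ≤ 8) : v = w := by
  rw [abs_le] at h
  exact le_antisymm (hw.le_of_near hj hv (by linarith)) (hv.le_of_near hi hw (by linarith))

open Classical in
/-- The number of values of `f` below `c`. -/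
noncomputable def countBelow (f : ℕ → ℝ) (n : ℕ) (c : ℝ) : ℕ := ((Finset.range n).filter fun j => f j < c).card

theorem countBelow_lt {f : ℕ → ℝ} {n k : ℕ} {c : ℝ} (hk : k < n) (h : f k < c) :
    countBelow f n (f k) < countBelow f n c := by
  classical
  refine Finset.card_lt_card ⟨fun j hj => ?_, fun hsub => ?_⟩
  · obtain ⟨h1, h2⟩ := Finset.mem_filter.1 hj
    exact Finset.mem_filter.2 ⟨h1, h2.trans h⟩
  · have := hsub (Finset.mem_filter.2 ⟨Finset.mem_range.2 hk, h⟩)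
    exact lt_irrefl _ (Finset.mem_filter.1 this).2

theorem countBelow_le (f : ℕ → ℝ) (n : ℕ) (c : ℝ) : countBelow f n c ≤ n := by
  classical
  exact (Finset.card_filter_le _ _).trans (by simp)

/-- A state of the search for the root. -/
structure Descends (f : ℕ → ℝ) (n i : ℕ) (c : ℝ) : Prop where
  le : c ≤ f i
  max : ∀ k < n, Bottom f n (f k) → f k ≤ f i → f k ≤ c
  mem : ∃ k < n, f k = c
  near : f i + 8 * countBelow f n c ≤ c + 8 * n

/-- The value `f k` lies close below `c`, so no value above `f k` and up to `c` has a gap below it,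
and no root is jumped over. A move of length at most 8 is paid for by the drop of `countBelow`. -/
theorem Descends.step {f : ℕ → ℝ} {n i k : ℕ} {c : ℝ} (h : Descends f n i c) (hk : k < n)
    (h1 : f k < c) (h2 : c ≤ f k + 8) : Descends f n i (f k) where
  le := h1.le.trans h.le
  max l hl hb hle := by
    rcases lt_or_ge (f k) (f l) with h3 | h3
    · have := hb k hk h3
      linarith [h.max l hl hb hle]
    · exact h3
  mem := ⟨k, hk, rfl⟩
  near := by
    have h3 : ((countBelow f n (f k) + 1 : ℕ) : ℝ) ≤ countBelow f n c := by
      exact_mod_cast countBelow_lt hk h1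
    push_cast at h3
    linarith [h.near]

theorem descends_self {f : ℕ → ℝ} {n i : ℕ} (hi : i < n) : Descends f n i (f i) where
  le := le_rfl
  max _ _ _ h := h
  mem := ⟨i, hi, rfl⟩
  near := by
    have : (countBelow f n (f i) : ℝ) ≤ n := by exact_mod_cast countBelow_le f n (f i)
    linarith

theorem Descends.isRoot {f : ℕ → ℝ} {n i : ℕ} {c : ℝ} (h : Descends f n i c) (hb : Bottom f n c) :
    IsRoot f n i c where
  le := h.le
  bottom := hb
  max := h.max
  mem := h.mem
  near := by
    have : (0 : ℝ) ≤ countBelow f n c := by positivity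
    linarith [h.near]

theorem bottom_of_countBelow {f : ℕ → ℝ} {n : ℕ} {c : ℝ} (h : countBelow f n c = 0) :
    Bottom f n c := by
  classical
  intro k hk hlt
  have := Finset.card_eq_zero.1 h
  exact absurd (Finset.mem_filter.2 ⟨Finset.mem_range.2 hk, hlt⟩) (by rw [this]; simp)

/-- Move the number in variable `30` down to the values of array `A` close below it. -/
def descend (A : ℕ) : Program :=
  forLoop 23 (var 0) (.cond
    (.and (.not (.realLe (.get 30 (.const 0)) (.get A (var 23))))
      (.realLe (.get 30 (.const 0)) (.add (.get A (var 23)) (.const 8))))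
    (.setReal 30 (.const 0) (.get A (var 23))) .skip)

/-- A pass that changes nothing has seen no value within 8 below the number, so the number has a gap
below it; any change lowers `countBelow`. -/
theorem reaches_descend (A : ℕ) (hA : A < 21) (m : Memory) (n i : ℕ) (h0 : m.nat 0 0 = n)
    (hd : Descends (m.real A) n i (m.real 30 0)) :
    Reaches (descend A) m ((n + 1) * 100) fun m' =>
      Frame {A | A = 23 ∨ A = 30} m m' ∧ Descends (m.real A) n i (m'.real 30 0) ∧
      (m'.real 30 0 = m.real 30 0 ∧ Bottom (m.real A) n (m.real 30 0) ∨
        countBelow (m.real A) n (m'.real 30 0) < countBelow (m.real A) n (m.real 30 0)) := by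
  set c₀ := m.real 30 0 with hc₀
  refine (reaches_forLoop_const n 70 (fun k m' => Frame {A | A = 23 ∨ A = 30} m m' ∧
    Descends (m.real A) n i (m'.real 30 0) ∧
      (m'.real 30 0 = c₀ ∧ (∀ j < k, m.real A j < c₀ → m.real A j + 8 < c₀) ∨
        countBelow (m.real A) n (m'.real 30 0) < countBelow (m.real A) n c₀)) ?_ ?_ ?_ ?_).mono ?_ ?_
  · exact ⟨Frame.refl _ _, hd, Or.inl ⟨hc₀.symm, by simp⟩⟩
  · rintro k m' v ⟨hf, hr⟩
    exact ⟨hf.writeNat (by simp) _ _, by simpa using hr⟩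
  · rintro k m' ⟨hf, -⟩
    simp only [NatExp.eval, (hf 0 (by simp)).1, h0]
  · rintro k hk m' ⟨hf, hr, hor⟩ hck
    have eA : m'.real A = m.real A := (hf A (by simp; omega)).2
    refine (reaches_of_loopFree (by simp [Program.LoopFree]) ?_).mono
      (by simp [Program.maxCost, NatExp.cost, RealExp.cost, Test.cost]) (fun _ h => h)
    simp only [Program.exec, Test.Holds, RealExp.eval, NatExp.eval, eA, hck, Nat.cast_ofNat]
    by_cases h : ¬ m'.real 30 0 ≤ m.real A k ∧ m'.real 30 0 ≤ m.real A k + 8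
    · rw [branch_pos h]
      have h1 := not_le.1 h.1
      refine ⟨⟨hf.writeReal (by simp) _ _, ?_, ?_⟩, by simp [hck]⟩
      · simpa [Memory.real_writeReal] using hr.step hk h1 h.2
      · refine Or.inr ?_
        simp only [Memory.real_writeReal, and_self, if_true]
        have h2 := countBelow_lt (f := m.real A) hk h1
        rcases hor with ⟨h3, -⟩ | h3
        · rwa [h3] at h2
        · exact h2.trans h3
    · rw [branch_neg h]
      refine ⟨⟨hf, hr, ?_⟩, hck⟩
      rcases hor with ⟨h3, h4⟩ | h3
      · refine Or.inl ⟨h3, fun j hj hlt => ?_⟩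
        rcases Nat.lt_succ_iff_lt_or_eq.1 hj with hj | rfl
        · exact h4 j hj hlt
        · by_contra hcon
          exact h ⟨by rw [h3]; exact not_le.2 hlt, by rw [h3]; linarith⟩
      · exact Or.inr h3
  · simp only [NatExp.cost]
    nlinarith
  · rintro m' ⟨h, -⟩
    exact h

/-- Compute the roots of the values in array `A` into array `B`. -/
def findRoots (A B : ℕ) : Program :=
  forLoop 21 (var 0) (.seq (.setReal 30 (.const 0) (.get A (var 21)))
    (.seq (forLoop 22 (var 0) (descend A)) (.setReal B (var 21) (.get 30 (.const 0)))))

/-- The count of values below starts at no more than `n` and drops in every pass until a gap is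
reached, so `n` passes suffice. -/
theorem reaches_findRoot (A : ℕ) (hA : A < 21) (m : Memory) (n i : ℕ) (h0 : m.nat 0 0 = n)
    (hd : Descends (m.real A) n i (m.real 30 0)) :
    Reaches (forLoop 22 (var 0) (descend A)) m (200 * (n + 1) ^ 2) fun m' =>
      Frame {A | A = 22 ∨ A = 23 ∨ A = 30} m m' ∧ IsRoot (m.real A) n i (m'.real 30 0) := by
  refine (reaches_forLoop_const n ((n + 1) * 100) (fun k m' =>
    Frame {A | A = 22 ∨ A = 23 ∨ A = 30} m m' ∧ Descends (m.real A) n i (m'.real 30 0) ∧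
      (Bottom (m.real A) n (m'.real 30 0) ∨ countBelow (m.real A) n (m'.real 30 0) + k ≤ n))
      ?_ ?_ ?_ ?_).mono ?_ ?_
  · exact ⟨Frame.refl _ _, hd, Or.inr (countBelow_le _ _ _)⟩
  · rintro k m' v ⟨hf, hr⟩
    exact ⟨hf.writeNat (by simp) _ _, by simpa using hr⟩
  · rintro k m' ⟨hf, -⟩
    simp only [NatExp.eval, (hf 0 (by simp)).1, h0]
  · rintro k hk m' ⟨hf, hr, hor⟩ hck
    have eA : m'.real A = m.real A := (hf A (by simp; omega)).2
    refine (reaches_descend A hA m' n i (by rw [(hf 0 (by simp)).1, h0]) (by rwa [eA])).mono le_rfl ?_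
    rintro m'' ⟨hf', hr', hor'⟩
    rw [eA] at hr' hor'
    refine ⟨⟨hf.trans (hf'.mono (by intro A; simp; omega)), hr', ?_⟩, ?_⟩
    · rcases hor' with ⟨h1, h2⟩ | h1
      · rw [h1]; exact Or.inl h2
      · rcases hor with h2 | h2
        -- A number with a gap below it cannot move further: maximality keeps the later number at or
        -- above it, so `countBelow` cannot have dropped.
        · obtain ⟨j, hj, hjc⟩ := hr.mem
          have h3 := hr.le
          rw [← hjc] at h2 h3
          have h4 := hr'.max j hj h2 h3
          obtain ⟨l, hl, hlc⟩ := hr'.mem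
          have h5 : countBelow (m.real A) n (m'.real 30 0) ≤ countBelow (m.real A) n (m''.real 30 0) := by
            rcases h4.eq_or_lt with h6 | h6
            · rw [← hjc, h6]
            · rw [← hjc]; exact (countBelow_lt hj h6).le
          omega
        · exact Or.inr (by omega)
    · rw [(hf' 22 (by simp)).1, hck]
  · simp only [NatExp.cost]
    nlinarith
  · rintro m' ⟨⟨hf, hr, hor⟩, -⟩
    refine ⟨hf, hr.isRoot ?_⟩
    rcases hor with h | h
    · exact h
    · exact bottom_of_countBelow (by omega)

theorem reaches_findRoots (A B : ℕ) (hA : A < 21) (hB : B < 21) (hA0 : A ≠ B) (hB0 : B ≠ 0)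
    (m : Memory) (n : ℕ) (h0 : m.nat 0 0 = n) :
    Reaches (findRoots A B) m (1000 * (n + 1) ^ 3) fun m' =>
      Frame (scratch {B}) m m' ∧ ∀ i < n, IsRoot (m.real A) n i (m'.real B i) := by
  refine (reaches_forLoop_const n (200 * (n + 1) ^ 2 + 50) (fun k m' =>
    Frame (scratch {B}) m m' ∧ ∀ i < k, IsRoot (m.real A) n i (m'.real B i)) ?_ ?_ ?_ ?_).mono ?_ ?_
  · exact ⟨Frame.refl _ _, by simp⟩
  · rintro k m' v ⟨hf, hr⟩
    exact ⟨hf.writeNat (by simp [scratch]) _ _, by simpa using hr⟩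
  · rintro k m' ⟨hf, -⟩
    simp only [NatExp.eval, (hf 0 (by simp [scratch]; omega)).1, h0]
  · rintro k hk m' ⟨hf, hr⟩ hck
    have eA : m'.real A = m.real A := (hf A (by simp [scratch]; omega)).2
    have ha : Reaches (.setReal 30 (.const 0) (.get A (var 21))) m' 6
        (fun m'' => m'' = m'.writeReal 30 0 (m.real A k)) := by
      refine (reaches_of_loopFree (by trivial) ?_).mono
        (by simp [Program.maxCost, NatExp.cost, RealExp.cost]) (fun _ h => h)
      simp [Program.exec, NatExp.eval, RealExp.eval, hck, eA]
    refine (ha.seq (T₂ := 200 * (n + 1) ^ 2 + 10) ?_).mono (by omega) (fun _ h => h)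
    rintro _ rfl
    have fA : (m'.writeReal 30 0 (m.real A k)).real A = m.real A := by
      rw [← eA]; funext j
      rw [Memory.real_writeReal, if_neg (by omega)]
    have hroot := reaches_findRoot A hA (m'.writeReal 30 0 (m.real A k)) n k
      (by simp [(hf 0 (by simp [scratch]; omega)).1, h0])
      (by rw [fA]; simpa [Memory.real_writeReal] using descends_self hk)
    rw [fA] at hroot
    refine (hroot.seq (T₂ := 10) ?_).mono le_rfl (fun _ h => h)
    rintro m₁ ⟨hf₁, hr₁⟩
    have hf₂ : Frame {A | A = 22 ∨ A = 23 ∨ A = 30} m' m₁ :=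
      ((Frame.refl _ _).writeReal (by simp) _ _).trans hf₁
    have e21 : m₁.nat 21 0 = k := by rw [(hf₂ 21 (by simp)).1, hck]
    have eB : m₁.real B = m'.real B := (hf₂ B (by simp; omega)).2
    refine (reaches_of_loopFree (by trivial) ?_).mono
      (by simp [Program.maxCost, NatExp.cost, RealExp.cost]) (fun _ h => h)
    simp only [Program.exec, NatExp.eval, RealExp.eval, e21]
    refine ⟨⟨(hf.trans (hf₂.mono ?_)).writeReal (by simp [scratch]) _ _, fun i hi => ?_⟩, by simpa using e21⟩
    · intro A; simp [scratch]; omega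
    · by_cases hik : i = k
      · subst hik
        simpa [Memory.real_writeReal] using hr₁
      · simpa [Memory.real_writeReal, hik, eB] using hr i (by omega)
  · simp only [NatExp.cost]
    nlinarith [Nat.zero_le (n ^ 2), Nat.zero_le (n ^ 3)]
  · rintro m' ⟨h, -⟩
    exact h

/-! ### Finding the septa-hexagon of a point without rounding -/

/-- One of the tests holds. -/
def Test.any : List Test → Test
  | [] => .not (.natLe (.const 0) (.const 0))
  | t :: l => .not (.and (.not t) (.not (Test.any l)))

theorem Test.holds_any (m : Memory) (l : List Test) : (Test.any l).Holds m ↔ ∃ t ∈ l, t.Holds m := by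
  induction l with
  | nil => simp [Test.any, Test.Holds]
  | cons t l ih =>
    simp only [Test.any, Test.Holds, ih, List.mem_cons, exists_eq_or_imp, not_and_or, not_not]

/-- Test for membership of a half-open cell. -/
def halfCellTest (x y : RealExp) : Test :=
  .and (.and (.realLe (.const 0) (.add x (.const 1))) (.not (.realLe (.const 1) x)))
    (.and (.and (.realLe (.const 0) (.add (.add x y) (.const 2))) (.not (.realLe (.const 2) (.add x y))))
      (.and (.realLe y (.add x (.const 2))) (.not (.realLe (.add y (.const 2)) x))))

theorem holds_halfCellTest (m : Memory) (x y : RealExp) :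
    (halfCellTest x y).Holds m ↔ HalfCell (x.eval m) (y.eval m) := by
  simp only [halfCellTest, Test.Holds, RealExp.eval, HalfCell, not_le, Nat.cast_zero, Nat.cast_one,
    Nat.cast_ofNat]
  constructor
  · rintro ⟨⟨h1, h2⟩, ⟨h3, h4⟩, h5, h6⟩
    exact ⟨by linarith, h2, by linarith, h4, by linarith, by linarith⟩
  · rintro ⟨h1, h2, h3, h4, h5, h6⟩
    exact ⟨⟨by linarith, h2⟩, ⟨by linarith, h4⟩, by linarith, by linarith⟩

/-- Test for membership of a half-open septa-hexagon. -/
def halfTileTest (x y : RealExp) : Test :=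
  .any [halfCellTest x y, halfCellTest (.sub x (.const 2)) y, halfCellTest (.add x (.const 2)) y,
    halfCellTest (.sub x (.const 1)) (.sub y (.const 3)),
    halfCellTest (.add x (.const 1)) (.add y (.const 3)),
    halfCellTest (.sub x (.const 1)) (.add y (.const 3)),
    halfCellTest (.add x (.const 1)) (.sub y (.const 3))]

theorem holds_halfTileTest (m : Memory) (x y : RealExp) :
    (halfTileTest x y).Holds m ↔ Tile HalfCell (x.eval m) (y.eval m) := by
  simp only [halfTileTest, Test.holds_any, List.mem_cons, List.not_mem_nil, or_false,
    exists_eq_or_imp, exists_eq_left, holds_halfCellTest, RealExp.eval, Nat.cast_one,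
    Nat.cast_ofNat]
  generalize x.eval m = u
  generalize y.eval m = v
  constructor
  · have key : ∀ (p q : ℤ) (u' v' : ℝ), IsOffset p q → HalfCell u' v' →
        u - (2 * p + q) = u' → v - 3 * q = v' → Tile HalfCell u v := by
      rintro p q u v ho hc rfl rfl
      exact ⟨p, q, ho, hc⟩
    rintro (h | h | h | h | h | h | h)
    · exact key 0 0 _ _ (by decide) h (by push_cast; ring) (by push_cast; ring)
    · exact key 1 0 _ _ (by decide) h (by push_cast; ring) (by push_cast; ring)
    · exact key (-1) 0 _ _ (by decide) h (by push_cast; ring) (by push_cast; ring)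
    · exact key 0 1 _ _ (by decide) h (by push_cast; ring) (by push_cast; ring)
    · exact key 0 (-1) _ _ (by decide) h (by push_cast; ring) (by push_cast; ring)
    · exact key 1 (-1) _ _ (by decide) h (by push_cast; ring) (by push_cast; ring)
    · exact key (-1) 1 _ _ (by decide) h (by push_cast; ring) (by push_cast; ring)
  · rintro ⟨p, q, ⟨h1, h2, h3⟩, hc⟩
    have key : ∀ u' v' : ℝ, u - (2 * p + q) = u' → v - 3 * q = v' → HalfCell u' v' := by
      rintro u v rfl rfl; exact hc
    rw [abs_le] at h1 h2 h3
    have hp : p = -1 ∨ p = 0 ∨ p = 1 := by omega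
    have hq : q = -1 ∨ q = 0 ∨ q = 1 := by omega
    rcases hp with rfl | rfl | rfl <;> rcases hq with rfl | rfl | rfl
    · omega
    · iterate 2 right
      left
      exact key _ _ (by push_cast; ring) (by push_cast; ring)
    · iterate 6 right
      exact key _ _ (by push_cast; ring) (by push_cast; ring)
    · iterate 4 right
      left
      exact key _ _ (by push_cast; ring) (by push_cast; ring)
    · left
      exact key _ _ (by push_cast; ring) (by push_cast; ring)
    · iterate 3 right
      left
      exact key _ _ (by push_cast; ring) (by push_cast; ring)
    · iterate 5 right
      left
      exact key _ _ (by push_cast; ring) (by push_cast; ring)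
    · right
      left
      exact key _ _ (by push_cast; ring) (by push_cast; ring)
    · omega

/-- The index map has determinant 42: `42 * a = 9 * (5 * a + b) - (3 * a + 9 * b)` and `42 * b = 5 *
(3 * a + 9 * b) - 3 * (5 * a + b)`. As `5 * a + b` and `3 * a + 9 * b` are within 3 and 5 of `u` and
`v`, both indices have absolute value at most `16 * n`, with room to spare; `0 < n` absorbs the
constants. -/
theorem exists_halfTile_bounded {u v : ℝ} {n : ℕ} (hn : 0 < n) (hu0 : 0 ≤ u) (hu : u ≤ 20 * n)
    (hv0 : 0 ≤ v) (hv : v ≤ 32 * n) : ∃ k < 32 * n + 1, ∃ l < 32 * n + 1,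
      Tile HalfCell (u - (5 * (-(16 * n) + k) + (-(16 * n) + l)))
        (v - (3 * (-(16 * n) + k) + 9 * (-(16 * n) + l))) := by
  obtain ⟨a, b, h⟩ := exists_halfTile u v
  obtain ⟨h1, h2, -⟩ := (h.mono fun _ _ => HalfCell.closed).bound
  rw [abs_le] at h1 h2
  have hn' : (1 : ℝ) ≤ n := by exact_mod_cast hn
  have a1 : -(16 * n : ℤ) ≤ a := by
    have : ((-(16 * n : ℤ) : ℤ) : ℝ) ≤ a := by push_cast; linarith
    exact_mod_cast this
  have a2 : a ≤ 16 * n := by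
    have : (a : ℝ) ≤ ((16 * n : ℤ) : ℝ) := by push_cast; linarith
    exact_mod_cast this
  have b1 : -(16 * n : ℤ) ≤ b := by
    have : ((-(16 * n : ℤ) : ℤ) : ℝ) ≤ b := by push_cast; linarith
    exact_mod_cast this
  have b2 : b ≤ 16 * n := by
    have : (b : ℝ) ≤ ((16 * n : ℤ) : ℝ) := by push_cast; linarith
    exact_mod_cast this
  obtain ⟨k, hk⟩ := Int.eq_ofNat_of_zero_le (show 0 ≤ a + 16 * n by omega)
  obtain ⟨l, hl⟩ := Int.eq_ofNat_of_zero_le (show 0 ≤ b + 16 * n by omega)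
  refine ⟨k, by omega, l, by omega, ?_⟩
  have ea : (a : ℝ) = -(16 * n) + k := by
    have : ((a + 16 * n : ℤ) : ℝ) = k := by rw [hk]; simp
    push_cast at this; linarith
  have eb : (b : ℝ) = -(16 * n) + l := by
    have : ((b + 16 * n : ℤ) : ℝ) = l := by rw [hl]; simp
    push_cast at this; linarith
  rwa [ea, eb] at h

/-- The point `(u, v)` lies in the half-open septa-hexagon with the integral indices `a`, `b`. -/
def IsPlaced (u v a b : ℝ) : Prop :=
  (∃ k l : ℤ, a = k ∧ b = l) ∧ Tile HalfCell (u - (5 * a + b)) (v - (3 * a + 9 * b))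

/-- Try the indices in variables `33` and `34` for the point in variable `21`. -/
def tryPlace : Program :=
  .cond (halfTileTest
      (.sub (.get 31 (.const 0)) (.add (.mul (.const 5) (.get 33 (.const 0))) (.get 34 (.const 0))))
      (.sub (.get 32 (.const 0))
        (.add (.mul (.const 3) (.get 33 (.const 0))) (.mul (.const 9) (.get 34 (.const 0))))))
    (.seq (.setReal 11 (var 21) (.get 33 (.const 0))) (.setReal 12 (var 21) (.get 34 (.const 0)))) .skip

/-- Try all indices. -/
def placePoint : Program :=
  .seq (.seq (.setReal 31 (.const 0) (.div (.mul (.sub (.get 3 (var 21)) (.get 9 (var 21))) (.const 4))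
      (.sqrt (.const 3))))
    (.seq (.setReal 32 (.const 0) (.mul (.sub (.get 4 (var 21)) (.get 10 (var 21))) (.const 4)))
      (.setReal 33 (.const 0) (.get 37 (.const 0)))))
    (forLoop 22 (var 24) (.seq (.setReal 34 (.const 0) (.get 37 (.const 0)))
      (.seq (forLoop 23 (var 24)
          (.seq tryPlace (.setReal 34 (.const 0) (.add (.get 34 (.const 0)) (.const 1)))))
        (.setReal 33 (.const 0) (.add (.get 33 (.const 0)) (.const 1))))))

/-- The invariant part of a state reached from `m` while placing the point `i` with coordinates
`u` and `v`. -/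
structure Placing (m : Memory) (n i : ℕ) (u v : ℝ) (m' : Memory) : Prop where
  frame : Frame (scratch {11, 12}) m m'
  others : ∀ j, j ≠ i → m'.real 11 j = m.real 11 j ∧ m'.real 12 j = m.real 12 j
  index : m'.nat 21 0 = i
  count : m'.nat 24 0 = 32 * n + 1
  start : m'.real 37 0 = -(16 * n)
  fst : m'.real 31 0 = u
  snd : m'.real 32 0 = v

theorem Placing.writeNat {m m' : Memory} {n i : ℕ} {u v : ℝ} (h : Placing m n i u v m') {A : ℕ}
    (h1 : A = 22 ∨ A = 23) (w : ℕ) : Placing m n i u v (m'.writeNat A 0 w) where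
  frame := h.frame.writeNat (by simp [scratch]; omega) _ _
  others := h.others
  index := by rw [Memory.nat_writeNat, if_neg (by omega), h.index]
  count := by rw [Memory.nat_writeNat, if_neg (by omega), h.count]
  start := h.start
  fst := h.fst
  snd := h.snd

theorem Placing.writeReal {m m' : Memory} {n i : ℕ} {u v : ℝ} (h : Placing m n i u v m') {A : ℕ}
    (h1 : A = 33 ∨ A = 34) (w : ℝ) : Placing m n i u v (m'.writeReal A 0 w) where
  frame := h.frame.writeReal (by simp [scratch]; omega) _ _
  others j hj := by
    rw [Memory.real_writeReal, Memory.real_writeReal, if_neg (by omega), if_neg (by omega)]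
    exact h.others j hj
  index := h.index
  count := h.count
  start := by rw [Memory.real_writeReal, if_neg (by omega), h.start]
  fst := by rw [Memory.real_writeReal, if_neg (by omega), h.fst]
  snd := by rw [Memory.real_writeReal, if_neg (by omega), h.snd]

/-- A later hit may overwrite an earlier one, but only with a pair of indices that is also correct,
so no uniqueness is needed here. -/
theorem reaches_tryPlace {m m' : Memory} {n i : ℕ} {u v a b : ℝ} (h : Placing m n i u v m')
    (ha : m'.real 33 0 = a) (hb : m'.real 34 0 = b) (hab : ∃ k l : ℤ, a = k ∧ b = l) :
    Reaches (.seq tryPlace (.setReal 34 (.const 0) (.add (.get 34 (.const 0)) (.const 1)))) m' 3000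
      fun m'' => Placing m n i u v m'' ∧ m''.real 33 0 = a ∧ m''.real 34 0 = b + 1 ∧
        m''.nat 22 0 = m'.nat 22 0 ∧ m''.nat 23 0 = m'.nat 23 0 ∧
        (IsPlaced u v (m'.real 11 i) (m'.real 12 i) → IsPlaced u v (m''.real 11 i) (m''.real 12 i)) ∧
        (Tile HalfCell (u - (5 * a + b)) (v - (3 * a + 9 * b)) →
          IsPlaced u v (m''.real 11 i) (m''.real 12 i)) := by
  refine (reaches_of_loopFree (by simp [Program.LoopFree, tryPlace]) ?_).mono
    (by simp [Program.maxCost, NatExp.cost, RealExp.cost, Test.cost, tryPlace, halfTileTest,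
      halfCellTest, Test.any]) (fun _ h => h)
  simp only [tryPlace, Program.exec, holds_halfTileTest, RealExp.eval, NatExp.eval, ha, hb, h.fst,
    h.snd, h.index, Nat.cast_ofNat, Nat.cast_one]
  by_cases ht : Tile HalfCell (u - (5 * a + b)) (v - (3 * a + 9 * b))
  · rw [branch_pos ht]
    have hp : IsPlaced u v a b := ⟨hab, ht⟩
    refine ⟨?_, by simp [Memory.real_writeReal, ha], by simp [Memory.real_writeReal, hb], rfl, rfl,
      by simp [Memory.real_writeReal, h.index, hb, hp],
      by simp [Memory.real_writeReal, h.index, hb, hp]⟩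
    have e34 : (m'.writeReal 11 i a).real 34 0 = b := by simp [Memory.real_writeReal, hb]
    have hq : Placing m n i u v ((m'.writeReal 11 i a).writeReal 12 i b) := by
      refine ⟨?_, ?_, h.index, h.count, ?_, ?_, ?_⟩
      · exact (h.frame.writeReal (by simp [scratch]) _ _).writeReal (by simp [scratch]) _ _
      · intro j hj
        simp [Memory.real_writeReal, hj, h.others j hj]
      · simp [Memory.real_writeReal, h.start]
      · simp [Memory.real_writeReal, h.fst]
      · simp [Memory.real_writeReal, h.snd]
    simp only [Memory.nat_writeReal, h.index, e34]
    exact hq.writeReal (by simp) _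
  · rw [branch_neg ht]
    exact ⟨h.writeReal (by simp) _, by simp [Memory.real_writeReal, ha],
      by simp [Memory.real_writeReal, hb], rfl, rfl, by simp [Memory.real_writeReal],
      fun h => absurd h ht⟩

/-- All pairs in a square of side `32 * n + 1` are tried. The indices are counted up as real numbers
alongside the loop counters, since a natural number cannot be converted into a real one. -/
theorem reaches_placePoint (m : Memory) (n i : ℕ) (hi : i < n) (h21 : m.nat 21 0 = i)
    (h24 : m.nat 24 0 = 32 * n + 1) (h37 : m.real 37 0 = -(16 * n)) {u v : ℝ}
    (hu : u = (m.real 3 i - m.real 9 i) * 4 / √3) (hv : v = (m.real 4 i - m.real 10 i) * 4)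
    (hu0 : 0 ≤ u) (hu1 : u ≤ 20 * n) (hv0 : 0 ≤ v) (hv1 : v ≤ 32 * n) :
    Reaches placePoint m (10 ^ 7 * (n + 1) ^ 2) fun m' => Placing m n i u v m' ∧
      IsPlaced u v (m'.real 11 i) (m'.real 12 i) := by
  have ha : Reaches (.seq (.setReal 31 (.const 0)
      (.div (.mul (.sub (.get 3 (var 21)) (.get 9 (var 21))) (.const 4)) (.sqrt (.const 3))))
      (.seq (.setReal 32 (.const 0) (.mul (.sub (.get 4 (var 21)) (.get 10 (var 21))) (.const 4)))
      (.setReal 33 (.const 0) (.get 37 (.const 0))))) m 100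
      (fun m' => Placing m n i u v m' ∧ m'.real 33 0 = -(16 * n)) := by
    refine (reaches_of_loopFree (by simp [Program.LoopFree]) ?_).mono
      (by simp [Program.maxCost, NatExp.cost, RealExp.cost]) (fun _ h => h)
    simp only [Program.exec, RealExp.eval, NatExp.eval, h21]
    refine ⟨⟨?_, ?_, h21, h24, ?_, ?_, ?_⟩, ?_⟩
    · refine Frame.writeReal (Frame.writeReal (Frame.writeReal (Frame.refl _ _) ?_ _ _) ?_ _ _) ?_ _ _
        <;> simp [scratch]
    · intro j hj; simp [Memory.real_writeReal]
    · simp [Memory.real_writeReal, h37]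
    · simp [Memory.real_writeReal, hu]
    · simp [Memory.real_writeReal, hv, h21]
    · simp [Memory.real_writeReal, h37]
  have hint : ∀ k l : ℕ, ∃ k' l' : ℤ, (-(16 * n) + k : ℝ) = k' ∧ (-(16 * n) + l : ℝ) = l' :=
    fun k l => ⟨-(16 * n) + k, -(16 * n) + l, by push_cast; ring, by push_cast; ring⟩
  let T : ℕ → ℕ → Prop := fun k l =>
    Tile HalfCell (u - (5 * (-(16 * n) + k) + (-(16 * n) + l)))
      (v - (3 * (-(16 * n) + k) + 9 * (-(16 * n) + l)))
  refine (ha.seq (T₂ := (32 * n + 2) * ((32 * n + 2) * 3030 + 200)) ?_).mono ?_ (fun _ h => h)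
  · rintro m₁ ⟨hp₁, h33₁⟩
    refine (reaches_forLoop_const (32 * n + 1) ((32 * n + 2) * 3030 + 100) (fun k m' =>
      Placing m n i u v m' ∧ m'.real 33 0 = -(16 * n) + k ∧ ∀ k' < k, ∀ l < 32 * n + 1, T k' l →
        IsPlaced u v (m'.real 11 i) (m'.real 12 i)) ?_ ?_ ?_ ?_).mono ?_ ?_
    · exact ⟨hp₁, by simp [h33₁], by simp⟩
    · rintro k m' w ⟨hp, h33, hT⟩
      exact ⟨hp.writeNat (by simp) _, by simpa using h33, by simpa using hT⟩
    · rintro k m' ⟨hp, -⟩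
      simp only [NatExp.eval, hp.count]
    · rintro k hk m' ⟨hp, h33, hT⟩ hck
      have hb : Reaches (.setReal 34 (.const 0) (.get 37 (.const 0))) m' 6
          (fun m'' => m'' = m'.writeReal 34 0 (-(16 * n))) := by
        refine (reaches_of_loopFree (by trivial) ?_).mono
          (by simp [Program.maxCost, NatExp.cost, RealExp.cost]) (fun _ h => h)
        simp [Program.exec, NatExp.eval, RealExp.eval, hp.start]
      refine (hb.seq (T₂ := (32 * n + 2) * 3030 + 50) ?_).mono (by omega) (fun _ h => h)
      rintro _ rfl
      have hinner := reaches_forLoop_const (c := 23) (N := var 24)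
        (p := .seq tryPlace (.setReal 34 (.const 0) (.add (.get 34 (.const 0)) (.const 1))))
        (m := m'.writeReal 34 0 (-(16 * n))) (32 * n + 1) 3000 (fun l m'' =>
        Placing m n i u v m'' ∧ m''.real 33 0 = -(16 * n) + k ∧ m''.real 34 0 = -(16 * n) + l ∧
          m''.nat 22 0 = k ∧ (∀ k' < k, ∀ l < 32 * n + 1, T k' l →
            IsPlaced u v (m''.real 11 i) (m''.real 12 i)) ∧
          ∀ l' < l, T k l' → IsPlaced u v (m''.real 11 i) (m''.real 12 i)) ?_ ?_ ?_ ?_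
      · refine (hinner.seq (T₂ := 20) ?_).mono ?_ (fun _ h => h)
        · rintro m₂ ⟨⟨hp₂, h33₂, h34₂, h22₂, hT₂, hT₂'⟩, -⟩
          refine (reaches_of_loopFree (by trivial) ?_).mono
            (by simp [Program.maxCost, NatExp.cost, RealExp.cost]) (fun _ h => h)
          simp only [Program.exec, NatExp.eval, RealExp.eval, h33₂, Nat.cast_one]
          refine ⟨⟨hp₂.writeReal (by simp) _, ?_, ?_⟩, h22₂⟩
          · simp [Memory.real_writeReal]; ring
          · simp only [Memory.real_writeReal, Nat.reduceEqDiff, false_and, if_false]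
            intro k' hk' l hl ht
            rcases Nat.lt_succ_iff_lt_or_eq.1 hk' with hk' | rfl
            · exact hT₂ k' hk' l hl ht
            · exact hT₂' l hl ht
        · simp only [NatExp.cost]; omega
      · refine ⟨hp.writeReal (by simp) _, ?_, ?_, hck, ?_, by simp⟩
        · simpa [Memory.real_writeReal] using h33
        · simp [Memory.real_writeReal]
        · simpa [Memory.real_writeReal] using hT
      · rintro l m'' w ⟨hp', h33', h34', h22', hT', hT''⟩
        exact ⟨hp'.writeNat (by simp) _, by simpa using h33', by simpa using h34',
          by simpa [Memory.nat_writeNat] using h22', by simpa using hT', by simpa using hT''⟩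
      · rintro l m'' ⟨hp', -⟩
        simp only [NatExp.eval, hp'.count]
      · rintro l hl m'' ⟨hp', h33', h34', h22', hT', hT''⟩ hcl
        refine (reaches_tryPlace hp' h33' h34' (hint k l)).mono le_rfl ?_
        rintro m₂ ⟨hp₂, h33₂, h34₂, h22₂, h23₂, hold, hnew⟩
        refine ⟨⟨hp₂, h33₂, by rw [h34₂]; push_cast; ring, by rw [h22₂, h22'], ?_, ?_⟩,
          by rw [h23₂, hcl]⟩
        · exact fun k' hk' l hl ht => hold (hT' k' hk' l hl ht)
        · intro l' hl' ht
          rcases Nat.lt_succ_iff_lt_or_eq.1 hl' with hl' | rfl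
          · exact hold (hT'' l' hl' ht)
          · exact hnew ht
    · simp only [NatExp.cost]
      exact Nat.mul_le_mul_left _ (by omega)
    · rintro m' ⟨⟨hp, -, hT⟩, -⟩
      obtain ⟨k, hk, l, hl, ht⟩ := exists_halfTile_bounded (by omega) hu0 hu1 hv0 hv1
      exact ⟨hp, hT k hk l hl ht⟩
  · have h1 : 32 * n + 2 ≤ 32 * (n + 1) := by omega
    have h2 : (32 * n + 2) * 3030 + 200 ≤ 100000 * (n + 1) := by omega
    have h3 := Nat.mul_le_mul h1 h2
    have h4 : 32 * (n + 1) * (100000 * (n + 1)) = 3200000 * (n + 1) ^ 2 := by ring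
    have h5 : 1 ≤ (n + 1) ^ 2 := Nat.one_le_pow _ _ (by omega)
    omega

/-- Place all points. -/
def placePoints : Program :=
  .seq (.seq (.setReal 37 (.const 0) (.const 0))
    (.seq (assign 25 (.add (var 0) (var 0))) (.seq (assign 25 (.add (var 25) (var 25)))
      (.seq (assign 25 (.add (var 25) (var 25))) (.seq (assign 25 (.add (var 25) (var 25)))
        (assign 24 (.add (.add (var 25) (var 25)) (.const 1))))))))
    (.seq (forLoop 21 (var 0) (.setReal 37 (.const 0) (.sub (.get 37 (.const 0)) (.const 16))))
      (forLoop 21 (var 0) placePoint))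

/-- Without multiplication of natural numbers `32 * n` is reached by doubling, and the real number
`-(16 * n)` by `n` subtractions. -/
theorem reaches_placePoints (m : Memory) (n : ℕ) (h0 : m.nat 0 0 = n)
    (h9 : ∀ i < n, IsRoot (m.real 3) n i (m.real 9 i))
    (h10 : ∀ i < n, IsRoot (m.real 4) n i (m.real 10 i)) :
    Reaches placePoints m (10 ^ 8 * (n + 1) ^ 3) fun m' => Frame (scratch {11, 12}) m m' ∧
      ∀ i < n, IsPlaced ((m.real 3 i - m.real 9 i) * 4 / √3) ((m.real 4 i - m.real 10 i) * 4)
        (m'.real 11 i) (m'.real 12 i) := by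
  have ha : Reaches (.seq (.setReal 37 (.const 0) (.const 0))
      (.seq (assign 25 (.add (var 0) (var 0))) (.seq (assign 25 (.add (var 25) (var 25)))
      (.seq (assign 25 (.add (var 25) (var 25))) (.seq (assign 25 (.add (var 25) (var 25)))
        (assign 24 (.add (.add (var 25) (var 25)) (.const 1)))))))) m 100
      (fun m' => Frame (scratch {11, 12}) m m' ∧ m'.nat 24 0 = 32 * n + 1 ∧ m'.real 37 0 = 0) := by
    refine (reaches_of_loopFree (by simp [Program.LoopFree]) ?_).mono
      (by simp [Program.maxCost, NatExp.cost, RealExp.cost]) (fun _ h => h)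
    simp only [Program.exec, RealExp.eval, NatExp.eval]
    refine ⟨?_, ?_, ?_⟩
    · refine Frame.writeNat (Frame.writeNat (Frame.writeNat (Frame.writeNat (Frame.writeNat
        (Frame.writeReal (Frame.refl _ _) ?_ _ _) ?_ _ _) ?_ _ _) ?_ _ _) ?_ _ _) ?_ _ _
        <;> simp [scratch]
    · simp [Memory.nat_writeNat, h0]; omega
    · simp [Memory.real_writeReal]
  refine (ha.seq (T₂ := 10 ^ 7 * (n + 1) ^ 3 + 1000 * (n + 1) + 1000 * (n + 1)) ?_).mono ?_
    (fun _ h => h)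
  · rintro m₁ ⟨hf₁, h24₁, h37₁⟩
    have hb : Reaches (forLoop 21 (var 0)
        (.setReal 37 (.const 0) (.sub (.get 37 (.const 0)) (.const 16)))) m₁ (1000 * (n + 1))
        (fun m' => (Frame (scratch {11, 12}) m m' ∧ m'.nat 24 0 = 32 * n + 1 ∧
          m'.real 37 0 = -(16 * n)) ∧ m'.nat 21 0 = n) := by
      refine (reaches_forLoop_const n 20 (fun k m' => Frame (scratch {11, 12}) m m' ∧
        m'.nat 24 0 = 32 * n + 1 ∧ m'.real 37 0 = -(16 * k)) ?_ ?_ ?_ ?_).mono ?_ (fun _ h => h)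
      · exact ⟨hf₁, h24₁, by simpa using h37₁⟩
      · rintro k m' w ⟨hf, h24, h37⟩
        exact ⟨hf.writeNat (by simp [scratch]) _ _, by simpa [Memory.nat_writeNat] using h24,
          by simpa using h37⟩
      · rintro k m' ⟨hf, -⟩
        simp only [NatExp.eval, (hf 0 (by simp [scratch])).1, h0]
      · rintro k hk m' ⟨hf, h24, h37⟩ hck
        refine (reaches_of_loopFree (by trivial) ?_).mono
          (by simp [Program.maxCost, NatExp.cost, RealExp.cost]) (fun _ h => h)
        simp only [Program.exec, RealExp.eval, NatExp.eval, h37]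
        refine ⟨⟨hf.writeReal (by simp [scratch]) _ _, h24, ?_⟩, hck⟩
        simp [Memory.real_writeReal]; ring
      · simp only [NatExp.cost]; omega
    refine (hb.seq (T₂ := 10 ^ 7 * (n + 1) ^ 3 + 1000 * (n + 1)) ?_).mono (by omega) (fun _ h => h)
    rintro m₂ ⟨⟨hf₂, h24₂, h37₂⟩, -⟩
    refine (reaches_forLoop_const n (10 ^ 7 * (n + 1) ^ 2) (fun k m' =>
      Frame (scratch {11, 12}) m m' ∧ m'.nat 24 0 = 32 * n + 1 ∧ m'.real 37 0 = -(16 * n) ∧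
      ∀ i < k, IsPlaced ((m.real 3 i - m.real 9 i) * 4 / √3) ((m.real 4 i - m.real 10 i) * 4)
        (m'.real 11 i) (m'.real 12 i)) ?_ ?_ ?_ ?_).mono ?_ ?_
    · exact ⟨hf₂, h24₂, h37₂, by simp⟩
    · rintro k m' w ⟨hf, h24, h37, hr⟩
      exact ⟨hf.writeNat (by simp [scratch]) _ _, by simpa [Memory.nat_writeNat] using h24,
        by simpa using h37, by simpa using hr⟩
    · rintro k m' ⟨hf, -⟩
      simp only [NatExp.eval, (hf 0 (by simp [scratch])).1, h0]
    · rintro k hk m' ⟨hf, h24, h37, hr⟩ hck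
      have e3 : m'.real 3 = m.real 3 := (hf 3 (by simp [scratch])).2
      have e4 : m'.real 4 = m.real 4 := (hf 4 (by simp [scratch])).2
      have e9 : m'.real 9 = m.real 9 := (hf 9 (by simp [scratch])).2
      have e10 : m'.real 10 = m.real 10 := (hf 10 (by simp [scratch])).2
      have r9 := h9 k hk
      have r10 := h10 k hk
      have hs := sqrt3_pos
      -- The bound `8 * n` on the distance to the root becomes `32 * n / √3` in `xi`, and this is at
      -- most `20 * n` once `√3 ≥ 1.6`.
      have hs2 : (1.7 : ℝ) ≤ √3 := Real.le_sqrt_of_sq_le (by norm_num)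
      refine (reaches_placePoint m' n k hk hck h24 h37 (by rw [e3, e9]) (by rw [e4, e10]) ?_ ?_ ?_
        ?_).mono le_rfl ?_
      · exact div_nonneg (by linarith [r9.le]) hs.le
      · rw [div_le_iff₀ hs]
        have : (0 : ℝ) ≤ n := by positivity
        nlinarith [r9.near]
      · linarith [r10.le]
      · linarith [r10.near]
      · rintro m'' ⟨hp, hpl⟩
        refine ⟨⟨hf.trans hp.frame, hp.count, hp.start, fun i hi => ?_⟩, hp.index⟩
        rcases Nat.lt_succ_iff_lt_or_eq.1 hi with hi | rfl
        · rw [(hp.others i hi.ne).1, (hp.others i hi.ne).2]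
          exact hr i hi
        · exact hpl
    · simp only [NatExp.cost]
      ring_nf
      omega
    · rintro m' ⟨⟨hf, -, -, hr⟩, -⟩
      exact ⟨hf, hr⟩
  · have h1 : n + 1 ≤ (n + 1) ^ 3 := Nat.le_self_pow (by norm_num) _
    have h2 : 1 ≤ (n + 1) ^ 3 := Nat.one_le_pow _ _ (by omega)
    omega

/-- The preparation of the input. -/
def prepare : Program :=
  .seq sortPoints (.seq fillIds (.seq fillPowers (.seq (findRoots 3 9) (.seq (findRoots 4 10)
    placePoints))))

/-- The coordinate `xi` of the point `i` relative to its root. -/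
noncomputable def relXi (m : Memory) (i : ℕ) : ℝ := (m.real 3 i - m.real 9 i) * 4 / √3

/-- The coordinate `eta` of the point `i` relative to its root. -/
noncomputable def relEta (m : Memory) (i : ℕ) : ℝ := (m.real 4 i - m.real 10 i) * 4

/-- The outcome of the preparation of `n` points with coordinates `x`, `y`. -/
structure IsPrepared (m : Memory) (n : ℕ) (x y : ℕ → ℝ) : Prop where
  size : m.nat 0 0 = n
  output : m.nat 1 0 = 0
  ids : readList m 6 0 = List.range n
  log : m.nat 8 0 = Nat.size n
  powers : ∀ i < m.nat 8 0, m.nat 7 i = 2 ^ i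
  sorted : IsSorted n x y (m.real 3) (m.real 4) (m.nat 5)
  rootX : ∀ i < n, IsRoot (m.real 3) n i (m.real 9 i)
  rootY : ∀ i < n, IsRoot (m.real 4) n i (m.real 10 i)
  placed : ∀ i < n, IsPlaced (relXi m i) (relEta m i) (m.real 11 i) (m.real 12 i)

theorem reaches_prepare (m : Memory) (n : ℕ) (h0 : m.nat 0 0 = n) (h1 : m.nat 1 0 = 0) :
    Reaches prepare m (10 ^ 9 * (n + 1) ^ 3) fun m' => IsPrepared m' n (m.real 0) (m.real 1) := by
  refine ((reaches_sortPoints m n h0).seq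
    (T₂ := 100 * (n + 1) + (100 * (n + 1) + (1000 * (n + 1) ^ 3 + (1000 * (n + 1) ^ 3 +
      10 ^ 8 * (n + 1) ^ 3)))) ?_).mono ?_ (fun _ h => h)
  · rintro m₁ ⟨f₁, hs⟩
    refine (reaches_fillIds m₁ n (by rw [(f₁ 0 (by simp [scratch])).1, h0])).seq ?_
    rintro m₂ ⟨f₂, hid⟩
    have g₂ : Frame (scratch {3, 4, 5, 6}) m m₂ :=
      (f₁.mono (by intro A; simp [scratch]; omega)).trans
        (f₂.mono (by intro A; simp [scratch]; omega))
    refine (reaches_fillPowers m₂ n (by rw [(g₂ 0 (by simp [scratch])).1, h0])).seq ?_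
    rintro m₃ ⟨f₃, h8, h7⟩
    have g₃ : Frame (scratch {3, 4, 5, 6, 7, 8}) m m₃ :=
      (g₂.mono (by intro A; simp [scratch]; omega)).trans
        (f₃.mono (by intro A; simp [scratch]; omega))
    refine (reaches_findRoots 3 9 (by simp) (by simp) (by simp) (by simp) m₃ n
      (by rw [(g₃ 0 (by simp [scratch])).1, h0])).seq ?_
    rintro m₄ ⟨f₄, h9⟩
    have g₄ : Frame (scratch {3, 4, 5, 6, 7, 8, 9}) m m₄ :=
      (g₃.mono (by intro A; simp [scratch]; omega)).trans
        (f₄.mono (by intro A; simp [scratch]; omega))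
    refine (reaches_findRoots 4 10 (by simp) (by simp) (by simp) (by simp) m₄ n
      (by rw [(g₄ 0 (by simp [scratch])).1, h0])).seq ?_
    rintro m₅ ⟨f₅, h10⟩
    have g₅ : Frame (scratch {3, 4, 5, 6, 7, 8, 9, 10}) m m₅ :=
      (g₄.mono (by intro A; simp [scratch]; omega)).trans
        (f₅.mono (by intro A; simp [scratch]; omega))
    have k9 : ∀ i < n, IsRoot (m₅.real 3) n i (m₅.real 9 i) := by
      rw [(f₅ 3 (by simp [scratch])).2, (f₄ 3 (by simp [scratch])).2, (f₅ 9 (by simp [scratch])).2]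
      exact h9
    have k10 : ∀ i < n, IsRoot (m₅.real 4) n i (m₅.real 10 i) := by
      rw [(f₅ 4 (by simp [scratch])).2]
      exact h10
    refine (reaches_placePoints m₅ n (by rw [(g₅ 0 (by simp [scratch])).1, h0]) k9 k10).mono le_rfl ?_
    rintro m₆ ⟨f₆, hpl⟩
    have g₆ : Frame (scratch {3, 4, 5, 6, 7, 8, 9, 10, 11, 12}) m m₆ :=
      (g₅.mono (by intro A; simp [scratch]; omega)).trans
        (f₆.mono (by intro A; simp [scratch]; omega))
    have p₂ : Frame (scratch {6, 7, 8, 9, 10, 11, 12}) m₁ m₆ := by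
      refine Frame.trans (Frame.trans (Frame.trans (Frame.trans (f₂.mono ?_) (f₃.mono ?_))
        (f₄.mono ?_)) (f₅.mono ?_)) (f₆.mono ?_) <;> (intro A; simp [scratch]; omega)
    have p₃ : Frame (scratch {7, 8, 9, 10, 11, 12}) m₂ m₆ := by
      refine Frame.trans (Frame.trans (Frame.trans (f₃.mono ?_)
        (f₄.mono ?_)) (f₅.mono ?_)) (f₆.mono ?_) <;> (intro A; simp [scratch]; omega)
    have p₄ : Frame (scratch {9, 10, 11, 12}) m₃ m₆ := by
      refine Frame.trans (Frame.trans (f₄.mono ?_) (f₅.mono ?_)) (f₆.mono ?_) <;>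
        (intro A; simp [scratch]; omega)
    have e8 : m₆.nat 8 = m₃.nat 8 := (p₄ 8 (by simp [scratch])).1
    have e3 : m₆.real 3 = m₅.real 3 := (f₆ 3 (by simp [scratch])).2
    have e4 : m₆.real 4 = m₅.real 4 := (f₆ 4 (by simp [scratch])).2
    have e9 : m₆.real 9 = m₅.real 9 := (f₆ 9 (by simp [scratch])).2
    have e10 : m₆.real 10 = m₅.real 10 := (f₆ 10 (by simp [scratch])).2
    exact {
      size := by rw [(g₆ 0 (by simp [scratch])).1, h0]
      output := by rw [(g₆ 1 (by simp [scratch])).1, h1]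
      ids := by rw [p₃.readList (by simp [scratch]) (by simp [scratch]), hid]
      log := by rw [e8, h8]
      powers := by rw [e8, h8, (p₄ 7 (by simp [scratch])).1]; exact h7
      sorted := by
        rw [(p₂ 3 (by simp [scratch])).2, (p₂ 4 (by simp [scratch])).2, (p₂ 5 (by simp [scratch])).1]
        exact hs
      rootX := by rw [e3, e9]; exact k9
      rootY := by rw [e4, e10]; exact k10
      placed := by
        unfold relXi relEta
        rw [e3, e4, e9, e10]
        exact hpl }
  · have h1 : n + 1 ≤ (n + 1) ^ 3 := Nat.le_self_pow (by norm_num) _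
    have h2 : (n + 1) ^ 2 ≤ (n + 1) ^ 3 := Nat.pow_le_pow_right (by omega) (by omega)
    omega

/-! ### Representatives, packing and the total work -/

theorem SameTile.symm {m : Memory} {i j : ℕ} (h : SameTile m i j) : SameTile m j i :=
  ⟨h.1.symm, h.2.1.symm, h.2.2.1.symm, h.2.2.2.symm⟩

theorem SameTile.trans {m : Memory} {i j k : ℕ} (h : SameTile m i j) (h' : SameTile m j k) :
    SameTile m i k :=
  ⟨h.1.trans h'.1, h.2.1.trans h'.2.1, h.2.2.1.trans h'.2.2.1, h.2.2.2.trans h'.2.2.2⟩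

theorem IsRep.eq {m : Memory} {i j : ℕ} (hi : IsRep m i) (hj : IsRep m j) (h : SameTile m i j) :
    i = j := by
  rcases lt_trichotomy i j with h1 | h1 | h1
  · exact absurd h (hj i h1)
  · exact h1
  · exact absurd h.symm (hi j h1)

open Classical in
theorem exists_rep (m : Memory) (i : ℕ) : ∃ j ≤ i, IsRep m j ∧ SameTile m j i := by
  have h : ∃ j, SameTile m j i := ⟨i, rfl, rfl, rfl, rfl⟩
  refine ⟨Nat.find h, Nat.find_min' h ⟨rfl, rfl, rfl, rfl⟩, fun j hj hs => ?_, Nat.find_spec h⟩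
  exact Nat.find_min h hj (hs.trans (Nat.find_spec h))

theorem mem_tileList {m : Memory} {n i j : ℕ} : j ∈ tileList m n i ↔ j < n ∧ SameTile m j i := by
  simp [tileList, mem_select]

theorem mem_coverList {m : Memory} {n i q : ℕ} : q ∈ coverList m n i ↔
    q < n ∧ ∃ j ∈ tileList m n i, Near (m.real 3) (m.real 4) j q := by
  simp [coverList, mem_select]

theorem near_of_rel {m : Memory} {i j : ℕ} (h9 : m.real 9 i = m.real 9 j)
    (h10 : m.real 10 i = m.real 10 j)
    (h : 3 * (relXi m i - relXi m j) ^ 2 + (relEta m i - relEta m j) ^ 2 ≤ 16) :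
    Near (m.real 3) (m.real 4) i j := by
  have hs := sqrt3_pos
  have h1 : m.real 3 i - m.real 3 j = (relXi m i - relXi m j) * √3 / 4 := by
    unfold relXi; rw [h9]; field_simp; ring
  have h2 : m.real 4 i - m.real 4 j = (relEta m i - relEta m j) / 4 := by
    unfold relEta; rw [h10]; ring
  unfold Near
  rw [h1, h2]
  nlinarith [sqrt3_mul_self]

namespace IsPrepared

variable {m : Memory} {n : ℕ} {x y : ℕ → ℝ}

theorem roots_eq (h : IsPrepared m n x y) {i j : ℕ} (hi : i < n) (hj : j < n)
    (h1 : |m.real 3 i - m.real 3 j| ≤ 8) (h2 : |m.real 4 i - m.real 4 j| ≤ 8) :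
    m.real 9 i = m.real 9 j ∧ m.real 10 i = m.real 10 j :=
  ⟨(h.rootX i hi).eq_of_near hi hj (h.rootX j hj) h1,
    (h.rootY i hi).eq_of_near hi hj (h.rootY j hj) h2⟩

/-- Of eight points in the seven cells of a septa-hexagon two share a cell, whose diameter is 1. -/
theorem pigeon (h : IsPrepared m n x y) (i : ℕ) (l : List ℕ) (hl : l.length = 8)
    (hmem : ∀ a ∈ l, a ∈ tileList m n i) :
    ¬ l.Pairwise fun a b => ¬ Near (m.real 3) (m.real 4) a b := by
  classical
  intro hpw
  have hcell : ∀ a ∈ l, ∃ z ∈ offsets,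
      ClosedCell (relXi m a - (5 * m.real 11 i + m.real 12 i) - (2 * z.1 + z.2))
        (relEta m a - (3 * m.real 11 i + 9 * m.real 12 i) - 3 * z.2) := by
    intro a ha
    obtain ⟨han, hs⟩ := mem_tileList.1 (hmem a ha)
    obtain ⟨-, p, q, ho, hc⟩ := h.placed a han
    rw [hs.2.2.1, hs.2.2.2] at hc
    exact ⟨(p, q), mem_offsets.2 ho, hc.closed⟩
  choose! f hf hc using hcell
  have hnd : (l.map f).Nodup := by
    rw [List.Nodup, List.pairwise_map]
    refine hpw.imp_of_mem fun {a b} ha hb hab hfab => hab ?_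
    obtain ⟨-, sa⟩ := mem_tileList.1 (hmem a ha)
    obtain ⟨-, sb⟩ := mem_tileList.1 (hmem b hb)
    have hca := hc a ha
    have hcb := hc b hb
    rw [← hfab] at hcb
    refine near_of_rel (sa.1.trans sb.1.symm) (sa.2.1.trans sb.2.1.symm) ?_
    have := closedCell_near hca hcb
    nlinarith [this]
  have h1 : (l.map f).toFinset.card = 8 := by
    rw [List.toFinset_card_of_nodup hnd, List.length_map, hl]
  have h2 : (l.map f).toFinset ⊆ offsets := by
    intro z hz
    obtain ⟨a, ha, rfl⟩ := List.mem_map.1 (List.mem_toFinset.1 hz)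
    exact hf a ha
  have h3 := Finset.card_le_card h2
  rw [h1, card_offsets] at h3
  omega

theorem prepared (h : IsPrepared m n x y) : Prepared m n where
  size := h.size
  ids := h.ids
  sorted := by
    refine List.pairwise_lt_range.imp_of_mem fun {a b} _ hb hab => ?_
    exact h.sorted.mono a b hab (List.mem_range.1 hb)
  large := by rw [h.log]; exact Nat.lt_size_self n
  powers := h.powers
  pigeon := h.pigeon

end IsPrepared

open Classical in
theorem length_select_range (p : ℕ → Prop) (n : ℕ) :
    (select p (List.range n)).length = ∑ q ∈ Finset.range n, if p q then 1 else 0 := by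
  induction n with
  | zero => simp [select]
  | succ n ih =>
    rw [List.range_succ, select_append, List.length_append, ih, Finset.sum_range_succ]
    by_cases h : p n
    · rw [select_singleton_pos h, if_pos h]; rfl
    · rw [select_singleton_neg h, if_neg h]; rfl

theorem near_abs {X Y : ℕ → ℝ} {i j : ℕ} (h : Near X Y i j) : |X i - X j| ≤ 1 ∧ |Y i - Y j| ≤ 1 := by
  unfold Near at h
  constructor
  · exact abs_le_of_sq_le_sq (by nlinarith [sq_nonneg (Y i - Y j)]) (by norm_num)
  · exact abs_le_of_sq_le_sq (by nlinarith [sq_nonneg (X i - X j)]) (by norm_num)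

/-- The hypotheses are what distance 2 amounts to: `8 / √3 ≤ 5` in `xi` and `8` in `eta`. Solving
for the index differences with determinant 42 leaves at most 117/42 and 123/42. -/
theorem index_bound {u v u' v' : ℝ} {a b a' b' : ℤ}
    (h : Tile HalfCell (u - (5 * a + b)) (v - (3 * a + 9 * b)))
    (h' : Tile HalfCell (u' - (5 * a' + b')) (v' - (3 * a' + 9 * b')))
    (hu : |u - u'| ≤ 5) (hv : |v - v'| ≤ 8) :
    a - a' ∈ Finset.Icc (-3 : ℤ) 3 ∧ b - b' ∈ Finset.Icc (-3 : ℤ) 3 := by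
  obtain ⟨h1, h2, -⟩ := (h.mono fun _ _ => HalfCell.closed).bound
  obtain ⟨h1', h2', -⟩ := (h'.mono fun _ _ => HalfCell.closed).bound
  rw [abs_le] at h1 h2 h1' h2' hu hv
  rw [Finset.mem_Icc, Finset.mem_Icc]
  refine ⟨⟨?_, ?_⟩, ?_, ?_⟩
  · have : ((-3 : ℤ) : ℝ) ≤ ((a - a' : ℤ) : ℝ) := by push_cast; linarith
    exact_mod_cast this
  · have : ((a - a' : ℤ) : ℝ) ≤ ((3 : ℤ) : ℝ) := by push_cast; linarith
    exact_mod_cast this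
  · have : ((-3 : ℤ) : ℝ) ≤ ((b - b' : ℤ) : ℝ) := by push_cast; linarith
    exact_mod_cast this
  · have : ((b - b' : ℤ) : ℝ) ≤ ((3 : ℤ) : ℝ) := by push_cast; linarith
    exact_mod_cast this

open Classical in
-- Double counting over the candidates `q`. Septa-hexagons having `q` as a candidate contain points
-- within 1 of `q`, hence within 2 of each other; so they have the same roots and their indices
-- differ by at most 3, which leaves at most `7 ^ 2` of them.
theorem IsPrepared.sum_tileWork_le {m : Memory} {n : ℕ} {x y : ℕ → ℝ} (h : IsPrepared m n x y) :
    ∑ i ∈ Finset.range n, tileWork m n i ≤ 49 * n := by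
  have hint : ∀ i < n, ∃ k l : ℤ, m.real 11 i = k ∧ m.real 12 i = l ∧
      Tile HalfCell (relXi m i - (5 * k + l)) (relEta m i - (3 * k + 9 * l)) := by
    intro i hi
    obtain ⟨⟨k, l, hk, hl⟩, ht⟩ := h.placed i hi
    exact ⟨k, l, hk, hl, by rwa [← hk, ← hl]⟩
  choose! k l hk hl ht using hint
  calc ∑ i ∈ Finset.range n, tileWork m n i
      = ∑ i ∈ Finset.range n, ∑ q ∈ Finset.range n,
          if IsRep m i ∧ ∃ j ∈ tileList m n i, Near (m.real 3) (m.real 4) j q then 1 else 0 := by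
        refine Finset.sum_congr rfl fun i _ => ?_
        by_cases hR : IsRep m i
        · simp only [tileWork, hR, if_true, true_and, coverList, length_select_range]
          exact Finset.sum_congr rfl fun q _ => by congr
        · simp [tileWork, hR]
    _ = ∑ q ∈ Finset.range n, ∑ i ∈ Finset.range n,
          if IsRep m i ∧ ∃ j ∈ tileList m n i, Near (m.real 3) (m.real 4) j q then 1 else 0 :=
        Finset.sum_comm
    _ ≤ ∑ q ∈ Finset.range n, 49 := by
        refine Finset.sum_le_sum fun q hq => ?_
        rw [← Finset.card_filter]
        set F := (Finset.range n).filter fun i =>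
          IsRep m i ∧ ∃ j ∈ tileList m n i, Near (m.real 3) (m.real 4) j q with hF
        rcases F.eq_empty_or_nonempty with h0 | ⟨i₀, hi₀⟩
        · rw [h0]; simp
        have key : ∀ i ∈ F, ∀ i' ∈ F, m.real 9 i = m.real 9 i' ∧ m.real 10 i = m.real 10 i' ∧
            k i - k i' ∈ Finset.Icc (-3 : ℤ) 3 ∧ l i - l i' ∈ Finset.Icc (-3 : ℤ) 3 := by
          intro i hi i' hi'
          obtain ⟨hin, -, j, hj, hjq⟩ := Finset.mem_filter.1 hi
          obtain ⟨hin', -, j', hj', hjq'⟩ := Finset.mem_filter.1 hi'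
          rw [Finset.mem_range] at hin hin'
          obtain ⟨hjn, hs⟩ := mem_tileList.1 hj
          obtain ⟨hjn', hs'⟩ := mem_tileList.1 hj'
          obtain ⟨a1, a2⟩ := near_abs hjq
          obtain ⟨a1', a2'⟩ := near_abs hjq'
          rw [abs_le] at a1 a2 a1' a2'
          have b1 : |m.real 3 j - m.real 3 j'| ≤ 2 := abs_le.2 ⟨by linarith, by linarith⟩
          have b2 : |m.real 4 j - m.real 4 j'| ≤ 2 := abs_le.2 ⟨by linarith, by linarith⟩
          obtain ⟨r1, r2⟩ := h.roots_eq hjn hjn' (b1.trans (by norm_num)) (b2.trans (by norm_num))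
          have k1 : k j = k i := by
            have := hs.2.2.1; rw [hk j hjn, hk i hin] at this; exact_mod_cast this
          have k1' : k j' = k i' := by
            have := hs'.2.2.1; rw [hk j' hjn', hk i' hin'] at this; exact_mod_cast this
          have l1 : l j = l i := by
            have := hs.2.2.2; rw [hl j hjn, hl i hin] at this; exact_mod_cast this
          have l1' : l j' = l i' := by
            have := hs'.2.2.2; rw [hl j' hjn', hl i' hin'] at this; exact_mod_cast this
          refine ⟨hs.1.symm.trans (r1.trans hs'.1), hs.2.1.symm.trans (r2.trans hs'.2.1), ?_⟩
          rw [← k1, ← k1', ← l1, ← l1']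
          refine index_bound (ht j hjn) (ht j' hjn') ?_ ?_
          · have e : relXi m j - relXi m j' = (m.real 3 j - m.real 3 j') * 4 / √3 := by
              unfold relXi; rw [r1]; ring
            have hs2 : (1.7 : ℝ) ≤ √3 := Real.le_sqrt_of_sq_le (by norm_num)
            rw [e, abs_div, abs_mul, abs_of_pos sqrt3_pos, div_le_iff₀ sqrt3_pos]
            norm_num
            linarith
          · have e : relEta m j - relEta m j' = (m.real 4 j - m.real 4 j') * 4 := by
              unfold relEta; rw [r2]; ring
            rw [e, abs_mul]
            norm_num
            linarith
        have hcard : F.card ≤ (Finset.Icc (-3 : ℤ) 3 ×ˢ Finset.Icc (-3 : ℤ) 3).card := by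
          refine Finset.card_le_card_of_injOn (fun i => (k i - k i₀, l i - l i₀)) ?_ ?_
          · intro i hi
            exact Finset.mem_coe.2 (Finset.mem_product.2 (key i hi i₀ hi₀).2.2)
          · intro i hi i' hi' heq
            obtain ⟨e1, e2⟩ := Prod.mk.injEq _ _ _ _ ▸ heq
            have hin := Finset.mem_range.1 (Finset.mem_filter.1 hi).1
            have hin' := Finset.mem_range.1 (Finset.mem_filter.1 hi').1
            obtain ⟨r1, r2, -⟩ := key i hi i' hi'
            refine IsRep.eq (Finset.mem_filter.1 hi).2.1 (Finset.mem_filter.1 hi').2.1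
              ⟨r1, r2, ?_, ?_⟩
            · rw [hk i hin, hk i' hin']; congr 1; omega
            · rw [hl i hin, hl i' hin']; congr 1; omega
        exact hcard.trans (by simp)
    _ = 49 * n := by simp [mul_comm]

/-! ### The tiling found by the program -/

/-- In each of the three conditions the closed end is the one left behind when `u` grows, so a small
shift makes all inequalities strict. -/
theorem halfCell_shift {u v : ℝ} (h : HalfCell u v) :
    ∀ᶠ ε in nhdsWithin (0 : ℝ) (Set.Ioi 0), OpenCell (u + ε) v := by
  obtain ⟨h1, h2, h3, h4, h5, h6⟩ := h
  filter_upwards [Ioo_mem_nhdsGT (show 0 < 1 - u by linarith),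
    Ioo_mem_nhdsGT (show 0 < 2 - (u + v) by linarith),
    Ioo_mem_nhdsGT (show 0 < 2 - (u - v) by linarith)] with ε e1 e2 e3
  exact ⟨abs_lt.2 ⟨by linarith [e1.1], by linarith [e1.2]⟩,
    abs_lt.2 ⟨by linarith [e1.1], by linarith [e2.2]⟩,
    abs_lt.2 ⟨by linarith [e1.1], by linarith [e3.2]⟩⟩

theorem halfTile_shift {u v : ℝ} (h : Tile HalfCell u v) :
    ∀ᶠ ε in nhdsWithin (0 : ℝ) (Set.Ioi 0), Tile OpenCell (u + ε) v := by
  obtain ⟨p, q, ho, hc⟩ := h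
  filter_upwards [halfCell_shift hc] with ε hε
  refine ⟨p, q, ho, ?_⟩
  convert hε using 1
  ring

/-- The `i`-th point in memory. -/
noncomputable def pointAt (m : Memory) (i : ℕ) : Plane := !₂[m.real 3 i, m.real 4 i]

/-- The root of the `i`-th point in memory. -/
noncomputable def rootAt (m : Memory) (i : ℕ) : Plane := !₂[m.real 9 i, m.real 10 i]

theorem xi_pointAt (m : Memory) (i : ℕ) : xi (pointAt m i) = xi (rootAt m i) + relXi m i := by
  simp [xi, pointAt, rootAt, relXi]; ring

theorem eta_pointAt (m : Memory) (i : ℕ) : eta (pointAt m i) = eta (rootAt m i) + relEta m i := by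
  simp [eta, pointAt, rootAt, relEta]; ring

/-- `cen i` is the centre of the septa-hexagon in which the point `i` has been placed, in a tiling
shifted so that no point is on a boundary. -/
structure IsCentring (m : Memory) (n : ℕ) (ε : ℝ) (k l : ℕ → ℤ) (cen : ℕ → Plane) : Prop where
  cen_eq : ∀ i, cen i = tileCentre (rootAt m i - (ε / 2) • e₁) (k i, l i)
  fst : ∀ i < n, m.real 11 i = k i
  snd : ∀ i < n, m.real 12 i = l i
  inside : ∀ i < n, pointAt m i ∈ openTile (cen i)

theorem IsPrepared.exists_centring {m : Memory} {n : ℕ} {x y : ℕ → ℝ} (h : IsPrepared m n x y) :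
    ∃ ε k l cen, IsCentring m n ε k l cen := by
  have hint : ∀ i < n, ∃ k l : ℤ, m.real 11 i = k ∧ m.real 12 i = l ∧
      Tile HalfCell (relXi m i - (5 * k + l)) (relEta m i - (3 * k + 9 * l)) := by
    intro i hi
    obtain ⟨⟨k, l, hk, hl⟩, ht⟩ := h.placed i hi
    exact ⟨k, l, hk, hl, by rwa [← hk, ← hl]⟩
  choose! k l hk hl ht using hint
  have hev : ∀ᶠ ε in nhdsWithin (0 : ℝ) (Set.Ioi 0), ∀ i ∈ Finset.range n,
      Tile OpenCell (relXi m i - (5 * k i + l i) + ε) (relEta m i - (3 * k i + 9 * l i)) :=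
    (Finset.range n).eventually_all.2 fun i hi => halfTile_shift (ht i (Finset.mem_range.1 hi))
  obtain ⟨ε, hε⟩ := hev.exists
  refine ⟨ε, k, l, _, fun i => rfl, hk, hl, fun i hi => ?_⟩
  have := hε i (Finset.mem_range.2 hi)
  change Tile OpenCell _ _
  rw [xi_tileCentre, eta_tileCentre, xi_sub, eta_sub, xi_smul, eta_smul, xi_e₁, eta_e₁, xi_pointAt,
    eta_pointAt]
  convert this using 1 <;> ring

/-- The index of the first point in a septa-hexagon. -/
def FirstIndex (m : Memory) (n : ℕ) : Type := {i : ℕ // i < n ∧ IsRep m i}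

/-- The widths of a septa-hexagon are 6 in `xi` and 10 in `eta`, that is `6 * √3 / 4 < 2.7` and `10
/ 4`. -/
theorem abs_coord_le {p c : Plane} {q : Plane} (hp : p ∈ septaHexagon c) (hq : q ∈ septaHexagon c) :
    |p 0 - q 0| ≤ 2.7 ∧ |p 1 - q 1| ≤ 2.5 := by
  obtain ⟨h1, h2, -⟩ := (mem_septaHexagon.1 hp).bound
  obtain ⟨h1', h2', -⟩ := (mem_septaHexagon.1 hq).bound
  rw [abs_le] at h1 h2 h1' h2'
  have hs : √3 ≤ (1.8 : ℝ) := Real.sqrt_le_iff.2 ⟨by norm_num, by norm_num⟩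
  have hs0 := sqrt3_pos
  rw [xi_eq p, xi_eq q, eta_eq p, eta_eq q]
  refine ⟨abs_le.2 ⟨?_, ?_⟩, abs_le.2 ⟨?_, ?_⟩⟩
  · nlinarith
  · nlinarith
  · linarith
  · linarith

theorem abs_coord_le_dist (p q : Plane) : |p 0 - q 0| ≤ dist p q ∧ |p 1 - q 1| ≤ dist p q := by
  have h : dist p q ^ 2 = (p 0 - q 0) ^ 2 + (p 1 - q 1) ^ 2 := by
    rw [EuclideanSpace.dist_eq, Real.sq_sqrt (by positivity), Fin.sum_univ_two, Real.dist_eq,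
      Real.dist_eq, sq_abs, sq_abs]
  constructor
  · exact abs_le_of_sq_le_sq (by nlinarith [sq_nonneg (p 1 - q 1)]) dist_nonneg
  · exact abs_le_of_sq_le_sq (by nlinarith [sq_nonneg (p 0 - q 0)]) dist_nonneg

namespace IsCentring

variable {m : Memory} {n : ℕ} {x y : ℕ → ℝ} {ε : ℝ} {k l : ℕ → ℤ} {cen : ℕ → Plane}

/-- The points `i` and `j` themselves differ by at most 2.7 + 2 + 2.7 in each coordinate, which is
less than 8. This is what fixes the length of the gaps. -/
theorem roots_eq (hc : IsCentring m n ε k l cen) (h : IsPrepared m n x y) {i j : ℕ} (hi : i < n)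
    (hj : j < n) {p q : Plane} (hp : p ∈ septaHexagon (cen i)) (hq : q ∈ septaHexagon (cen j))
    (hpq : dist p q ≤ 2) : m.real 9 i = m.real 9 j ∧ m.real 10 i = m.real 10 j := by
  obtain ⟨a1, a2⟩ := abs_coord_le hp (openTile_subset _ (hc.inside i hi))
  obtain ⟨b1, b2⟩ := abs_coord_le hq (openTile_subset _ (hc.inside j hj))
  obtain ⟨c1, c2⟩ := abs_coord_le_dist p q
  simp only [pointAt, PiLp.toLp_apply, Matrix.cons_val_zero, Matrix.cons_val_one] at a1 a2 b1 b2
  rw [abs_le] at a1 a2 b1 b2 c1 c2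
  refine h.roots_eq hi hj (abs_le.2 ⟨?_, ?_⟩) (abs_le.2 ⟨?_, ?_⟩) <;> linarith

theorem centre_eq (hc : IsCentring m n ε k l cen) {i j : ℕ}
    (hr : m.real 9 i = m.real 9 j ∧ m.real 10 i = m.real 10 j) :
    cen j = tileCentre (rootAt m i - (ε / 2) • e₁) (k j, l j) := by
  rw [hc.cen_eq j, rootAt, rootAt, hr.1, hr.2]

theorem sameTile (hc : IsCentring m n ε k l cen) {i j : ℕ} (hi : i < n) (hj : j < n)
    (hr : m.real 9 i = m.real 9 j ∧ m.real 10 i = m.real 10 j) (hk : k i = k j) (hl : l i = l j) :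
    SameTile m i j :=
  ⟨hr.1, hr.2, by rw [hc.fst i hi, hc.fst j hj, hk], by rw [hc.snd i hi, hc.snd j hj, hl]⟩

theorem cen_congr (hc : IsCentring m n ε k l cen) {i j : ℕ} (hi : i < n) (hj : j < n)
    (h : SameTile m i j) : cen i = cen j := by
  have hk : k i = k j := by
    have := h.2.2.1; rw [hc.fst i hi, hc.fst j hj] at this; exact_mod_cast this
  have hl : l i = l j := by
    have := h.2.2.2; rw [hc.snd i hi, hc.snd j hj] at this; exact_mod_cast this
  rw [hc.centre_eq ⟨h.1, h.2.1⟩, hc.cen_eq i, hk, hl]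

/-- A point shared by a septa-hexagon and the one where `j` was placed forces equal roots. Both then
belong to one copy of the tiling, where a closed septa-hexagon does not meet the open cells of
another. -/
theorem mem_septaHexagon_iff (hc : IsCentring m n ε k l cen) (h : IsPrepared m n x y) {i j : ℕ}
    (hi : i < n) (hj : j < n) : pointAt m j ∈ septaHexagon (cen i) ↔ SameTile m j i := by
  constructor
  · intro hmem
    have ho := hc.inside j hj
    have hr := hc.roots_eq h hi hj hmem (openTile_subset _ ho) (by simp)
    rw [hc.centre_eq hr] at ho
    rw [hc.cen_eq i, mem_septaHexagon] at hmem
    change Tile OpenCell _ _ at ho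
    rw [xi_tileCentre, eta_tileCentre, ← sub_sub (xi _), ← sub_sub (eta _)] at hmem ho
    obtain ⟨h1, h2⟩ := tile_eq_of_open ho hmem
    exact (hc.sameTile hi hj hr h1.symm h2.symm).symm
  · intro hs
    rw [← hc.cen_congr hj hi hs]
    exact openTile_subset _ (hc.inside j hj)

theorem index_ne (hc : IsCentring m n ε k l cen) {i j : FirstIndex m n} (hij : i ≠ j)
    (hr : m.real 9 i.1 = m.real 9 j.1 ∧ m.real 10 i.1 = m.real 10 j.1) :
    ((k i.1, l i.1) : ℤ × ℤ) ≠ (k j.1, l j.1) := by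
  intro heq
  obtain ⟨h1, h2⟩ := Prod.mk.injEq _ _ _ _ ▸ heq
  exact hij (Subtype.ext (i.2.2.eq j.2.2 (hc.sameTile i.2.1 j.2.1 hr h1 h2)))

/-- With equal roots the claims are those for one tiling; with different roots no two points of the
septa-hexagons are within distance 2. -/
theorem isColouredSeptaPartition (hc : IsCentring m n ε k l cen) (h : IsPrepared m n x y)
    {S : Finset Plane} (hS : ∀ s ∈ S, ∃ i < n, pointAt m i = s) :
    IsColouredSeptaPartition S (fun i : FirstIndex m n => cen i.1) fun i => tileColour (k i.1, l i.1) := by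
  refine ⟨fun i j hij => ?_, fun s hs => ?_, fun i j hij hcol p hp q hq => ?_⟩
  · by_cases hr : m.real 9 i.1 = m.real 9 j.1 ∧ m.real 10 i.1 = m.real 10 j.1
    · have := nonOverlapping_tileCentre (rootAt m i.1 - (ε / 2) • e₁) _ _ (hc.index_ne hij hr)
      rwa [← hc.cen_eq, ← hc.centre_eq hr] at this
    · rw [Set.disjoint_left]
      intro p hp hp'
      exact hr (hc.roots_eq h i.2.1 j.2.1 (interior_subset hp) (interior_subset hp') (by simp))
  · obtain ⟨i, hi, rfl⟩ := hS s hs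
    obtain ⟨j, hj, hR, hs⟩ := exists_rep m i
    refine ⟨⟨j, by omega, hR⟩, ?_⟩
    have := openTile_subset_interior _ (hc.inside i hi)
    rwa [← hc.cen_congr (by omega) hi hs] at this
  · by_contra hcon
    have hr := hc.roots_eq h i.2.1 j.2.1 (interior_subset hp) (interior_subset hq) (not_lt.1 hcon)
    dsimp only at hp hq
    rw [hc.cen_eq i.1] at hp
    rw [hc.centre_eq hr] at hq
    exact hcon (sameColourFar_tileCentre _ _ _ (hc.index_ne hij hr) hcol p hp q hq)

theorem followsTiling (hc : IsCentring m n ε k l cen) (h : IsPrepared m n x y) :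
    FollowsTiling fun i : FirstIndex m n => cen i.1 := by
  rintro i j ⟨d, ⟨p, hp, hpd⟩, q, hq, hqd⟩
  rw [Metric.mem_closedBall] at hpd hqd
  have hr := hc.roots_eq h i.2.1 j.2.1 hp hq (by linarith [dist_triangle_right p q d])
  refine ⟨(k j.1 - k i.1, l j.1 - l i.1), ?_⟩
  dsimp only
  rw [hc.centre_eq hr, hc.cen_eq i.1]
  refine plane_ext ?_ ?_
  · simp only [xi_tileCentre]; push_cast; ring
  · simp only [eta_tileCentre]; push_cast; ring

end IsCentring

theorem near_iff_dist (m : Memory) (i j : ℕ) :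
    Near (m.real 3) (m.real 4) i j ↔ dist (pointAt m i) (pointAt m j) ≤ 1 := by
  rw [EuclideanSpace.dist_eq, Fin.sum_univ_two, Real.dist_eq, Real.dist_eq, sq_abs, sq_abs,
    Real.sqrt_le_iff]
  simp [Near, pointAt, sq]

theorem IsPrepared.pointAt_inj {m : Memory} {n : ℕ} {x y : ℕ → ℝ} (h : IsPrepared m n x y)
    (hxy : ∀ i < n, ∀ j < n, x i = x j → y i = y j → i = j) {i j : ℕ} (hi : i < n) (hj : j < n)
    (hij : pointAt m i = pointAt m j) : i = j := by
  have h0 : m.real 3 i = m.real 3 j := by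
    have := congrArg (fun p : Plane => p 0) hij; simpa [pointAt] using this
  have h1 : m.real 4 i = m.real 4 j := by
    have := congrArg (fun p : Plane => p 1) hij; simpa [pointAt] using this
  rw [h.sorted.fst i hi, h.sorted.fst j hj] at h0
  rw [h.sorted.snd i hi, h.sorted.snd j hj] at h1
  exact h.sorted.inj i hi j hj (hxy _ (h.sorted.lt i hi) _ (h.sorted.lt j hj) h0 h1)

open Classical in
-- Optimality passes from lists of indices to sets of points: a list has at least as many entries as
-- its set of points has elements, and a competing set comes from a list of the same length, because
-- distinct indices give distinct points.
theorem IsCentring.isSeptaOptimum {m : Memory} {n : ℕ} {x y : ℕ → ℝ} {ε : ℝ} {k l : ℕ → ℤ}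
    {cen : ℕ → Plane} (hc : IsCentring m n ε k l cen) (h : IsPrepared m n x y) {S : Finset Plane}
    (hS : ∀ s, s ∈ S ↔ ∃ i < n, pointAt m i = s)
    (hxy : ∀ i < n, ∀ j < n, x i = x j → y i = y j → i = j) {i : ℕ} (hi : i < n) {L : List ℕ}
    (hL : IsOptList (m.real 3) (m.real 4) (coverList m n i) (tileList m n i) L) :
    IsSeptaOptimum S (cen i) (L.toFinset.image (pointAt m)) := by
  have hpts : ∀ s, s ∈ pointsIn S (cen i) ↔ ∃ j ∈ tileList m n i, pointAt m j = s := by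
    intro s
    rw [mem_pointsIn, hS]
    constructor
    · rintro ⟨⟨j, hj, rfl⟩, hs⟩
      exact ⟨j, mem_tileList.2 ⟨hj, (hc.mem_septaHexagon_iff h hi hj).1 hs⟩, rfl⟩
    · rintro ⟨j, hj, rfl⟩
      obtain ⟨hjn, hs⟩ := mem_tileList.1 hj
      exact ⟨⟨j, hjn, rfl⟩, (hc.mem_septaHexagon_iff h hi hjn).2 hs⟩
  have hcov : ∀ s, s ∈ coverers (pointsIn S (cen i)) S ↔ ∃ q ∈ coverList m n i, pointAt m q = s := by
    intro s
    rw [mem_coverers, hS]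
    constructor
    · rintro ⟨⟨q, hq, rfl⟩, p, hp, hpq⟩
      obtain ⟨j, hj, rfl⟩ := (hpts p).1 hp
      exact ⟨q, mem_coverList.2 ⟨hq, j, hj, (near_iff_dist m j q).2 hpq⟩, rfl⟩
    · rintro ⟨q, hq, rfl⟩
      obtain ⟨hqn, j, hj, hjq⟩ := mem_coverList.1 hq
      exact ⟨⟨q, hqn, rfl⟩, _, (hpts _).2 ⟨j, hj, rfl⟩, (near_iff_dist m j q).1 hjq⟩
  obtain ⟨h1, h2, h3⟩ := hL
  refine ⟨⟨fun s hs => ?_, fun s hs => ?_⟩, fun D' hD' => ?_⟩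
  · obtain ⟨q, hq, rfl⟩ := Finset.mem_image.1 hs
    exact (hcov _).2 ⟨q, h1 q (List.mem_toFinset.1 hq), rfl⟩
  · obtain ⟨j, hj, rfl⟩ := (hpts s).1 hs
    obtain ⟨a, ha, haj⟩ := h2 j hj
    refine ⟨_, Finset.mem_image_of_mem _ (List.mem_toFinset.2 ha), ?_⟩
    rw [Metric.mem_closedBall]
    exact (near_iff_dist m j a).1 (near_comm.1 haj)
  · have hnd : (coverList m n i).Nodup := by
      unfold coverList select
      exact List.nodup_range.filter _
    -- The indices of the points of the competitor `D'`, without repetition.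
    set l' := (coverList m n i).filter (fun q => pointAt m q ∈ D') with hl'
    have hmem : ∀ q, q ∈ l' ↔ q ∈ coverList m n i ∧ pointAt m q ∈ D' := by
      intro q; simp [hl']
    have h4 := h3 l' (fun a ha => ((hmem a).1 ha).1) (by
      intro j hj
      obtain ⟨d, hd, hjd⟩ := hD'.2 _ ((hpts _).2 ⟨j, hj, rfl⟩)
      obtain ⟨q, hq, rfl⟩ := (hcov d).1 (hD'.1 hd)
      exact ⟨q, (hmem q).2 ⟨hq, hd⟩, near_comm.1 ((near_iff_dist m j q).2 hjd)⟩)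
    calc (L.toFinset.image (pointAt m)).card ≤ L.toFinset.card := Finset.card_image_le
      _ ≤ L.length := L.toFinset_card_le
      _ ≤ l'.length := h4
      _ = l'.toFinset.card := (List.toFinset_card_of_nodup (hnd.filter _)).symm
      _ ≤ D'.card := by
        refine Finset.card_le_card_of_injOn (pointAt m) ?_ ?_
        · intro q hq
          exact ((hmem q).1 (List.mem_toFinset.1 hq)).2
        · intro q hq q' hq' heq
          exact h.pointAt_inj hxy
            (mem_coverList.1 ((hmem q).1 (List.mem_toFinset.1 hq)).1).1
            (mem_coverList.1 ((hmem q').1 (List.mem_toFinset.1 hq')).1).1 heq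

/-! ### The running time and the assembled theorem -/

/-- For `2 ≤ n` one has `(n + 1) ^ 6 ≤ (3 / 2 * n) ^ 6 ≤ 12 * n ^ 6`, and `Nat.size n + 1 ≤ log₂ n +
2 ≤ 3 * log₂ n`, which is at most five times the natural logarithm. Hence the factor 60. -/
theorem time_bound (c : ℕ) {n : ℕ} (hn : 2 ≤ n) :
    ((c * ((n + 1) ^ 6 * (Nat.size n + 1)) : ℕ) : ℝ) ≤ 60 * c * (n : ℝ) ^ 6 * Real.log n := by
  have hn' : (2 : ℝ) ≤ n := by exact_mod_cast hn
  have hlog2 := Real.log_two_gt_d9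
  have hlog : Real.log 2 ≤ Real.log n := Real.log_le_log (by norm_num) hn'
  have hsz : ((Nat.size n + 1 : ℕ) : ℝ) ≤ 5 * Real.log n := by
    have h1 : 0 < Nat.size n := Nat.size_pos.2 (by omega)
    have h2 : 2 ^ (Nat.size n - 1) ≤ n := Nat.lt_size.1 (by omega)
    have h3 : ((Nat.size n - 1 : ℕ) : ℝ) * Real.log 2 ≤ Real.log n := by
      rw [← Real.log_pow]
      exact Real.log_le_log (by positivity) (by exact_mod_cast h2)
    rw [Nat.cast_sub h1] at h3
    push_cast at h3 ⊢
    have h4 : (0 : ℝ) ≤ (Nat.size n : ℝ) - 1 := by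
      have : (1 : ℝ) ≤ Nat.size n := by exact_mod_cast h1
      linarith
    nlinarith
  have hpow : ((n : ℝ) + 1) ^ 6 ≤ 12 * (n : ℝ) ^ 6 := by
    have h1 : ((n : ℝ) + 1) ≤ 3 / 2 * n := by linarith
    calc ((n : ℝ) + 1) ^ 6 ≤ (3 / 2 * n) ^ 6 := pow_le_pow_left₀ (by positivity) h1 6
      _ = 729 / 64 * (n : ℝ) ^ 6 := by ring
      _ ≤ 12 * (n : ℝ) ^ 6 := by gcongr; norm_num
  calc ((c * ((n + 1) ^ 6 * (Nat.size n + 1)) : ℕ) : ℝ)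
      = c * (((n : ℝ) + 1) ^ 6 * ((Nat.size n + 1 : ℕ) : ℝ)) := by push_cast; ring
    _ ≤ c * (12 * (n : ℝ) ^ 6 * (5 * Real.log n)) := by gcongr
    _ = 60 * c * (n : ℝ) ^ 6 * Real.log n := by ring

/-- The bound in terms of `Nat.size n` holds for every `n`, whereas `n ^ 6 * log n` vanishes for `n
≤ 1`. -/
theorem exists_algorithm : ∃ (prog : Program) (c : ℕ), ∀ (n : ℕ) (P : Fin n ↪ Plane),
    ∃ (T : ℕ) (m : Memory) (D : Finset Plane),
      Runs prog (inputMemory P) T m ∧ T ≤ c * ((n + 1) ^ 6 * (Nat.size n + 1)) ∧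
      IsOutput P m D ∧
      ∃ (ι : Type) (centre : ι → Plane) (colour : ι → Fin 4) (L : ι → Finset Plane),
        IsColouredSeptaPartition (Finset.univ.map P) centre colour ∧
        FollowsTiling centre ∧
        (∀ i, IsSeptaOptimum (Finset.univ.map P) (centre i) (L i)) ∧
        D = combine (Finset.univ.map P) L := by
  classical
  obtain ⟨c, hc⟩ := reaches_solveAll
  refine ⟨.seq prepare solveAll, 10 ^ 9 + 50 * c, fun n P => ?_⟩
  set m₀ := inputMemory P with hm₀
  have hx : ∀ i (hi : i < n), m₀.real 0 i = P ⟨i, hi⟩ 0 := fun i hi => by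
    simp [hm₀, inputMemory, hi]
  have hy : ∀ i (hi : i < n), m₀.real 1 i = P ⟨i, hi⟩ 1 := fun i hi => by
    simp [hm₀, inputMemory, hi]
  have hxy : ∀ i < n, ∀ j < n, m₀.real 0 i = m₀.real 0 j → m₀.real 1 i = m₀.real 1 j → i = j := by
    intro i hi j hj h0 h1
    rw [hx i hi, hx j hj] at h0
    rw [hy i hi, hy j hj] at h1
    have : P ⟨i, hi⟩ = P ⟨j, hj⟩ := by
      ext a; fin_cases a
      · exact h0
      · exact h1
    simpa using P.injective this
  have hrun := (reaches_prepare m₀ n (by simp [hm₀, inputMemory])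
    (by simp [hm₀, inputMemory])).seq
    (T₂ := c * ((n + 1) ^ 5 * (Nat.size n + 1) * (49 * n + n + 1)))
    -- The memory `m` reached after the preparation is carried along, because the placement and the
    -- solutions are described by its contents.
    (Q := fun m' => ∃ m, IsPrepared m n (m₀.real 0) (m₀.real 1) ∧ ∃ sol : ℕ → List ℕ,
        (∀ i < n, IsRep m i →
          IsOptList (m.real 3) (m.real 4) (coverList m n i) (tileList m n i) (sol i)) ∧
        ∀ x, x ∈ readList m' 2 1 ↔ ∃ i < n, IsRep m i ∧ ∃ a ∈ sol i, m.nat 5 a = x)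
    (fun m hm => (hc m n hm.prepared hm.output).mono (by
      rw [hm.log]
      have := hm.sum_tileWork_le
      gcongr) fun m' hm' => ⟨m, hm, hm'⟩)
  obtain ⟨T, m', hruns, hT, m, hm, sol, hsol, hout⟩ := hrun
  obtain ⟨ε, k, l, cen, hcen⟩ := hm.exists_centring
  have hpt : ∀ i (hi : i < n), pointAt m i = P ⟨m.nat 5 i, hm.sorted.lt i hi⟩ := by
    intro i hi
    ext a; fin_cases a
    · simp [pointAt, hm.sorted.fst i hi, hx _ (hm.sorted.lt i hi)]
    · simp [pointAt, hm.sorted.snd i hi, hy _ (hm.sorted.lt i hi)]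
  have hS : ∀ s, s ∈ Finset.univ.map P ↔ ∃ i < n, pointAt m i = s := by
    intro s
    simp only [Finset.mem_map, Finset.mem_univ, true_and]
    constructor
    · rintro ⟨⟨j, hj⟩, rfl⟩
      obtain ⟨i, hi, rfl⟩ := hm.sorted.surj j hj
      exact ⟨i, hi, hpt i hi⟩
    · rintro ⟨i, hi, rfl⟩
      exact ⟨_, (hpt i hi).symm⟩
  have hlt : ∀ i < n, IsRep m i → ∀ a ∈ sol i, a < n := fun i hi hR a ha =>
    (mem_coverList.1 ((hsol i hi hR).1 a ha)).1
  -- The family has one septa-hexagon for each representative point, so only occupied septa-hexagons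
  -- occur.
  refine ⟨T, m', combine (Finset.univ.map P) fun i : FirstIndex m n => (sol i.1).toFinset.image (pointAt m),
    hruns, hT.trans ?_, ⟨?_, ?_⟩, FirstIndex m n, fun i => cen i.1, _, _,
    hcen.isColouredSeptaPartition hm fun s hs => (hS s).1 hs, hcen.followsTiling hm,
    fun i => hcen.isSeptaOptimum hm hS hxy i.2.1 (hsol i.1 i.2.1 i.2.2), rfl⟩
  · have h1 : (n + 1) ^ 3 ≤ (n + 1) ^ 6 * (Nat.size n + 1) :=
      (Nat.pow_le_pow_right (by omega) (by norm_num)).trans (Nat.le_mul_of_pos_right _ (by omega))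
    have h2 : (n + 1) ^ 5 * (Nat.size n + 1) * (49 * n + n + 1) ≤
        50 * ((n + 1) ^ 6 * (Nat.size n + 1)) := by
      calc (n + 1) ^ 5 * (Nat.size n + 1) * (49 * n + n + 1)
          ≤ (n + 1) ^ 5 * (Nat.size n + 1) * (50 * (n + 1)) := Nat.mul_le_mul_left _ (by omega)
        _ = 50 * ((n + 1) ^ 6 * (Nat.size n + 1)) := by ring
    have h3 := Nat.mul_le_mul_left c h2
    have h4 : (10 ^ 9 + 50 * c) * ((n + 1) ^ 6 * (Nat.size n + 1)) =
      10 ^ 9 * ((n + 1) ^ 6 * (Nat.size n + 1)) +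
        c * (50 * ((n + 1) ^ 6 * (Nat.size n + 1))) := by ring
    omega
  · intro j hj
    obtain ⟨i, hi, hR, a, ha, hax⟩ := (hout _).1 (mem_readList.2 ⟨j, hj, rfl⟩)
    rw [← hax]
    exact hm.sorted.lt a (hlt i hi hR a ha)
  · intro p
    rw [mem_combine]
    constructor
    · rintro ⟨-, i, hp⟩
      obtain ⟨a, ha, rfl⟩ := Finset.mem_image.1 hp
      rw [List.mem_toFinset] at ha
      obtain ⟨j, hj, hja⟩ := mem_readList.1 ((hout _).2 ⟨i.1, i.2.1, i.2.2, a, ha, rfl⟩)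
      have han := hlt i.1 i.2.1 i.2.2 a ha
      exact ⟨j, hj, ⟨m.nat 5 a, hm.sorted.lt a han⟩, hja, (hpt a han).symm⟩
    · rintro ⟨j, hj, i', hji, rfl⟩
      refine ⟨by simp, ?_⟩
      obtain ⟨i, hi, hR, a, ha, hax⟩ := (hout _).1 (mem_readList.2 ⟨j, hj, rfl⟩)
      refine ⟨⟨i, hi, hR⟩, Finset.mem_image.2 ⟨a, List.mem_toFinset.2 ha, ?_⟩⟩
      rw [hpt a (hlt i hi hR a ha)]
      congr 1
      exact Fin.ext (hax.trans hji)

theorem theorem1 :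
    -- the septa-hexagons tile the plane, and the 4-colouring keeps equal colours apart
    (∀ t : Plane,
      (⋃ z : ℤ × ℤ, septaHexagon (tileCentre t z)) = Set.univ ∧
      NonOverlapping (tileCentre t) ∧
      SameColourFar (tileCentre t) tileColour) ∧
    -- some position of the tiling has no point of `S` on a boundary, and every such position
    -- gives a 4-coloured partition
    (∀ S : Finset Plane,
      (∃ t : Plane, ∀ s ∈ S, ∀ z, s ∉ frontier (septaHexagon (tileCentre t z))) ∧
      ∀ t : Plane, (∀ s ∈ S, ∀ z, s ∉ frontier (septaHexagon (tileCentre t z))) →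
        IsColouredSeptaPartition S (tileCentre t) tileColour) ∧
    -- optimum solutions of the single septa-hexagon problems exist and have at most 7 centres,
    -- and their union is a 4-approximation
    (∀ (S : Finset Plane) (ι : Type) (centre : ι → Plane) (colour : ι → Fin 4),
      IsColouredSeptaPartition S centre colour →
      (∀ i, ∃ D, IsSeptaOptimum S (centre i) D) ∧
      ∀ L : ι → Finset Plane, (∀ i, IsSeptaOptimum S (centre i) (L i)) →
        (∀ i, (L i).card ≤ 7) ∧ IsApproxMDS 4 S (combine S L)) ∧
    -- the algorithm and its running time
    (∃ (prog : Program) (K : ℝ), ∀ (n : ℕ) (P : Fin n ↪ Plane),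
      ∃ (T : ℕ) (m : Memory) (D : Finset Plane),
        Runs prog (inputMemory P) T m ∧
        (2 ≤ n → (T : ℝ) ≤ K * (n : ℝ) ^ 6 * Real.log n) ∧
        IsOutput P m D ∧
        (∃ (ι : Type) (centre : ι → Plane) (colour : ι → Fin 4) (L : ι → Finset Plane),
          IsColouredSeptaPartition (Finset.univ.map P) centre colour ∧
          FollowsTiling centre ∧
          (∀ i, IsSeptaOptimum (Finset.univ.map P) (centre i) (L i)) ∧
          D = combine (Finset.univ.map P) L) ∧
        IsApproxMDS 4 (Finset.univ.map P) D) := by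
  refine ⟨fun t => ⟨iUnion_septaHexagon t, nonOverlapping_tileCentre t, sameColourFar_tileCentre t⟩,
    fun S => ⟨exists_generic S, fun t => isColouredSeptaPartition_tileCentre⟩,
    fun S ι centre colour h => ⟨fun i => exists_septaOptimum S (centre i), fun L hL =>
      ⟨fun i => (hL i).card_le, isApproxMDS_combine h hL⟩⟩, ?_⟩
  obtain ⟨prog, c, h⟩ := exists_algorithm
  refine ⟨prog, 60 * c, fun n P => ?_⟩
  obtain ⟨T, m, D, hr, hT, hout, ι, centre, colour, L, hp, hf, hL, rfl⟩ := h n P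
  exact ⟨T, m, _, hr, fun hn => (Nat.cast_le.2 hT).trans (time_bound c hn), hout,
    ⟨ι, centre, colour, L, hp, hf, hL, rfl⟩, isApproxMDS_combine hp hL⟩
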